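/- **Setting.** Let $H\in\{2,-2\}$. A *definite affine sphere* on an open set $D\subseteq\mathbb C$ with invariants $(\psi,U,H)$ is a smooth map $r:D\to\mathbb R^3$ (centre at the origin, $z=x+iy$ a positively oriented conformal coordinate) whose affine metric $|\det\Lambda|^{-1/4}\Lambda$, $\Lambda_{ij}=\det(r_{ij},r_x,r_y)$, equals $e^\psi|dz|^2$, whose affine normal $\xi=\tfrac12\Delta^g r$ equals $-Hr$ (so the affine shape operator is $H\cdot\mathrm{Id}$), and whose cubic form is $U\,dz^3+\bar U\,d\bar z^3$, i.e. $r_{zz}=\psi_z r_z+Ue^{-\psi}r_{\bar z}$. Roots of negative numbers are $\sqrt{-x}=i\sqrt x$. For $\lambda\in\mathbb C^\times$ put $$\alpha_\lambda=\begin{pmatrix}\frac12(\psi_zdz-\psi_{\bar z}d\bar z)&\lambda^{-1}\bar Ue^{-\psi}d\bar z&\sqrt{-H/2}\,\lambda e^{\psi/2}dz\\ \lambda Ue^{-\psi}dz&\frac12(\psi_{\bar z}d\bar z-\psi_zdz)&\sqrt{-H/2}\,\lambda^{-1}e^{\psi/2}d\bar z\\ \sqrt{-H/2}\,\lambda^{-1}e^{\psi/2}d\bar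 z&\sqrt{-H/2}\,\lambda e^{\psi/2}dz&0\end{pmatrix}.$$ Let $\epsilon=e^{\pi i/3}$, $\tau(g)=T\bar gT^{-1}$, $\sigma(g)=P(g^t)^{-1}P^{-1}$ with $$T=\begin{pmatrix}0&1&0\\1&0&0\\0&0&-H/2\end{pmatrix},\qquad P=\begin{pmatrix}0&\epsilon^4&0\\ \epsilon^2&0&0\\0&0&1\end{pmatrix}.$$ $\Lambda^{\sigma,\tau}_{\mathbb C^\times}SL(3,\mathbb C)$ is the set of holomorphic $g:\mathbb C^\times\to SL(3,\mathbb C)$ with $\tau(g(\bar\lambda^{-1}))=g(\lambda)$ and $\sigma(g(\lambda))=g(\epsilon\lambda)$; $\Lambda^{\sigma,\tau}_IGL(3,\mathbb C)$ is the set of holomorphic $g:I\to GL(3,\mathbb C)$ with the same two conditions, where $I=\{|\lambda|<\rho\}\cup\{|\lambda|>1/\rho\}\cup\{\infty\}$ and $0<\rho<1$. Let $\Delta=\{z\in\mathbb C^3: 2z_1z_2=z_3^2\text{ or }z_3=0\}$, and for $\ell=\mathbb C(b,c,1)\not\subseteq\Delta$ let $$g_{\alpha,\ell}(\lambda)=I+\frac2{\lambda^3-\alpha^3}\begin{pmatrix}\frac{\alpha^3bc}{2bc-1}&\frac{\alpha\lambda^2c^2}{2bc-1}&\frac{\alpha^2\lambda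 c}{2bc-1}\\ \alpha^2\lambda b^2&\alpha^3bc&\alpha\lambda^2b\\ \alpha\lambda^2b&\alpha^2\lambda c&\alpha^3\end{pmatrix}.$$ **Theorem.** Let $r$ be a definite affine sphere on an open $D\subseteq\mathbb C$ with invariants $(\psi,U,H)$, $H=\pm2$. (1) On every open $\Omega\subseteq D$ that contains $0$ and is star-shaped about $0$ there is a normalized frame: a smooth invertible solution $E(z,\bar z,\lambda)$, $\lambda\in\mathbb C^\times$, of $E^{-1}dE=\alpha_\lambda$ with $E(0,0,\lambda)=I$. (2) Let $\Omega\subseteq D$ be open and connected with $0\in\Omega$ and let $E$ be a normalized frame on $\Omega$. Then $E(z,\bar z,\cdot)\in\Lambda^{\sigma,\tau}_{\mathbb C^\times}SL(3,\mathbb C)$ for all $z\in\Omega$, and there is a family $r_\lambda$, $|\lambda|=1$, of definite affine spheres on $\Omega$ with invariants $(\psi,\lambda^3U,H)$ and $r_1=r$, such that $F_\lambda=(\lambda^{-1}\sqrt{-2H}e^{-\psi/2}(r_\lambda)_z,\ \lambda\sqrt{-2H}e^{-\psi/2}(r_\lambda)_{\bar z},\ -Hr_\lambda)$ satisfies $F_\lambda(z)=F_\lambda(0)E(z,\bar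 z,\lambda)$. (3) In the situation of (2), let $\rho<|\alpha|<1/\rho$, $|\alpha|\ne1$, $d\in\mathbb C^\times$, let $\ell_i=\mathbb C(b_i,c_i,1)\not\subseteq\Delta$ $(i=1,2)$, $A=\mathrm{diag}(d,d^{-1},1)$, and let $h=A\,g_{\alpha,\ell_1}g_{\bar\alpha^{-1},\ell_2}\in\Lambda^{\sigma,\tau}_IGL(3,\mathbb C)$. Let $G\subseteq\Omega$ be the set of all points at which $\tilde\ell_2=\ell_2E(\bar\alpha^{-1})=\mathbb C(\tilde b_2,\tilde c_2,1)$ and $\tilde\ell_1=\ell_1g_{\bar\alpha^{-1},\ell_2}(\alpha)E(\alpha)g_{\bar\alpha^{-1},\tilde\ell_2}(\alpha)^{-1}=\mathbb C(\tilde b_1,\tilde c_1,1)$ are not in $\Delta$ and $(2\tilde b_1\tilde c_1-1)(2\tilde b_2\tilde c_2-1)>0$; on $G$ let $\tilde d=\sqrt{(2\tilde b_1\tilde c_1-1)(2\tilde b_2\tilde c_2-1)}$, $\tilde A=\mathrm{diag}(\tilde d,\tilde d^{-1},1)$ and $e^{\tilde\psi}=\tilde d^2e^\psi$. Then $G$ is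 open and for $z\in G$ there is a factorization $$A\,g_{\alpha,\ell_1}(\lambda)g_{\bar\alpha^{-1},\ell_2}(\lambda)\,E(z,\bar z,\lambda)=\tilde E(z,\bar z,\lambda)\,\tilde A\,g_{\alpha,\tilde\ell_1}(\lambda)g_{\bar\alpha^{-1},\tilde\ell_2}(\lambda)$$ with $\tilde E(z,\bar z,\cdot)\in\Lambda^{\sigma,\tau}_{\mathbb C^\times}SL(3,\mathbb C)$ and $\tilde A\,g_{\alpha,\tilde\ell_1}g_{\bar\alpha^{-1},\tilde\ell_2}\in\Lambda^{\sigma,\tau}_IGL(3,\mathbb C)$. On $G$, $\tilde E$ is smooth in $z$ and $\tilde E^{-1}d\tilde E$ is the form $\alpha_\lambda$ with $\psi$ replaced by $\tilde\psi$ and the same $U$ and $H$. For a $\mathbb C^3$-valued map $r$ put, with $s=\sqrt{-2H}\,e^{-\psi/2}$, $$\begin{aligned}\mathcal D_\lambda[r]=&\ \frac{\alpha\lambda^3\tilde b_1\{-2s[\lambda^3\bar\alpha^3(2\tilde b_2\tilde c_2-1)-1]r_{\bar z}+4s\bar\alpha^2\tilde c_2^2r_z+4H\bar\alpha\tilde c_2r\}}{(\lambda^3\bar\alpha^3+1)(2\tilde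 b_2\tilde c_2-1)(\lambda^3+\alpha^3)}\\&+\frac{\alpha^2\tilde c_1[4s\bar\alpha\lambda^3\tilde b_2^2r_{\bar z}+2s(\lambda^3\bar\alpha^3+1-2\tilde b_2\tilde c_2)r_z+4H\bar\alpha^2\lambda^3\tilde b_2r]}{(\lambda^3\bar\alpha^3+1)(\lambda^3+\alpha^3)}\\&+\frac{(-\lambda^3+\alpha^3)[2s\bar\alpha^2\lambda^3\tilde b_2r_{\bar z}-2s\bar\alpha\tilde c_2r_z+H(\lambda^3\bar\alpha^3-1)r]}{(\lambda^3\bar\alpha^3+1)(\lambda^3+\alpha^3)},\end{aligned}$$ $$N=\begin{pmatrix}\frac1{\sqrt2}&\frac1{\sqrt2}&0\\ \frac i{\sqrt2}&\frac{-i}{\sqrt2}&0\\0&0&\sqrt{-H/2}\end{pmatrix},\qquad \kappa=\frac{|\lambda^3+\alpha^3|^2}{|\lambda^3-\alpha^3|^2}.$$ For every $\lambda$ with $|\lambda|=1$ both $$\frac{(2\kappa)^{1/3}}{-H\sqrt{-H/2}}\,N\,\mathcal D_\lambda\big[-H^{-1}E(\cdot,\lambda)e_3\big]\qquad\text{and}\qquad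 \frac{\kappa^{1/3}}{H}\,\mathcal D_\lambda[r_\lambda]$$ are real, and each of them is a definite affine sphere on $G$ with frame $\tilde E(\cdot,\lambda)$ up to a constant matrix factor on the left, affine metric $\tilde d^2e^\psi|dz|^2$, and the same cubic form (given by $\lambda^3U$) and the same affine mean curvature $H$ as $r_\lambda$. -/

import Mathlib

open scoped ContDiff ComplexOrder Matrix

noncomputable section

namespace AffineSphere

/-! ### Definite affine spheres in a conformal coordinate -/

/-- Directional derivative of a real function on the plane. -/
def pd (v : ℂ) (f : ℂ → ℝ) (z : ℂ) : ℝ := fderiv ℝ f z v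

/-- The coordinate directions `x`, `y` of the plane. -/
def coordDir : Fin 2 → ℂ := ![1, Complex.I]

/-- `∂f/∂z = (f_x - i f_y) / 2`. -/
def dz (f : ℂ → ℂ) (z : ℂ) : ℂ :=
  (fderiv ℝ f z 1 - Complex.I * fderiv ℝ f z Complex.I) / 2

/-- `∂f/∂z̄ = (f_x + i f_y) / 2`. -/
def dzbar (f : ℂ → ℂ) (z : ℂ) : ℂ :=
  (fderiv ℝ f z 1 + Complex.I * fderiv ℝ f z Complex.I) / 2

/-- The coefficients `Λ_ij = det (r_ij, r_x, r_y)` of the fundamental equiaffine form. -/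
def fundamentalForm (r : ℂ → Fin 3 → ℝ) (z : ℂ) : Matrix (Fin 2) (Fin 2) ℝ :=
  Matrix.of fun i j => Matrix.det (Matrix.of
    ![fun k => pd (coordDir i) (pd (coordDir j) fun w => r w k) z,
      fun k => pd (coordDir 0) (fun w => r w k) z,
      fun k => pd (coordDir 1) (fun w => r w k) z])

/-- The affine metric `g = |det Λ|^{-1/4} Λ` of a surface (for the orientation `dx ∧ dy`). -/
def affineMetric (r : ℂ → Fin 3 → ℝ) (z : ℂ) : Matrix (Fin 2) (Fin 2) ℝ :=
  |(fundamentalForm r z).det| ^ (-(1 / 4) : ℝ) • fundamentalForm r z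

/-- The Laplace-Beltrami operator of a metric `g` on the plane. -/
def laplaceBeltrami (g : ℂ → Matrix (Fin 2) (Fin 2) ℝ) (f : ℂ → ℝ) (z : ℂ) : ℝ :=
  (√(g z).det)⁻¹ * ∑ i : Fin 2, pd (coordDir i)
    (fun w => √(g w).det * ∑ j : Fin 2, (g w)⁻¹ i j * pd (coordDir j) f w) z

/-- The affine normal `ξ = (Δ^g r) / 2`, with `g` the affine metric. -/
def affineNormal (r : ℂ → Fin 3 → ℝ) (z : ℂ) : Fin 3 → ℝ :=
  fun k => laplaceBeltrami (affineMetric r) (fun w => r w k) z / 2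

/-- `r` is, on the open set `D`, a definite affine sphere centred at the origin, with
conformal coordinate `z` compatible with its orientation, affine metric `e^ψ |dz|²`, affine
cubic form `U dz³ + Ū dz̄³` and affine mean curvature `H ≠ 0`. -/
structure IsDefiniteAffineSphere (D : Set ℂ) (r : ℂ → Fin 3 → ℝ) (ψ : ℂ → ℝ) (U : ℂ → ℂ)
    (H : ℝ) : Prop where
  smooth : ContDiffOn ℝ ∞ r D
  metric : ∀ z ∈ D, affineMetric r z = Real.exp (ψ z) • (1 : Matrix (Fin 2) (Fin 2) ℝ)
  /-- The affine normal lines meet in the origin, `ξ = -H r`; differentiating, `dξ = -H dr`,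
  that is, the affine shape operator is `H • Id`. -/
  sphere : ∀ z ∈ D, affineNormal r z = -H • r z
  /-- By the formula of Gauss `r_zz` is the image of `∇_{∂z} ∂z`, with `∇` the Blaschke
  connection, and `ψ_z ∂z` is the Levi-Civita derivative; so this says that the difference of
  the two connections is `U e^{-ψ} ∂z̄` on `(∂z, ∂z)`. -/
  cubic : ∀ z ∈ D, ∀ k, dz (dz fun w => (r w k : ℂ)) z =
    dz (fun w => (ψ w : ℂ)) z * dz (fun w => (r w k : ℂ)) z
      + U z * (Real.exp (-ψ z) : ℂ) * dzbar (fun w => (r w k : ℂ)) z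

/-! ### Frames -/

/-- The coefficient of `dz` in the Maurer-Cartan form with loop parameter `l`. -/
def connZ (H : ℝ) (ψ : ℂ → ℝ) (U : ℂ → ℂ) (l z : ℂ) : Matrix (Fin 3) (Fin 3) ℂ :=
  !![dz (fun w => (ψ w : ℂ)) z / 2, 0,
      Complex.sqrt ((-H / 2 : ℝ) : ℂ) * l * (Real.exp (ψ z / 2) : ℂ);
    l * U z * (Real.exp (-ψ z) : ℂ), -(dz (fun w => (ψ w : ℂ)) z / 2), 0;
    0, Complex.sqrt ((-H / 2 : ℝ) : ℂ) * l * (Real.exp (ψ z / 2) : ℂ), 0]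

/-- The coefficient of `dz̄` in the Maurer-Cartan form with loop parameter `l`. -/
def connZbar (H : ℝ) (ψ : ℂ → ℝ) (U : ℂ → ℂ) (l z : ℂ) : Matrix (Fin 3) (Fin 3) ℂ :=
  !![-(dzbar (fun w => (ψ w : ℂ)) z / 2),
      l⁻¹ * (starRingEnd ℂ) (U z) * (Real.exp (-ψ z) : ℂ), 0;
    0, dzbar (fun w => (ψ w : ℂ)) z / 2,
      Complex.sqrt ((-H / 2 : ℝ) : ℂ) * l⁻¹ * (Real.exp (ψ z / 2) : ℂ);
    Complex.sqrt ((-H / 2 : ℝ) : ℂ) * l⁻¹ * (Real.exp (ψ z / 2) : ℂ), 0, 0]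

/-- `E (z, l)` is an extended frame on `Ω`: for each `l ≠ 0` it solves `E⁻¹ dE = α_l`. -/
structure IsExtendedFrame (Ω : Set ℂ) (H : ℝ) (ψ : ℂ → ℝ) (U : ℂ → ℂ)
    (E : ℂ → ℂ → Matrix (Fin 3) (Fin 3) ℂ) : Prop where
  smooth : ∀ l : ℂ, l ≠ 0 → ∀ i j, ContDiffOn ℝ ∞ (fun z => E z l i j) Ω
  det_ne_zero : ∀ l : ℂ, l ≠ 0 → ∀ z ∈ Ω, (E z l).det ≠ 0
  eq_dz : ∀ l : ℂ, l ≠ 0 → ∀ z ∈ Ω,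
    (Matrix.of fun i j => dz (fun w => E w l i j) z) = E z l * connZ H ψ U l z
  eq_dzbar : ∀ l : ℂ, l ≠ 0 → ∀ z ∈ Ω,
    (Matrix.of fun i j => dzbar (fun w => E w l i j) z) = E z l * connZbar H ψ U l z

/-- An extended frame with `E (0, l) = I`. -/
structure IsNormalizedFrame (Ω : Set ℂ) (H : ℝ) (ψ : ℂ → ℝ) (U : ℂ → ℂ)
    (E : ℂ → ℂ → Matrix (Fin 3) (Fin 3) ℂ) : Prop extends IsExtendedFrame Ω H ψ U E where
  base : ∀ l : ℂ, l ≠ 0 → E 0 l = 1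

/-- The frame `(l⁻¹ √(-2H) e^{-ψ/2} r_z, l √(-2H) e^{-ψ/2} r_z̄, -H r)` of a surface. -/
def surfaceFrame (H : ℝ) (ψ : ℂ → ℝ) (r : ℂ → Fin 3 → ℝ) (l z : ℂ) :
    Matrix (Fin 3) (Fin 3) ℂ :=
  Matrix.of fun k =>
    ![l⁻¹ * Complex.sqrt ((-2 * H : ℝ) : ℂ) * (Real.exp (-ψ z / 2) : ℂ)
        * dz (fun w => (r w k : ℂ)) z,
      l * Complex.sqrt ((-2 * H : ℝ) : ℂ) * (Real.exp (-ψ z / 2) : ℂ)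
        * dzbar (fun w => (r w k : ℂ)) z,
      -(H : ℂ) * (r z k : ℂ)]

/-! ### Twisted loop groups -/

/-- `ε = e^{πi/3}`. -/
def eps : ℂ := Complex.exp (Real.pi * Complex.I / 3)

def matT (H : ℝ) : Matrix (Fin 3) (Fin 3) ℂ := !![0, 1, 0; 1, 0, 0; 0, 0, -(H : ℂ) / 2]

def matP : Matrix (Fin 3) (Fin 3) ℂ := !![0, eps ^ 4, 0; eps ^ 2, 0, 0; 0, 0, 1]

/-- `τ(g) = T ḡ T⁻¹`. -/
def tau (H : ℝ) (g : Matrix (Fin 3) (Fin 3) ℂ) : Matrix (Fin 3) (Fin 3) ℂ :=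
  matT H * g.map (starRingEnd ℂ) * (matT H)⁻¹

/-- `σ(g) = P (gᵗ)⁻¹ P⁻¹`. -/
def sigma (g : Matrix (Fin 3) (Fin 3) ℂ) : Matrix (Fin 3) (Fin 3) ℂ :=
  matP * (gᵀ)⁻¹ * matP⁻¹

/-- Holomorphic maps `ℂˣ → SL(3, ℂ)` with both reality conditions. -/
structure InLoopSL (H : ℝ) (g : ℂ → Matrix (Fin 3) (Fin 3) ℂ) : Prop where
  holo : ∀ i j, DifferentiableOn ℂ (fun l => g l i j) {l | l ≠ 0}
  det_eq_one : ∀ l : ℂ, l ≠ 0 → (g l).det = 1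
  tau_eq : ∀ l : ℂ, l ≠ 0 → tau H (g ((starRingEnd ℂ) l)⁻¹) = g l
  sigma_eq : ∀ l : ℂ, l ≠ 0 → sigma (g l) = g (eps * l)

/-- The finite points of `I = {|l| < ρ} ∪ {|l| > 1/ρ} ∪ {∞}`. -/
def nearZeroInfty (ρ : ℝ) : Set ℂ := {l | ‖l‖ < ρ ∨ ρ⁻¹ < ‖l‖}

/-- Holomorphic maps `I → GL(3, ℂ)` with both reality conditions; `G` is the map in the
coordinate `m = 1/l` at `∞`. -/
structure InLoopI (H ρ : ℝ) (g : ℂ → Matrix (Fin 3) (Fin 3) ℂ) : Prop where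
  holo_zero : ∀ i j, DifferentiableOn ℂ (fun l => g l i j) (Metric.ball 0 ρ)
  holo_infty : ∃ G : ℂ → Matrix (Fin 3) (Fin 3) ℂ,
    (∀ i j, DifferentiableOn ℂ (fun m => G m i j) (Metric.ball 0 ρ)) ∧
    (∀ m ∈ Metric.ball (0 : ℂ) ρ, m ≠ 0 → G m = g m⁻¹) ∧ (G 0).det ≠ 0
  det_ne_zero : ∀ l ∈ nearZeroInfty ρ, (g l).det ≠ 0
  tau_eq : ∀ l ∈ nearZeroInfty ρ, l ≠ 0 → tau H (g ((starRingEnd ℂ) l)⁻¹) = g l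
  sigma_eq : ∀ l ∈ nearZeroInfty ρ, sigma (g l) = g (eps * l)

/-! ### Simple elements -/

/-- The cone `Δ`; a line is contained in it iff one of its nonzero vectors lies in it. -/
def cone : Set (Fin 3 → ℂ) := {v | 2 * v 0 * v 1 = v 2 ^ 2 ∨ v 2 = 0}

/-- The coordinates `b`, `c` of a line `ℂ v = ℂ (b, c, 1)`. -/
def lineB (v : Fin 3 → ℂ) : ℂ := v 0 / v 2

def lineC (v : Fin 3 → ℂ) : ℂ := v 1 / v 2

/-- The simple element `g_{α,ℓ}` for `ℓ = ℂ (b, c, 1)`. -/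
def simpleElt (α b c l : ℂ) : Matrix (Fin 3) (Fin 3) ℂ :=
  1 + (2 / (l ^ 3 - α ^ 3)) •
    !![α ^ 3 * b * c / (2 * b * c - 1), α * l ^ 2 * c ^ 2 / (2 * b * c - 1),
        α ^ 2 * l * c / (2 * b * c - 1);
      α ^ 2 * l * b ^ 2, α ^ 3 * b * c, α * l ^ 2 * b;
      α * l ^ 2 * b, α ^ 2 * l * c, α ^ 3]

/-- `A g_{α,ℓ₁} g_{1/ᾱ,ℓ₂}` with `A = diag (d, 1/d, 1)`. -/
def sixPole (α d b₁ c₁ b₂ c₂ l : ℂ) : Matrix (Fin 3) (Fin 3) ℂ :=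
  Matrix.diagonal ![d, d⁻¹, 1] * simpleElt α b₁ c₁ l
    * simpleElt ((starRingEnd ℂ) α)⁻¹ b₂ c₂ l

/-! ### The dressed data -/

/-- A vector spanning `ℓ̃₂ = ℓ₂ E(1/ᾱ)`. -/
def line₂ (E : ℂ → ℂ → Matrix (Fin 3) (Fin 3) ℂ) (α b₂ c₂ z : ℂ) : Fin 3 → ℂ :=
  ![b₂, c₂, 1] ᵥ* E z ((starRingEnd ℂ) α)⁻¹

def b₂t (E : ℂ → ℂ → Matrix (Fin 3) (Fin 3) ℂ) (α b₂ c₂ z : ℂ) : ℂ :=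
  lineB (line₂ E α b₂ c₂ z)

def c₂t (E : ℂ → ℂ → Matrix (Fin 3) (Fin 3) ℂ) (α b₂ c₂ z : ℂ) : ℂ :=
  lineC (line₂ E α b₂ c₂ z)

/-- A vector spanning `ℓ̃₁ = ℓ₁ g_{1/ᾱ,ℓ₂}(α) E(α) g_{1/ᾱ,ℓ̃₂}(α)⁻¹`. -/
def line₁ (E : ℂ → ℂ → Matrix (Fin 3) (Fin 3) ℂ) (α b₁ c₁ b₂ c₂ z : ℂ) : Fin 3 → ℂ :=
  ![b₁, c₁, 1] ᵥ* (simpleElt ((starRingEnd ℂ) α)⁻¹ b₂ c₂ α * E z α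
    * (simpleElt ((starRingEnd ℂ) α)⁻¹ (b₂t E α b₂ c₂ z) (c₂t E α b₂ c₂ z) α)⁻¹)

def b₁t (E : ℂ → ℂ → Matrix (Fin 3) (Fin 3) ℂ) (α b₁ c₁ b₂ c₂ z : ℂ) : ℂ :=
  lineB (line₁ E α b₁ c₁ b₂ c₂ z)

def c₁t (E : ℂ → ℂ → Matrix (Fin 3) (Fin 3) ℂ) (α b₁ c₁ b₂ c₂ z : ℂ) : ℂ :=
  lineC (line₁ E α b₁ c₁ b₂ c₂ z)

/-- `(2 b̃₁ c̃₁ - 1) (2 b̃₂ c̃₂ - 1)`. -/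
def prodT (E : ℂ → ℂ → Matrix (Fin 3) (Fin 3) ℂ) (α b₁ c₁ b₂ c₂ z : ℂ) : ℂ :=
  (2 * b₁t E α b₁ c₁ b₂ c₂ z * c₁t E α b₁ c₁ b₂ c₂ z - 1)
    * (2 * b₂t E α b₂ c₂ z * c₂t E α b₂ c₂ z - 1)

/-- The points of `Ω` at which neither `ℓ̃₁` nor `ℓ̃₂` is in `Δ` and the product above is
a positive real number. -/
def regularSet (Ω : Set ℂ) (E : ℂ → ℂ → Matrix (Fin 3) (Fin 3) ℂ) (α b₁ c₁ b₂ c₂ : ℂ) :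
    Set ℂ :=
  {z | z ∈ Ω ∧ line₂ E α b₂ c₂ z ∉ cone ∧ line₁ E α b₁ c₁ b₂ c₂ z ∉ cone ∧
    0 < prodT E α b₁ c₁ b₂ c₂ z}

/-- `d̃ = √((2 b̃₁ c̃₁ - 1) (2 b̃₂ c̃₂ - 1))`. -/
def dt (E : ℂ → ℂ → Matrix (Fin 3) (Fin 3) ℂ) (α b₁ c₁ b₂ c₂ z : ℂ) : ℝ :=
  √(prodT E α b₁ c₁ b₂ c₂ z).re

/-- The new conformal factor: `e^ψ̃ = d̃² e^ψ`. -/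
def psiT (ψ : ℂ → ℝ) (E : ℂ → ℂ → Matrix (Fin 3) (Fin 3) ℂ) (α b₁ c₁ b₂ c₂ z : ℂ) : ℝ :=
  Real.log (dt E α b₁ c₁ b₂ c₂ z ^ 2 * Real.exp (ψ z))

/-- `Ã g_{α,ℓ̃₁} g_{1/ᾱ,ℓ̃₂}`. -/
def sixPoleT (E : ℂ → ℂ → Matrix (Fin 3) (Fin 3) ℂ) (α b₁ c₁ b₂ c₂ z l : ℂ) :
    Matrix (Fin 3) (Fin 3) ℂ :=
  sixPole α (dt E α b₁ c₁ b₂ c₂ z : ℂ) (b₁t E α b₁ c₁ b₂ c₂ z) (c₁t E α b₁ c₁ b₂ c₂ z)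
    (b₂t E α b₂ c₂ z) (c₂t E α b₂ c₂ z) l

/-- The explicit combination of `r`, `r_z`, `r_z̄`, for one coordinate function of the surface;
`s = √(-2H) e^{-ψ/2}` and `b₁ c₁ b₂ c₂` are the coordinates of the transformed lines. -/
def dressingFormula (H : ℝ) (s α b₁ c₁ b₂ c₂ l r rz rzb : ℂ) : ℂ :=
  α * l ^ 3 * b₁ *
      (-2 * s * (l ^ 3 * (starRingEnd ℂ) α ^ 3 * (2 * b₂ * c₂ - 1) - 1) * rzb
        + 4 * s * (starRingEnd ℂ) α ^ 2 * c₂ ^ 2 * rz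
        + 4 * H * (starRingEnd ℂ) α * c₂ * r)
      / ((l ^ 3 * (starRingEnd ℂ) α ^ 3 + 1) * (2 * b₂ * c₂ - 1) * (l ^ 3 + α ^ 3))
    + α ^ 2 * c₁ *
      (4 * s * (starRingEnd ℂ) α * l ^ 3 * b₂ ^ 2 * rzb
        + 2 * s * (l ^ 3 * (starRingEnd ℂ) α ^ 3 + 1 - 2 * b₂ * c₂) * rz
        + 4 * H * (starRingEnd ℂ) α ^ 2 * l ^ 3 * b₂ * r)
      / ((l ^ 3 * (starRingEnd ℂ) α ^ 3 + 1) * (l ^ 3 + α ^ 3))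
    + (-l ^ 3 + α ^ 3) *
      (2 * s * (starRingEnd ℂ) α ^ 2 * l ^ 3 * b₂ * rzb
        - 2 * s * (starRingEnd ℂ) α * c₂ * rz
        + H * (l ^ 3 * (starRingEnd ℂ) α ^ 3 - 1) * r)
      / ((l ^ 3 * (starRingEnd ℂ) α ^ 3 + 1) * (l ^ 3 + α ^ 3))

/-- The explicit formula applied to a `ℂ³`-valued map `r`. -/
def dressed (H : ℝ) (ψ : ℂ → ℝ) (E : ℂ → ℂ → Matrix (Fin 3) (Fin 3) ℂ)
    (α b₁ c₁ b₂ c₂ l : ℂ) (r : ℂ → Fin 3 → ℂ) (z : ℂ) : Fin 3 → ℂ :=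
  fun k => dressingFormula H
    (Complex.sqrt ((-2 * H : ℝ) : ℂ) * (Real.exp (-ψ z / 2) : ℂ)) α
    (b₁t E α b₁ c₁ b₂ c₂ z) (c₁t E α b₁ c₁ b₂ c₂ z) (b₂t E α b₂ c₂ z) (c₂t E α b₂ c₂ z) l
    (r z k) (dz (fun w => r w k) z) (dzbar (fun w => r w k) z)

/-- The matrix `N` that turns the complex frame into a real one. -/
def matN (H : ℝ) : Matrix (Fin 3) (Fin 3) ℂ :=
  !![1 / (√2 : ℝ), 1 / (√2 : ℝ), 0;
    Complex.I / (√2 : ℝ), -Complex.I / (√2 : ℝ), 0;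
    0, 0, Complex.sqrt ((-H / 2 : ℝ) : ℂ)]

/-- The `ℂ³`-valued map `-H⁻¹ E₃`, with `E₃` the last column of the normalized frame: the
surface `r_l` in the complex position in which its frame is `E (·, l)` itself. -/
def normalizedPosition (H : ℝ) (E : ℂ → ℂ → Matrix (Fin 3) (Fin 3) ℂ) (l z : ℂ) : Fin 3 → ℂ :=
  fun k => -(H : ℂ)⁻¹ * E z l k 2

/-- `|l³ + α³|² / |l³ - α³|²`, which is `-det (A g_{α,ℓ₁} g_{1/ᾱ,ℓ₂}) (l)` for `|l| = 1`. -/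
def negDet (α l : ℂ) : ℝ := ‖l ^ 3 + α ^ 3‖ ^ 2 / ‖l ^ 3 - α ^ 3‖ ^ 2

end AffineSphere

end

open AffineSphere

open scoped ContDiff ComplexOrder Matrix

noncomputable section

namespace AffineSphere

open Complex Topology

/-! Frames and the associated family. Flatness of `α_λ` is equivalent to the equations of Gauss and
Codazzi, and these do not contain `λ` (`hasWM_conn`). The moving frame of `r` solves the system at
`λ = 1`, so the equations hold (`gaussCodazzi_of_frame`) and the system is integrable for every `λ ≠
0`. Solutions are built by parallel transport along rays. The ordinary differential equation is
solved by inverting `1 - V`, with `V` a Volterra operator depending linearly on the coefficients;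
this gives differentiability in `z` and holomorphy in `λ` from the same construction
(`exists_frame_of_flat`). The involutions `τ` and `σ` carry solutions to solutions with the same
initial value, so uniqueness puts the normalized frame in the loop group
(`inLoopSL_of_normalizedFrame`). Conversely, a solution with the right determinant and with last
column `-H` times a real vector is the frame of an affine sphere (`sphere_of_frame`). For `C E` with
a suitable constant `C` this produces `r_λ`, and later the dressed spheres.

Dressing one line. Up to the denominator, `g_{α,ℓ}(α)` has rank one with row space `ℓ`, while `ℓ` is
annihilated by the numerator of the inverse at `α`. With `ℓ' = ℓ E(α)` the numerator of `g_{α,ℓ} E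
g_{α,ℓ'}⁻¹` therefore vanishes at `α`, and by the `σ`-symmetry at all six points with `λ⁶ = α⁶`; the
quotient is holomorphic on `ℂˣ` (`exists_dressing`). Two such steps, at `1/ᾱ` and at `α`, give the
factorization.

Reality. One factor alone only respects `σ`. For the product, the failure of `τ`-reality of the new
frame, `Ẽ⁻¹ τ(Ẽ(1/λ̄))`, equals near `0` and `∞` an expression in the new six-pole element alone. By
Liouville it is a constant diagonal matrix; comparing its values at `0` and `∞` shows that
`(2b̃₁c̃₁-1)(2b̃₂c̃₂-1)` is real, and `d̃ d̃̄` equal to this number makes the constant `1`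
(`tau_dressing`).

The new system. The lines move by Riccati equations, and these are what makes the gauge transform by
a simple element keep the shape of `α_λ` (`simpleElt_mul_formZ`, `simpleElt_mul_formW`). The torus
factor `Ã` then distributes the scaling evenly between the `dz` and `dz̄` parts, which is the change
`e^ψ ↦ d̃² e^ψ` with `U` unchanged (`DressingData.solvesOn_mul_sixPoleT_inv`).

The formulas. `𝒟_λ[r]` is the last column of the frame of `r` times the inverse of the new six-pole
element (`dressingFormula_eq`, `DressingData.dressed_eq`). On the unit circle the old six-pole
element `h` is `τ`-real with determinant `-κ`, so a real scalar involving `κ^{1/3}` restores the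
determinant `-iH` required of a frame (`DressingData.exists_dressed_sphere`). -/

/-! ### Wirtinger calculus -/

/-- The real-linear map `v ↦ p v + q v̄`. -/
def wirt (p q : ℂ) : ℂ →L[ℝ] ℂ :=
  p • (ContinuousLinearMap.id ℝ ℂ) + q • (Complex.conjCLE : ℂ →L[ℝ] ℂ)

@[simp] lemma wirt_apply (p q v : ℂ) : wirt p q v = p * v + q * (starRingEnd ℂ) v := by
  simp [wirt]

/-- `f` is differentiable at `z` with `df = p dz + q dz̄`. -/
def HasW (f : ℂ → ℂ) (p q z : ℂ) : Prop := HasFDerivAt f (wirt p q) z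

lemma HasW.dz_eq {f : ℂ → ℂ} {p q z : ℂ} (h : HasW f p q z) : dz f z = p := by
  unfold dz
  rw [HasFDerivAt.fderiv h]
  simp only [wirt_apply, map_one, conj_I]
  ring_nf
  simp only [I_sq]
  ring

lemma HasW.dzbar_eq {f : ℂ → ℂ} {p q z : ℂ} (h : HasW f p q z) : dzbar f z = q := by
  unfold dzbar
  rw [HasFDerivAt.fderiv h]
  simp only [wirt_apply, map_one, conj_I]
  ring_nf
  simp only [I_sq]
  ring

/-- Every real-linear map of the plane has the form `v ↦ p v + q v̄`, and `p`, `q` are found from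
its values at `1` and `I`. -/
lemma hasW_of_differentiableAt {f : ℂ → ℂ} {z : ℂ} (h : DifferentiableAt ℝ f z) :
    HasW f (dz f z) (dzbar f z) z := by
  unfold HasW
  convert! h.hasFDerivAt using 1
  ext v
  have hv : fderiv ℝ f z v = v.re * fderiv ℝ f z 1 + v.im * fderiv ℝ f z I := by
    have : v = v.re • (1 : ℂ) + v.im • I := by simp [Complex.re_add_im]
    conv_lhs => rw [this, map_add, map_smul, map_smul]
    simp
  have e1 := re_add_im v
  have e2 : (v.re : ℂ) - v.im * I = (starRingEnd ℂ) v := by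
    apply Complex.ext <;> simp
  rw [hv, wirt_apply, ← e2, dz, dzbar]
  linear_combination (-(v.im * fderiv ℝ f z I) : ℂ) * I_sq -
    (fderiv ℝ f z 1 - I * fderiv ℝ f z I) / 2 * e1

lemma HasW.differentiableAt {f : ℂ → ℂ} {p q z : ℂ} (h : HasW f p q z) :
    DifferentiableAt ℝ f z := HasFDerivAt.differentiableAt h

lemma HasW.continuousAt {f : ℂ → ℂ} {p q z : ℂ} (h : HasW f p q z) :
    ContinuousAt f z := HasFDerivAt.continuousAt h

lemma hasW_const (c z : ℂ) : HasW (fun _ => c) 0 0 z := by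
  unfold HasW
  convert! hasFDerivAt_const (𝕜 := ℝ) c z using 1
  ext; simp

lemma HasW.congr_deriv {f : ℂ → ℂ} {p q p' q' z : ℂ} (h : HasW f p q z) (hp : p = p')
    (hq : q = q') : HasW f p' q' z := by
  subst hp hq; exact h

lemma HasW.congr {f g : ℂ → ℂ} {p q z : ℂ} (h : HasW f p q z) (hg : g =ᶠ[𝓝 z] f) :
    HasW g p q z := HasFDerivAt.congr_of_eventuallyEq h hg

lemma HasW.add {f g : ℂ → ℂ} {p q p' q' z : ℂ} (hf : HasW f p q z) (hg : HasW g p' q' z) :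
    HasW (fun w => f w + g w) (p + p') (q + q') z := by
  unfold HasW at *
  convert! HasFDerivAt.add hf hg using 1
  ext
  simp
  ring

lemma HasW.sum {ι : Type*} (s : Finset ι) {f : ι → ℂ → ℂ} {p q : ι → ℂ} {z : ℂ}
    (h : ∀ i ∈ s, HasW (f i) (p i) (q i) z) :
    HasW (fun w => ∑ i ∈ s, f i w) (∑ i ∈ s, p i) (∑ i ∈ s, q i) z := by
  classical
  induction s using Finset.induction_on with
  | empty => simpa using hasW_const 0 z
  | insert a s ha ih =>
    simp only [Finset.sum_insert ha]
    exact (h a (by simp)).add (ih fun i hi => h i (by simp [hi]))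

/-- A complex derivative multiplies both coefficients by the same number; the rules for negation,
inverse and exponential are instances. -/
lemma HasW.comp_holo {f g : ℂ → ℂ} {p q g' z : ℂ} (hf : HasW f p q z)
    (hg : HasDerivAt g g' (f z)) : HasW (fun w => g (f w)) (g' * p) (g' * q) z := by
  unfold HasW at *
  convert! (hg.hasFDerivAt.restrictScalars ℝ).comp z hf using 1
  ext
  simp
  ring

lemma HasW.neg {f : ℂ → ℂ} {p q z : ℂ} (hf : HasW f p q z) :
    HasW (fun w => -f w) (-p) (-q) z := by
  simpa using hf.comp_holo (hasDerivAt_neg (f z))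

lemma HasW.sub {f g : ℂ → ℂ} {p q p' q' z : ℂ} (hf : HasW f p q z) (hg : HasW g p' q' z) :
    HasW (fun w => f w - g w) (p - p') (q - q') z := by
  simpa [sub_eq_add_neg] using hf.add hg.neg

lemma HasW.mul {f g : ℂ → ℂ} {p q p' q' z : ℂ} (hf : HasW f p q z) (hg : HasW g p' q' z) :
    HasW (fun w => f w * g w) (p * g z + f z * p') (q * g z + f z * q') z := by
  unfold HasW at *
  convert! HasFDerivAt.mul hf hg using 1
  ext
  simp
  ring

lemma HasW.const_mul {f : ℂ → ℂ} {p q z : ℂ} (c : ℂ) (hf : HasW f p q z) :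
    HasW (fun w => c * f w) (c * p) (c * q) z := by
  simpa using (hasW_const c z).mul hf

lemma HasW.inv {f : ℂ → ℂ} {p q z : ℂ} (hf : HasW f p q z) (h0 : f z ≠ 0) :
    HasW (fun w => (f w)⁻¹) (-p / f z ^ 2) (-q / f z ^ 2) z :=
  (hf.comp_holo (hasDerivAt_inv h0)).congr_deriv (by ring) (by ring)

lemma HasW.div {f g : ℂ → ℂ} {p q p' q' z : ℂ} (hf : HasW f p q z) (hg : HasW g p' q' z)
    (h0 : g z ≠ 0) :
    HasW (fun w => f w / g w) ((p * g z - f z * p') / g z ^ 2)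
      ((q * g z - f z * q') / g z ^ 2) z := by
  simp only [div_eq_mul_inv (f _)]
  exact (hf.mul (hg.inv h0)).congr_deriv (by field_simp; ring) (by field_simp; ring)

/-- The exchange of the two coefficients is what makes `τ` exchange the `dz` and `dz̄` parts of the
connection form. -/
lemma HasW.conj {f : ℂ → ℂ} {p q z : ℂ} (hf : HasW f p q z) :
    HasW (fun w => (starRingEnd ℂ) (f w)) ((starRingEnd ℂ) q) ((starRingEnd ℂ) p) z := by
  unfold HasW at *
  convert! ((Complex.conjCLE : ℂ →L[ℝ] ℂ).hasFDerivAt.comp z hf) using 1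
  ext
  simp
  ring

lemma HasW.cexp {f : ℂ → ℂ} {p q z : ℂ} (hf : HasW f p q z) :
    HasW (fun w => Complex.exp (f w)) (Complex.exp (f z) * p) (Complex.exp (f z) * q) z :=
  hf.comp_holo (Complex.hasDerivAt_exp (f z))

lemma HasW.unique {f : ℂ → ℂ} {p q p' q' z : ℂ} (h : HasW f p q z) (h' : HasW f p' q' z) :
    p = p' ∧ q = q' := ⟨h.dz_eq.symm.trans h'.dz_eq, h.dzbar_eq.symm.trans h'.dzbar_eq⟩

/-- A smooth function on an open set has smooth Wirtinger derivatives. -/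
lemma contDiffOn_dz {f : ℂ → ℂ} {Ω : Set ℂ} (hΩ : IsOpen Ω) (hf : ContDiffOn ℝ ∞ f Ω) :
    ContDiffOn ℝ ∞ (dz f) Ω := by
  have h := hf.fderiv_of_isOpen hΩ (m := ∞) (by simp)
  have h1 := h.clm_apply (contDiffOn_const (c := (1 : ℂ)))
  have h2 := h.clm_apply (contDiffOn_const (c := I))
  exact (h1.sub (contDiffOn_const.mul h2)).div_const 2

lemma contDiffOn_dzbar {f : ℂ → ℂ} {Ω : Set ℂ} (hΩ : IsOpen Ω) (hf : ContDiffOn ℝ ∞ f Ω) :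
    ContDiffOn ℝ ∞ (dzbar f) Ω := by
  have h := hf.fderiv_of_isOpen hΩ (m := ∞) (by simp)
  have h1 := h.clm_apply (contDiffOn_const (c := (1 : ℂ)))
  have h2 := h.clm_apply (contDiffOn_const (c := I))
  exact (h1.add (contDiffOn_const.mul h2)).div_const 2

lemma hasW_of_contDiffOn {f : ℂ → ℂ} {Ω : Set ℂ} (hΩ : IsOpen Ω) (hf : ContDiffOn ℝ ∞ f Ω)
    {z : ℂ} (hz : z ∈ Ω) : HasW f (dz f z) (dzbar f z) z :=
  hasW_of_differentiableAt ((hf.differentiableOn (by simp)).differentiableAt (hΩ.mem_nhds hz))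

/-- Second derivatives commute. -/
lemma dz_dzbar_comm {f : ℂ → ℂ} {Ω : Set ℂ} (hΩ : IsOpen Ω) (hf : ContDiffOn ℝ ∞ f Ω)
    {z : ℂ} (hz : z ∈ Ω) : dz (dzbar f) z = dzbar (dz f) z := by
  have hsym : IsSymmSndFDerivAt ℝ f z :=
    (hf.contDiffAt (hΩ.mem_nhds hz)).isSymmSndFDerivAt (by simp; exact ENat.LEInfty.out)
  have hD : DifferentiableAt ℝ (fderiv ℝ f) z :=
    ((hf.fderiv_of_isOpen hΩ (m := ∞) (by simp)).differentiableOn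
      (by simp)).differentiableAt (hΩ.mem_nhds hz)
  have e (v : ℂ) : HasFDerivAt (fun w => fderiv ℝ f w v) ((fderiv ℝ (fderiv ℝ f) z).flip v) z := by
    simpa using hD.hasFDerivAt.clm_apply (hasFDerivAt_const v z)
  have e1 : HasFDerivAt (dz f) _ z :=
    ((e 1).sub ((e I).const_smul I)).const_smul (2⁻¹ : ℂ) |>.congr_of_eventuallyEq
      (Filter.Eventually.of_forall fun w => by simp [dz]; ring)
  have e2 : HasFDerivAt (dzbar f) _ z :=
    ((e 1).add ((e I).const_smul I)).const_smul (2⁻¹ : ℂ) |>.congr_of_eventuallyEq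
      (Filter.Eventually.of_forall fun w => by simp [dzbar]; ring)
  rw [dz, dzbar, e1.fderiv, e2.fderiv]
  have := hsym 1 I
  simp [this]
  ring

/-- A function with smooth Wirtinger derivatives of order `n` is of order `n + 1`. -/
lemma contDiffOn_succ_of_hasW {f p q : ℂ → ℂ} {Ω : Set ℂ} (hΩ : IsOpen Ω) {n : ℕ}
    (h : ∀ z ∈ Ω, HasW f (p z) (q z) z) (hp : ContDiffOn ℝ n p Ω) (hq : ContDiffOn ℝ n q Ω) :
    ContDiffOn ℝ (n + 1 : ℕ) f Ω := by
  push_cast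
  rw [contDiffOn_succ_iff_fderiv_of_isOpen hΩ]
  refine ⟨fun z hz => (h z hz).differentiableAt.differentiableWithinAt, by simp, ?_⟩
  have : ContDiffOn ℝ n (fun z => wirt (p z) (q z)) Ω := by
    unfold wirt
    exact (hp.smul contDiffOn_const).add (hq.smul contDiffOn_const)
  exact this.congr fun z hz => HasFDerivAt.fderiv (h z hz)

/-! ### Matrix-valued maps -/

abbrev M3 := Matrix (Fin 3) (Fin 3) ℂ

/-- Entrywise `dF = P dz + Q dz̄` at `z`. -/
def HasWM (F : ℂ → M3) (P Q : M3) (z : ℂ) : Prop :=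
  ∀ i j, HasW (fun w => F w i j) (P i j) (Q i j) z

lemma HasWM.congr {F G : ℂ → M3} {P Q : M3} {z : ℂ} (h : HasWM F P Q z) (hg : G =ᶠ[𝓝 z] F) :
    HasWM G P Q z := fun i j => (h i j).congr (hg.mono fun w hw => by simp [hw])

lemma HasWM.congr_deriv {F : ℂ → M3} {P Q P' Q' : M3} {z : ℂ} (h : HasWM F P Q z) (hP : P = P')
    (hQ : Q = Q') : HasWM F P' Q' z := by subst hP hQ; exact h

lemma HasWM.unique {F : ℂ → M3} {P Q P' Q' : M3} {z : ℂ} (h : HasWM F P Q z)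
    (h' : HasWM F P' Q' z) : P = P' ∧ Q = Q' :=
  ⟨Matrix.ext fun i j => ((h i j).unique (h' i j)).1,
    Matrix.ext fun i j => ((h i j).unique (h' i j)).2⟩

lemma hasWM_const (C : M3) (z : ℂ) : HasWM (fun _ => C) 0 0 z := fun i j => hasW_const (C i j) z

lemma HasWM.mul {F G : ℂ → M3} {P Q P' Q' : M3} {z : ℂ} (hF : HasWM F P Q z)
    (hG : HasWM G P' Q' z) :
    HasWM (fun w => F w * G w) (P * G z + F z * P') (Q * G z + F z * Q') z := by
  intro i j
  simp only [Matrix.mul_apply, Matrix.add_apply, ← Finset.sum_add_distrib]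
  exact HasW.sum _ fun k _ => (hF i k).mul (hG k j)

lemma HasWM.const_mul {F : ℂ → M3} {P Q : M3} {z : ℂ} (C : M3) (hF : HasWM F P Q z) :
    HasWM (fun w => C * F w) (C * P) (C * Q) z := by
  simpa using (hasWM_const C z).mul hF

lemma HasWM.det {F : ℂ → M3} {P Q : M3} {z : ℂ} (hF : HasWM F P Q z) :
    HasW (fun w => (F w).det) ((F z).adjugate * P).trace ((F z).adjugate * Q).trace z := by
  simp only [Matrix.det_fin_three]
  refine ((((((hF 0 0).mul (hF 1 1)).mul (hF 2 2)).sub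
    (((hF 0 0).mul (hF 1 2)).mul (hF 2 1))).sub
    (((hF 0 1).mul (hF 1 0)).mul (hF 2 2))).add
    (((hF 0 1).mul (hF 1 2)).mul (hF 2 0))).add
    (((hF 0 2).mul (hF 1 0)).mul (hF 2 1)) |>.sub
    (((hF 0 2).mul (hF 1 1)).mul (hF 2 0)) |>.congr_deriv ?_ ?_ <;>
  · rw [Matrix.trace_fin_three]
    simp only [Matrix.mul_apply, Fin.sum_univ_three, Matrix.adjugate_fin_three]
    simp
    ring

lemma HasWM.differentiableAt_inv {F : ℂ → M3} {P Q : M3} {z : ℂ} (hF : HasWM F P Q z)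
    (h0 : (F z).det ≠ 0) (i j : Fin 3) : DifferentiableAt ℝ (fun w => (F w)⁻¹ i j) z := by
  have hd : DifferentiableAt ℝ (fun w => ((F w).det)⁻¹) z := (hF.det.inv h0).differentiableAt
  have h (a b : Fin 3) : DifferentiableAt ℝ (fun w => F w a b) z := (hF a b).differentiableAt
  have e : (fun w => (F w)⁻¹ i j) = fun w => ((F w).det)⁻¹ * (F w).adjugate i j := by
    ext w; simp [Matrix.inv_def]
  rw [e]
  refine hd.mul ?_
  simp only [Matrix.adjugate_fin_three]
  fin_cases i <;> fin_cases j <;> simp <;> fun_prop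

lemma HasWM.inv {F : ℂ → M3} {P Q : M3} {z : ℂ} (hF : HasWM F P Q z) (h0 : (F z).det ≠ 0) :
    HasWM (fun w => (F w)⁻¹) (-((F z)⁻¹ * P * (F z)⁻¹)) (-((F z)⁻¹ * Q * (F z)⁻¹)) z := by
  -- Differentiability comes from the adjugate formula; the value of the derivative is then forced
  -- by differentiating `F F⁻¹ = 1`.
  have h1 : HasWM (fun w => (F w)⁻¹) (Matrix.of fun i j => dz (fun w => (F w)⁻¹ i j) z)
      (Matrix.of fun i j => dzbar (fun w => (F w)⁻¹ i j) z) z := fun i j =>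
    hasW_of_differentiableAt (hF.differentiableAt_inv h0 i j)
  have hu : IsUnit (F z).det := isUnit_iff_ne_zero.mpr h0
  have hne : ∀ᶠ w in 𝓝 z, (F w).det ≠ 0 := hF.det.continuousAt.eventually_ne h0
  have h2 : HasWM (fun w => F w * (F w)⁻¹) 0 0 z := (hasWM_const 1 z).congr <|
    hne.mono fun w hw => Matrix.mul_nonsing_inv _ (isUnit_iff_ne_zero.mpr hw)
  obtain ⟨e1, e2⟩ := (hF.mul h1).unique h2
  have key : ∀ X Y : M3, X * (F z)⁻¹ + F z * Y = 0 → Y = -((F z)⁻¹ * X * (F z)⁻¹) := by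
    intro X Y h
    have : (F z)⁻¹ * (X * (F z)⁻¹ + F z * Y) = 0 := by rw [h, mul_zero]
    rw [mul_add, ← mul_assoc, ← mul_assoc, Matrix.nonsing_inv_mul _ hu, one_mul] at this
    exact eq_neg_of_add_eq_zero_right this
  exact h1.congr_deriv (key _ _ e1) (key _ _ e2)

/-- Entrywise smoothness on a set. -/
def SmoothM (F : ℂ → M3) (Ω : Set ℂ) : Prop := ∀ i j, ContDiffOn ℝ ∞ (fun z => F z i j) Ω

lemma SmoothM.mul {F G : ℂ → M3} {Ω : Set ℂ} (hF : SmoothM F Ω) (hG : SmoothM G Ω) :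
    SmoothM (fun z => F z * G z) Ω := by
  intro i j
  simp only [Matrix.mul_apply]
  exact ContDiffOn.sum fun k _ => (hF i k).mul (hG k j)

lemma SmoothM.inv {F : ℂ → M3} {Ω : Set ℂ} (hF : SmoothM F Ω) (h0 : ∀ z ∈ Ω, (F z).det ≠ 0) :
    SmoothM (fun z => (F z)⁻¹) Ω := by
  have hd : ContDiffOn ℝ ∞ (fun w => ((F w).det)⁻¹) Ω := by
    refine ContDiffOn.inv ?_ h0
    simp only [Matrix.det_fin_three]
    have h := hF
    unfold SmoothM at h
    fun_prop
  intro i j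
  have e : (fun w => (F w)⁻¹ i j) = fun w => ((F w).det)⁻¹ * (F w).adjugate i j := by
    ext w; simp [Matrix.inv_def]
  rw [e]
  refine hd.mul ?_
  have h := hF
  unfold SmoothM at h
  simp only [Matrix.adjugate_fin_three]
  fin_cases i <;> fin_cases j <;> simp <;> fun_prop

lemma SmoothM.hasWM {F : ℂ → M3} {Ω : Set ℂ} (hΩ : IsOpen Ω) (hF : SmoothM F Ω) {z : ℂ}
    (hz : z ∈ Ω) : HasWM F (Matrix.of fun i j => dz (fun w => F w i j) z)
      (Matrix.of fun i j => dzbar (fun w => F w i j) z) z :=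
  fun i j => hasW_of_contDiffOn hΩ (hF i j) hz

/-- A solution of `dF = F (Z dz + W dz̄)` with smooth coefficients is smooth. -/
lemma smoothM_of_hasWM {F Z W : ℂ → M3} {Ω : Set ℂ} (hΩ : IsOpen Ω) (hZ : SmoothM Z Ω)
    (hW : SmoothM W Ω) (h : ∀ z ∈ Ω, HasWM F (F z * Z z) (F z * W z) z) : SmoothM F Ω := by
  -- Bootstrapping: if `F` is of class `Cⁿ`, then so is `dF = F (Z dz + W dz̄)`, hence `F` is of
  -- class `Cⁿ⁺¹`.
  have key : ∀ n : ℕ, ∀ i j, ContDiffOn ℝ n (fun z => F z i j) Ω := by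
    intro n
    induction n with
    | zero =>
      intro i j
      rw [Nat.cast_zero, contDiffOn_zero]
      exact fun z hz => (h z hz i j).continuousAt.continuousWithinAt
    | succ n ih =>
      intro i j
      refine contDiffOn_succ_of_hasW hΩ (fun z hz => h z hz i j) ?_ ?_ <;>
      · simp only [Matrix.mul_apply]
        refine ContDiffOn.sum fun k _ => (ih i k).mul ?_
        first
        | exact (hZ k j).of_le (by exact_mod_cast le_top)
        | exact (hW k j).of_le (by exact_mod_cast le_top)
  exact fun i j => contDiffOn_infty.mpr fun n => key n i j

lemma eqOn_of_hasWM_zero {F : ℂ → M3} {Ω : Set ℂ} (hΩ : IsOpen Ω) (hc : IsPreconnected Ω)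
    (h : ∀ z ∈ Ω, HasWM F 0 0 z) {x y : ℂ} (hx : x ∈ Ω) (hy : y ∈ Ω) : F x = F y := by
  ext i j
  refine hΩ.is_const_of_fderiv_eq_zero (𝕜 := ℝ) hc (f := fun z => F z i j)
    (fun z hz => (h z hz i j).differentiableAt.differentiableWithinAt) ?_ hx hy
  intro z hz
  have : HasFDerivAt (fun w => F w i j) (wirt 0 0) z := h z hz i j
  rw [this.fderiv]
  ext; simp

/-- Two solutions of the same linear system on a connected open set differ by a constant
left factor. -/
lemma frame_unique {F E Z W : ℂ → M3} {Ω : Set ℂ} (hΩ : IsOpen Ω) (hc : IsPreconnected Ω)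
    (hF : ∀ z ∈ Ω, HasWM F (F z * Z z) (F z * W z) z)
    (hE : ∀ z ∈ Ω, HasWM E (E z * Z z) (E z * W z) z) (h0 : ∀ z ∈ Ω, (E z).det ≠ 0)
    {x y : ℂ} (hx : x ∈ Ω) (hy : y ∈ Ω) : F y = F x * (E x)⁻¹ * E y := by
  -- In `d(F E⁻¹)` the connection form enters once from `dF` and once, with the opposite sign, from
  -- `d(E⁻¹)`.
  have key : ∀ z ∈ Ω, HasWM (fun w => F w * (E w)⁻¹) 0 0 z := by
    intro z hz
    have hu : IsUnit (E z).det := isUnit_iff_ne_zero.mpr (h0 z hz)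
    refine ((hF z hz).mul ((hE z hz).inv (h0 z hz))).congr_deriv ?_ ?_ <;>
    · rw [← mul_assoc (E z)⁻¹ (E z), Matrix.nonsing_inv_mul _ hu, one_mul]
      simp [mul_assoc]
  have h1 := eqOn_of_hasWM_zero hΩ hc key hx hy
  have hu : IsUnit (E y).det := isUnit_iff_ne_zero.mpr (h0 y hy)
  rw [h1, mul_assoc, Matrix.nonsing_inv_mul _ hu, mul_one]

/-- The determinant of a solution of a trace-free linear system is constant. -/
lemma det_const_of_hasWM {F Z W : ℂ → M3} {Ω : Set ℂ} (hΩ : IsOpen Ω) (hc : IsPreconnected Ω)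
    (hF : ∀ z ∈ Ω, HasWM F (F z * Z z) (F z * W z) z) (hZ : ∀ z ∈ Ω, (Z z).trace = 0)
    (hW : ∀ z ∈ Ω, (W z).trace = 0) {x y : ℂ} (hx : x ∈ Ω) (hy : y ∈ Ω) :
    (F x).det = (F y).det := by
  -- Jacobi's formula: the derivative is `tr(adj(F) F Z) = det F · tr Z`.
  have key : ∀ z ∈ Ω, HasW (fun w => (F w).det) 0 0 z := by
    intro z hz
    refine (hF z hz).det.congr_deriv ?_ ?_ <;>
    · rw [← mul_assoc, Matrix.adjugate_mul, Matrix.smul_mul, one_mul, Matrix.trace_smul]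
      simp [hZ z hz, hW z hz]
  refine hΩ.is_const_of_fderiv_eq_zero (𝕜 := ℝ) hc (f := fun z => (F z).det)
    (fun z hz => (key z hz).differentiableAt.differentiableWithinAt) ?_ hx hy
  intro z hz
  have : HasFDerivAt (fun w => (F w).det) (wirt 0 0) z := key z hz
  rw [this.fderiv]
  ext; simp

/-! ### Linear differential equations in a Banach algebra -/

section LinearODE

open unitInterval

set_option linter.unusedSectionVars false
variable {𝔸 : Type*} [NormedRing 𝔸] [NormedAlgebra ℂ 𝔸] [CompleteSpace 𝔸]

/-- Clamping the argument extends a function on `[0, 1]` to the line, so that integrals and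
two-sided derivatives make sense at the end points. -/
lemma continuous_comp_projIcc (f : C(I, 𝔸)) :
    Continuous fun s : ℝ => f (Set.projIcc 0 1 zero_le_one s) :=
  f.continuous.comp continuous_projIcc

lemma hasDerivAt_integral_projIcc (f : C(I, 𝔸)) (t : ℝ) :
    HasDerivAt (fun t : ℝ => ∫ s in (0 : ℝ)..t, f (Set.projIcc 0 1 zero_le_one s))
      (f (Set.projIcc 0 1 zero_le_one t)) t :=
  intervalIntegral.integral_hasDerivAt_right
    ((continuous_comp_projIcc f).intervalIntegrable _ _)
    ((continuous_comp_projIcc f).stronglyMeasurableAtFilter _ _)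
    (continuous_comp_projIcc f).continuousAt

/-- `1 - Tⁿ` is invertible and is the product of `1 - T` with the geometric sum; commuting factors
of a unit are units. -/
lemma isUnit_one_sub_of_norm_pow_lt_one {X : Type*} [NormedAddCommGroup X] [NormedSpace ℂ X]
    [CompleteSpace X] {T : X →L[ℂ] X} {n : ℕ} (h : ‖T ^ n‖ < 1) : IsUnit (1 - T) := by
  have h1 : IsUnit (1 - T ^ n) := isUnit_one_sub_of_norm_lt_one h
  rw [← mul_neg_geom_sum] at h1
  have hc : Commute (1 - T) (∑ i ∈ Finset.range n, T ^ i) :=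
    Commute.sum_right _ _ _ fun i _ =>
      ((Commute.one_left _).sub_left (Commute.refl _)).pow_right i
  exact (hc.isUnit_mul_iff.mp h1).1

/-- The solution `e` of `e - V A e = x`. -/
def resolventSol {X Y : Type*} [NormedAddCommGroup X] [NormedSpace ℂ X]
    [NormedAddCommGroup Y] [NormedSpace ℂ Y] (V : Y →L[ℂ] X →L[ℂ] X) (x : X) (A : Y) : X :=
  Ring.inverse (1 - V A) x

lemma resolventSol_sub {X Y : Type*} [NormedAddCommGroup X] [NormedSpace ℂ X]
    [NormedAddCommGroup Y] [NormedSpace ℂ Y] (V : Y →L[ℂ] X →L[ℂ] X) (x : X) (A : Y)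
    (hV : IsUnit (1 - V A)) : resolventSol V x A - V A (resolventSol V x A) = x := by
  have h := Ring.mul_inverse_cancel _ hV
  exact congrArg (fun T : X →L[ℂ] X => T x) h

lemma eq_of_sub_apply_eq {X : Type*} [NormedAddCommGroup X] [NormedSpace ℂ X]
    {T : X →L[ℂ] X} (hT : IsUnit (1 - T)) {x y : X} (h : x - T x = y - T y) : x = y := by
  obtain ⟨u, hu⟩ := hT
  have hx (w : X) : (↑u⁻¹ : X →L[ℂ] X) (w - T w) = w := by
    have : w - T w = (u : X →L[ℂ] X) w := by rw [hu]; rfl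
    rw [this, ← mul_apply_eq_comp, Units.inv_mul]; rfl
  rw [← hx x, h, hx y]

/-- Smooth dependence on the coefficients costs nothing in this form: `V` is linear in `A`, and
inversion is smooth near a unit. -/
lemma contDiff_resolventSol {X Y : Type*} [NormedAddCommGroup X] [NormedSpace ℂ X]
    [CompleteSpace X] [NormedAddCommGroup Y] [NormedSpace ℂ Y] (V : Y →L[ℂ] X →L[ℂ] X)
    (hV : ∀ A, IsUnit (1 - V A)) (x : X) :
    ContDiff ℂ ∞ (resolventSol V x) := by
  rw [contDiff_iff_contDiffAt]
  intro A
  obtain ⟨u, hu⟩ := hV A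
  have h1 : ContDiffAt ℂ ∞ (fun A => 1 - V A) A := contDiffAt_const.sub V.contDiff.contDiffAt
  have h2 := contDiffAt_ringInverse ℂ u (n := ∞)
  rw [hu] at h2
  exact (h2.comp A h1).clm_apply contDiffAt_const

/-- Bounded operators, and bounded families of them, on a normed space. -/
abbrev Op (X : Type*) [NormedAddCommGroup X] [NormedSpace ℂ X] := X →L[ℂ] X

abbrev OpFamily (X : Type*) [NormedAddCommGroup X] [NormedSpace ℂ X] := X →L[ℂ] X →L[ℂ] X

/-- The family `A ↦ (e ↦ J (e A))`. -/
def mulThen {X : Type*} [NormedRing X] [NormedAlgebra ℂ X] (J : Op X) : OpFamily X :=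
  (ContinuousLinearMap.compL ℂ _ _ _ J) ∘L (ContinuousLinearMap.mul ℂ X).flip

/-- Integration from `0`, as an operator on continuous functions. -/
def integrate : Op C(I, 𝔸) :=
  LinearMap.mkContinuous
    { toFun := fun f => ⟨fun t => ∫ s in (0 : ℝ)..t, f (Set.projIcc 0 1 zero_le_one s),
        (continuous_iff_continuousAt.mpr fun t =>
          (hasDerivAt_integral_projIcc f t).continuousAt).comp continuous_subtype_val⟩
      map_add' := fun f g => by
        ext t
        exact intervalIntegral.integral_add ((continuous_comp_projIcc f).intervalIntegrable _ _)
          ((continuous_comp_projIcc g).intervalIntegrable _ _)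
      map_smul' := fun c f => by
        ext t
        exact intervalIntegral.integral_smul c _ } 1 <| by
    intro f
    rw [one_mul, ContinuousMap.norm_le _ (norm_nonneg f)]
    intro t
    have h := intervalIntegral.norm_integral_le_of_norm_le_const (a := (0 : ℝ)) (b := t)
      (f := fun s => f (Set.projIcc 0 1 zero_le_one s)) (C := ‖f‖) fun s _ => f.norm_coe_le_norm _
    refine h.trans ?_
    rw [sub_zero, abs_of_nonneg t.2.1]
    exact mul_le_of_le_one_right (norm_nonneg f) t.2.2

lemma integrate_apply (f : C(I, 𝔸)) (t : I) :
    integrate f t = ∫ s in (0 : ℝ)..t, f (Set.projIcc 0 1 zero_le_one s) := rfl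

/-- The Volterra operator `e ↦ ∫ e A`. -/
def volterra : OpFamily C(I, 𝔸) :=
  mulThen integrate

lemma volterra_apply (A e : C(I, 𝔸)) : volterra A e = integrate (e * A) := rfl

/-- The bound keeps the dependence on `t`, because integrating `sⁿ` at the next step is what
produces the factorial. -/
lemma norm_volterra_pow_apply_le (A e : C(I, 𝔸)) (n : ℕ) (t : I) :
    ‖(volterra A ^ n) e t‖ ≤ (‖A‖ * t) ^ n / n.factorial * ‖e‖ := by
  induction n generalizing t with
  | zero => simpa using e.norm_coe_le_norm t
  | succ n ih =>
    rw [pow_succ', mul_apply_eq_comp, volterra_apply, integrate_apply]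
    have hb : ∀ s ∈ Set.Ioc (0 : ℝ) t,
        ‖(((volterra A ^ n) e) * A) (Set.projIcc 0 1 zero_le_one s)‖
          ≤ ‖A‖ ^ (n + 1) / n.factorial * ‖e‖ * s ^ n := by
      intro s hs
      have hs' : s ∈ Set.Icc (0 : ℝ) 1 := ⟨hs.1.le, hs.2.trans t.2.2⟩
      rw [Set.projIcc_of_mem _ hs', ContinuousMap.mul_apply]
      refine (norm_mul_le _ _).trans ?_
      calc _ ≤ ((‖A‖ * s) ^ n / n.factorial * ‖e‖) * ‖A‖ :=
            mul_le_mul (ih ⟨s, hs'⟩) (A.norm_coe_le_norm _) (norm_nonneg _)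
              (by have := hs'.1; positivity)
        _ = _ := by rw [mul_pow]; ring
    refine (intervalIntegral.norm_integral_le_of_norm_le t.2.1
      (MeasureTheory.ae_of_all _ hb) (Continuous.intervalIntegrable (by fun_prop) _ _)).trans ?_
    rw [intervalIntegral.integral_const_mul, integral_pow, Nat.factorial_succ, mul_pow]
    push_cast
    apply le_of_eq
    have : (n.factorial : ℝ) ≠ 0 := by exact_mod_cast n.factorial_ne_zero
    field_simp
    simp

/-- Factorials beat powers, so some power of the Volterra operator is a contraction, whatever the
size of `A`. -/
lemma isUnit_one_sub_volterra (A : C(I, 𝔸)) : IsUnit (1 - volterra A) := by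
  obtain ⟨n, hn⟩ : ∃ n : ℕ, ‖A‖ ^ n / n.factorial < 1 :=
    ((FloorSemiring.tendsto_pow_div_factorial_atTop ‖A‖).eventually_lt_const one_pos).exists
  have hle : ‖volterra A ^ n‖ ≤ ‖A‖ ^ n / n.factorial := by
    refine ContinuousLinearMap.opNorm_le_bound _ (by positivity) fun e => ?_
    rw [ContinuousMap.norm_le _ (by positivity)]
    intro t
    refine (norm_volterra_pow_apply_le A e n t).trans ?_
    have h1 : (‖A‖ * t) ^ n ≤ ‖A‖ ^ n :=
      pow_le_pow_left₀ (mul_nonneg (norm_nonneg _) t.2.1)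
        (mul_le_of_le_one_right (norm_nonneg _) t.2.2) n
    gcongr
  exact isUnit_one_sub_of_norm_pow_lt_one (hle.trans_lt hn)

/-- The solution of `e' = e A`, `e 0 = 1`, on the unit interval. -/
def odeSol (A : C(I, 𝔸)) : C(I, 𝔸) := resolventSol volterra 1 A

lemma odeSol_eq (A : C(I, 𝔸)) : odeSol A = 1 + integrate (odeSol A * A) := by
  have h3 : odeSol A - integrate (odeSol A * A) = 1 :=
    resolventSol_sub volterra 1 A (isUnit_one_sub_volterra A)
  rw [← h3]; abel

lemma odeSol_zero : odeSol (0 : C(I, 𝔸)) = 1 := by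
  rw [odeSol_eq]; simp

lemma contDiff_odeSol : ContDiff ℂ ∞ (odeSol : C(I, 𝔸) → C(I, 𝔸)) :=
  contDiff_resolventSol volterra isUnit_one_sub_volterra 1

/-- The integral expression equals `odeSol A` on `[0, 1]` and is defined on the whole line, so it
has honest derivatives at the end points too. -/
lemma hasDerivAt_odeSol (A : C(I, 𝔸)) (t : ℝ) :
    HasDerivAt (fun t : ℝ => 1 + ∫ s in (0 : ℝ)..t, (odeSol A * A) (Set.projIcc 0 1 zero_le_one s))
      ((odeSol A * A) (Set.projIcc 0 1 zero_le_one t)) t :=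
  (hasDerivAt_integral_projIcc _ t).const_add 1

end LinearODE

/-! ### Parallel transport along rays -/

section Transport

open unitInterval

set_option linter.unusedSectionVars false
variable {𝔸 : Type*} [NormedRing 𝔸] [NormedAlgebra ℂ 𝔸] [CompleteSpace 𝔸]

/-- The restriction of `Z` to the segment from `z₀` to `z`. -/
def pathMap {E : Type*} [NormedAddCommGroup E] (Z : ℂ → E) (z₀ z : ℂ) : C(I, E) :=
  open Classical in
  -- The value `0` only makes the definition total: for `Z` continuous on a set star-shaped about
  -- `z₀` and `z` in that set, the first branch applies.
  if h : Continuous fun t : I => Z (z₀ + (t : ℝ) * (z - z₀)) then ⟨_, h⟩ else 0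

lemma segment_mem {Ω : Set ℂ} {z₀ z : ℂ} (hs : StarConvex ℝ z₀ Ω) (hz : z ∈ Ω) {t : ℝ}
    (h0 : 0 ≤ t) (h1 : t ≤ 1) : z₀ + (t : ℂ) * (z - z₀) ∈ Ω := by
  have := hs hz (sub_nonneg.mpr h1) h0 (by ring)
  convert! this using 1
  simp
  ring

lemma pathMap_apply {E : Type*} [NormedAddCommGroup E] {Z : ℂ → E} {Ω : Set ℂ} {z₀ z : ℂ}
    (hs : StarConvex ℝ z₀ Ω) (hZ : ContinuousOn Z Ω) (hz : z ∈ Ω) (t : I) :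
    pathMap Z z₀ z t = Z (z₀ + (t : ℝ) * (z - z₀)) := by
  have h : Continuous fun t : I => Z (z₀ + (t : ℝ) * (z - z₀)) :=
    hZ.comp_continuous (by fun_prop) fun t => segment_mem hs hz t.2.1 t.2.2
  rw [pathMap, dif_pos h]
  rfl

/-- The derivative is taken in the supremum norm, with candidate `v ↦ (t ↦ t · DZ(z₀ + t (z - z₀))
v)`. The remainder is bounded by the mean value inequality, uniformly in `t` because the segment is
compact. -/
lemma differentiableAt_pathMap {E : Type*} [NormedAddCommGroup E] [NormedSpace ℝ E]
    {Z : ℂ → E} {Ω : Set ℂ} {z₀ z : ℂ} (hΩ : IsOpen Ω)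
    (hs : StarConvex ℝ z₀ Ω) (hZ : ContDiffOn ℝ ∞ Z Ω) (hz : z ∈ Ω) :
    DifferentiableAt ℝ (pathMap Z z₀) z := by
  have hD : ContinuousOn (fderiv ℝ Z) Ω := hZ.continuousOn_fderiv_of_isOpen hΩ (by simp)
  have hmem := fun t : I => segment_mem hs hz t.2.1 t.2.2
  have hcont (v : ℂ) : Continuous fun t : I => (t : ℝ) • fderiv ℝ Z (z₀ + (t : ℝ) * (z - z₀)) v :=
    (by fun_prop : Continuous fun t : I => (t : ℝ)).smul
      ((hD.comp_continuous (by fun_prop) hmem).clm_apply continuous_const)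
  let D (v : ℂ) : C(I, E) := ⟨_, hcont v⟩
  let L : ℂ →L[ℝ] C(I, E) := reCLM.smulRight (D 1) + imCLM.smulRight (D Complex.I)
  have hL (v : ℂ) (t : I) : L v t = (t : ℝ) • fderiv ℝ Z (z₀ + (t : ℝ) * (z - z₀)) v := by
    have : v = v.re • (1 : ℂ) + v.im • Complex.I := by simp
    conv_rhs => rw [this, map_add, map_smul, map_smul]
    simp [L, D, smul_smul, mul_comm]
  have key : HasFDerivAt (pathMap Z z₀) L z := by
    refine HasFDerivAt.of_isLittleO ?_
    rw [Asymptotics.isLittleO_iff]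
    intro c hc
    -- Compactness of `[0, 1]` turns continuity of `DZ` at each point of the segment into one
    -- neighbourhood of `z` that works for all `t`.
    have hev : ∀ᶠ w in 𝓝 z, ∀ t ∈ Set.Icc (0 : ℝ) 1, w ∈ Ω ∧
        ‖fderiv ℝ Z (z₀ + t * (w - z₀)) - fderiv ℝ Z (z₀ + t * (z - z₀))‖ < c := by
      refine isCompact_Icc.eventually_forall_of_forall_eventually fun t ht => ?_
      have h1 : ContinuousAt (fderiv ℝ Z) (z₀ + t * (z - z₀)) :=
        hD.continuousAt (hΩ.mem_nhds (segment_mem hs hz ht.1 ht.2))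
      have h2 : ContinuousAt (fun x : ℂ × ℝ => fderiv ℝ Z (z₀ + x.2 * (x.1 - z₀)) -
          fderiv ℝ Z (z₀ + x.2 * (z - z₀))) (z, t) := by
        refine ContinuousAt.sub ?_ ?_
        · exact ContinuousAt.comp (f := fun x : ℂ × ℝ => z₀ + x.2 * (x.1 - z₀)) (x := (z, t)) h1
            (by fun_prop)
        · exact ContinuousAt.comp (f := fun x : ℂ × ℝ => z₀ + x.2 * (z - z₀)) (x := (z, t)) h1
            (by fun_prop)
      have h3 := h2.norm.eventually_lt_const (u := c) (by simpa using hc)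
      exact (continuousAt_fst.eventually (hΩ.mem_nhds hz)).and h3
    obtain ⟨δ, hδ, hball⟩ := Metric.eventually_nhds_iff_ball.mp hev
    filter_upwards [Metric.ball_mem_nhds z hδ] with w hw
    rw [ContinuousMap.norm_le _ (by positivity)]
    intro t
    have hwΩ := (hball w hw 0 (by simp)).1
    simp only [ContinuousMap.sub_apply, pathMap_apply hs hZ.continuousOn hz,
      pathMap_apply hs hZ.continuousOn hwΩ]
    have hd : ∀ x ∈ Metric.ball z δ, HasFDerivWithinAt (fun x : ℂ => Z (z₀ + (t : ℝ) * (x - z₀)))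
        ((t : ℝ) • fderiv ℝ Z (z₀ + (t : ℝ) * (x - z₀))) (Metric.ball z δ) x := by
      intro x hx
      have hxΩ := (hball x hx 0 (by simp)).1
      have h1 : HasFDerivAt Z _ (z₀ + (t : ℝ) * (x - z₀)) :=
        ((hZ.differentiableOn (by simp)).differentiableAt
          (hΩ.mem_nhds (segment_mem hs hxΩ t.2.1 t.2.2))).hasFDerivAt
      have h2 : HasFDerivAt (fun x : ℂ => z₀ + (t : ℝ) * (x - z₀))
          ((t : ℝ) • ContinuousLinearMap.id ℝ ℂ) x := by
        have := (((hasFDerivAt_id (𝕜 := ℝ) x).sub_const z₀).const_smul (t : ℝ)).const_add z₀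
        simpa using! this
      convert! (h1.comp x h2).hasFDerivWithinAt using 1
      ext v
      simp
    have := (convex_ball z δ).norm_image_sub_le_of_norm_hasFDerivWithin_le' (C := c)
      (φ := (t : ℝ) • fderiv ℝ Z (z₀ + (t : ℝ) * (z - z₀))) hd ?_ (Metric.mem_ball_self hδ) hw
    · rw [hL]
      exact this
    · intro x hx
      rw [← smul_sub, norm_smul, Real.norm_of_nonneg t.2.1]
      calc _ ≤ 1 * c := mul_le_mul t.2.2 (hball x hx t t.2).2.le (norm_nonneg _) zero_le_one
        _ = c := one_mul c
  exact key.differentiableAt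

/-- The connection form `Z dz + W dz̄` along the segment from `z₀` to `z`. -/
def pathForm (Z W : ℂ → 𝔸) (z₀ z : ℂ) : C(I, 𝔸) :=
  (z - z₀) • pathMap Z z₀ z + (starRingEnd ℂ) (z - z₀) • pathMap W z₀ z

/-- Parallel transport of `Z dz + W dz̄` from `z₀` to `z` along the segment. -/
def transport (Z W : ℂ → 𝔸) (z₀ z : ℂ) : 𝔸 := odeSol (pathForm Z W z₀ z) 1

lemma transport_self (Z W : ℂ → 𝔸) (z₀ : ℂ) : transport Z W z₀ z₀ = 1 := by
  simp [transport, pathForm, odeSol_zero]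

/-- The form along the ray is affine in `l` and `l⁻¹`, `odeSol` is complex differentiable and
evaluation at `1` is linear; so transport is holomorphic in `l`. -/
lemma differentiableAt_transport_param {Z₀ Z₁ W₀ W₁ : ℂ → 𝔸} {Ω : Set ℂ} {z₀ z : ℂ}
    (hs : StarConvex ℝ z₀ Ω) (hZ₀ : ContinuousOn Z₀ Ω) (hZ₁ : ContinuousOn Z₁ Ω)
    (hW₀ : ContinuousOn W₀ Ω) (hW₁ : ContinuousOn W₁ Ω) (hz : z ∈ Ω) {l : ℂ} (hl : l ≠ 0) :
    DifferentiableAt ℂ (fun l : ℂ => transport (fun w => Z₀ w + l • Z₁ w)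
      (fun w => W₀ w + l⁻¹ • W₁ w) z₀ z) l := by
  have e : ∀ l : ℂ, pathForm (fun w => Z₀ w + l • Z₁ w) (fun w => W₀ w + l⁻¹ • W₁ w) z₀ z =
      (z - z₀) • (pathMap Z₀ z₀ z + l • pathMap Z₁ z₀ z) +
        (starRingEnd ℂ) (z - z₀) • (pathMap W₀ z₀ z + l⁻¹ • pathMap W₁ z₀ z) := by
    intro l
    ext t
    simp only [pathForm, ContinuousMap.add_apply, ContinuousMap.smul_apply]
    rw [pathMap_apply hs hZ₀ hz, pathMap_apply hs hZ₁ hz, pathMap_apply hs hW₀ hz,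
      pathMap_apply hs hW₁ hz, pathMap_apply hs (hZ₀.fun_add (hZ₁.fun_const_smul l)) hz,
      pathMap_apply hs (hW₀.fun_add (hW₁.fun_const_smul l⁻¹)) hz]
  have h1 : DifferentiableAt ℂ (fun l : ℂ =>
      (z - z₀) • (pathMap Z₀ z₀ z + l • pathMap Z₁ z₀ z) +
        (starRingEnd ℂ) (z - z₀) • (pathMap W₀ z₀ z + l⁻¹ • pathMap W₁ z₀ z)) l := by
    have hinv : DifferentiableAt ℂ (fun l : ℂ => l⁻¹) l := differentiableAt_inv hl
    exact DifferentiableAt.fun_add (DifferentiableAt.fun_const_smul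
      (DifferentiableAt.fun_add (differentiableAt_const _)
        (DifferentiableAt.smul_const differentiableAt_id _)) _)
      (DifferentiableAt.fun_const_smul
      (DifferentiableAt.fun_add (differentiableAt_const _) (hinv.smul_const _)) _)
  have h2 := ((contDiff_odeSol (𝔸 := 𝔸)).differentiable (by simp)).differentiableAt.comp l h1
  have h3 := (ContinuousMap.evalCLM ℂ (1 : I) : C(I, 𝔸) →L[ℂ] 𝔸).differentiableAt.comp l h2
  refine h3.congr_of_eventuallyEq (Filter.Eventually.of_forall fun l => ?_)
  simp [transport, e]

lemma pathForm_apply {Z W : ℂ → 𝔸} {Ω : Set ℂ} {z₀ z : ℂ} (hs : StarConvex ℝ z₀ Ω)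
    (hZ : ContinuousOn Z Ω) (hW : ContinuousOn W Ω) (hz : z ∈ Ω) (t : I) :
    pathForm Z W z₀ z t = (z - z₀) • Z (z₀ + (t : ℝ) * (z - z₀)) +
      (starRingEnd ℂ) (z - z₀) • W (z₀ + (t : ℝ) * (z - z₀)) := by
  rw [← pathMap_apply hs hZ hz, ← pathMap_apply hs hW hz]
  rfl

lemma differentiableAt_pathForm {Z W : ℂ → 𝔸} {Ω : Set ℂ} {z₀ z : ℂ} (hΩ : IsOpen Ω)
    (hs : StarConvex ℝ z₀ Ω) (hZ : ContDiffOn ℝ ∞ Z Ω) (hW : ContDiffOn ℝ ∞ W Ω) (hz : z ∈ Ω) :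
    DifferentiableAt ℝ (pathForm Z W z₀) z := by
  have h1 : DifferentiableAt ℝ (fun w : ℂ => w - z₀) z := by fun_prop
  have h2 : DifferentiableAt ℝ (fun w : ℂ => (starRingEnd ℂ) (w - z₀)) z :=
    (Complex.conjCLE : ℂ →L[ℝ] ℂ).differentiableAt.comp z h1
  exact DifferentiableAt.fun_add
    (DifferentiableAt.fun_smul h1 (differentiableAt_pathMap hΩ hs hZ hz))
    (DifferentiableAt.fun_smul h2 (differentiableAt_pathMap hΩ hs hW hz))

/-- The derivative in `C(I, 𝔸)` exists already; its value at `t` is identified by differentiating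
the explicit expression at fixed `t`. The first summand comes from moving the factor `z - z₀`, the
second from moving the point of the segment. -/
lemma fderiv_pathForm_apply {Z W : ℂ → 𝔸} {Ω : Set ℂ} {z₀ z : ℂ} (hΩ : IsOpen Ω)
    (hs : StarConvex ℝ z₀ Ω) (hZ : ContDiffOn ℝ ∞ Z Ω) (hW : ContDiffOn ℝ ∞ W Ω) (hz : z ∈ Ω)
    (v : ℂ) (t : I) :
    fderiv ℝ (pathForm Z W z₀) z v t =
      (v • Z (z₀ + (t : ℝ) * (z - z₀)) + (starRingEnd ℂ) v • W (z₀ + (t : ℝ) * (z - z₀))) +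
      (t : ℝ) • ((z - z₀) • fderiv ℝ Z (z₀ + (t : ℝ) * (z - z₀)) v +
        (starRingEnd ℂ) (z - z₀) • fderiv ℝ W (z₀ + (t : ℝ) * (z - z₀)) v) := by
  have h1 : HasFDerivAt (fun w => pathForm Z W z₀ w t)
      ((ContinuousMap.evalCLM ℝ t : C(I, 𝔸) →L[ℝ] 𝔸) ∘L fderiv ℝ (pathForm Z W z₀) z) z :=
    (ContinuousMap.evalCLM ℝ t : C(I, 𝔸) →L[ℝ] 𝔸).hasFDerivAt.comp z
      (differentiableAt_pathForm hΩ hs hZ hW hz).hasFDerivAt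
  have hγ : HasFDerivAt (fun x : ℂ => z₀ + (t : ℝ) * (x - z₀))
      ((t : ℝ) • ContinuousLinearMap.id ℝ ℂ) z := by
    have := (((hasFDerivAt_id (𝕜 := ℝ) z).sub_const z₀).const_smul (t : ℝ)).const_add z₀
    simpa using! this
  have hd (Y : ℂ → 𝔸) (hY : ContDiffOn ℝ ∞ Y Ω) :
      HasFDerivAt (fun x : ℂ => Y (z₀ + (t : ℝ) * (x - z₀)))
        (fderiv ℝ Y (z₀ + (t : ℝ) * (z - z₀)) ∘L ((t : ℝ) • ContinuousLinearMap.id ℝ ℂ)) z :=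
    HasFDerivAt.comp (f := fun x : ℂ => z₀ + (t : ℝ) * (x - z₀)) z
      ((hY.differentiableOn (by simp)).differentiableAt
        (hΩ.mem_nhds (segment_mem hs hz t.2.1 t.2.2))).hasFDerivAt hγ
  have h2 : HasFDerivAt (fun w : ℂ => (w - z₀) • Z (z₀ + (t : ℝ) * (w - z₀)) +
      (starRingEnd ℂ) (w - z₀) • W (z₀ + (t : ℝ) * (w - z₀))) _ z :=
    (((hasFDerivAt_id (𝕜 := ℝ) z).sub_const z₀).smul (hd Z hZ)).add
      (((Complex.conjCLE : ℂ →L[ℝ] ℂ).hasFDerivAt.comp z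
        ((hasFDerivAt_id (𝕜 := ℝ) z).sub_const z₀)).smul (hd W hW))
  have h3 : (fun w => pathForm Z W z₀ w t) =ᶠ[𝓝 z] fun w : ℂ =>
      (w - z₀) • Z (z₀ + (t : ℝ) * (w - z₀)) +
        (starRingEnd ℂ) (w - z₀) • W (z₀ + (t : ℝ) * (w - z₀)) := by
    filter_upwards [hΩ.mem_nhds hz] with w hw
    exact pathForm_apply hs hZ.continuousOn hW.continuousOn hw t
  have h4 := congrArg (fun T : ℂ →L[ℝ] 𝔸 => T v) (h1.unique (h2.congr_of_eventuallyEq h3))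
  refine Eq.trans h4 ?_
  rw [smul_add, smul_comm (t : ℝ) (z - z₀), smul_comm (t : ℝ) ((starRingEnd ℂ) (z - z₀))]
  simp
  abel

/-- Differentiating `e = 1 + ∫ e a` gives the linearized equation `e' = ∫ (e' a + e a')`, the input
of `odeSol_variation`. -/
lemma fderiv_odeSol_comp {a : ℂ → C(I, 𝔸)} {z : ℂ} (ha : DifferentiableAt ℝ a z) :
    DifferentiableAt ℝ (fun w => odeSol (a w)) z ∧ ∀ v,
      fderiv ℝ (fun w => odeSol (a w)) z v = integrate
        (fderiv ℝ (fun w => odeSol (a w)) z v * a z + odeSol (a z) * fderiv ℝ a z v) := by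
  have he : DifferentiableAt ℝ (fun w => odeSol (a w)) z :=
    (((contDiff_odeSol (𝔸 := 𝔸)).restrict_scalars ℝ).differentiable
      (by simp)).differentiableAt.comp z ha
  refine ⟨he, fun v => ?_⟩
  have h1 : HasFDerivAt (fun w => 1 + integrate (odeSol (a w) * a w)) _ z :=
    ((((integrate : Op C(I, 𝔸)).restrictScalars ℝ).hasFDerivAt.comp z
      (he.hasFDerivAt.mul' ha.hasFDerivAt))).const_add 1
  have h2 : HasFDerivAt (fun w => odeSol (a w)) _ z :=
    h1.congr_of_eventuallyEq (Filter.Eventually.of_forall fun w => odeSol_eq (a w))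
  have h3 := congrArg (fun T : ℂ →L[ℝ] C(I, 𝔸) => T v) h2.fderiv
  refine h3.trans ?_
  simp [add_comm]

/-- Variation of constants: the linearized equation with right-hand side `e B` is solved by
`e m` if `m' = B + [m, A]`. -/
lemma odeSol_variation {A B x : C(I, 𝔸)} (hx : x = integrate (x * A + odeSol A * B))
    (m : ℝ → 𝔸) (h0 : m 0 = 0)
    (hm : ∀ s (hs : s ∈ Set.Icc (0 : ℝ) 1),
      HasDerivAt m (B ⟨s, hs⟩ + m s * A ⟨s, hs⟩ - A ⟨s, hs⟩ * m s) s) :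
    x 1 = odeSol A 1 * m 1 := by
  have hmc : Continuous fun t : I => m t := continuous_iff_continuousAt.mpr fun t =>
    (hm t t.2).continuousAt.comp continuous_subtype_val.continuousAt
  -- The candidate solution `e m`: since `e' = e A` and `m' = B + m A - A m`, its derivative is `(e
  -- m) A + e B`.
  let y : C(I, 𝔸) := odeSol A * ⟨fun t : I => m t, hmc⟩
  have hyt (t : I) : y t = odeSol A t * m t := rfl
  have hes (t : I) : 1 + ∫ s in (0 : ℝ)..t, (odeSol A * A) (Set.projIcc 0 1 zero_le_one s) =
      odeSol A t := by
    conv_rhs => rw [odeSol_eq]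
    rfl
  have hyint : y = integrate (y * A + odeSol A * B) := by
    ext t
    rw [integrate_apply]
    have hder : ∀ s ∈ Set.uIcc (0 : ℝ) t, HasDerivAt (fun s : ℝ =>
        (1 + ∫ s in (0 : ℝ)..s, (odeSol A * A) (Set.projIcc 0 1 zero_le_one s)) * m s)
        ((y * A + odeSol A * B) (Set.projIcc 0 1 zero_le_one s)) s := by
      intro s hs'
      rw [Set.uIcc_of_le t.2.1] at hs'
      have hs1 : s ∈ Set.Icc (0 : ℝ) 1 := ⟨hs'.1, hs'.2.trans t.2.2⟩
      have h3 := (hasDerivAt_odeSol A s).mul (hm s hs1)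
      rw [hes ⟨s, hs1⟩, Set.projIcc_of_mem _ hs1] at h3
      rw [Set.projIcc_of_mem _ hs1]
      convert! h3 using 1
      simp only [ContinuousMap.add_apply, ContinuousMap.mul_apply, hyt]
      noncomm_ring
    rw [intervalIntegral.integral_eq_sub_of_hasDerivAt hder
      ((continuous_comp_projIcc _).intervalIntegrable _ _), hyt, hes t, h0]
    simp
  -- Both functions solve the same inhomogeneous Volterra equation, and `1 - V` is injective.
  have hsol : x = y := by
    refine eq_of_sub_apply_eq (isUnit_one_sub_volterra A) ?_
    rw [volterra_apply, volterra_apply]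
    rw [map_add] at hx hyint
    rw [← sub_eq_iff_eq_add'] at hx hyint
    rw [hx, hyint]
  rw [hsol, hyt]
  rfl

/-- Parallel transport of a flat connection along rays is parallel. -/
lemma hasFDerivAt_transport {Z W : ℂ → 𝔸} {Ω : Set ℂ} {z₀ z : ℂ} (hΩ : IsOpen Ω)
    (hs : StarConvex ℝ z₀ Ω) (hZ : ContDiffOn ℝ ∞ Z Ω) (hW : ContDiffOn ℝ ∞ W Ω)
    (hflat : ∀ w ∈ Ω, ∀ c v : ℂ,
      (c • Z w + (starRingEnd ℂ) c • W w) * (v • Z w + (starRingEnd ℂ) v • W w)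
        + (v • fderiv ℝ Z w c + (starRingEnd ℂ) v • fderiv ℝ W w c) =
      (v • Z w + (starRingEnd ℂ) v • W w) * (c • Z w + (starRingEnd ℂ) c • W w)
        + (c • fderiv ℝ Z w v + (starRingEnd ℂ) c • fderiv ℝ W w v))
    (hz : z ∈ Ω) :
    DifferentiableAt ℝ (transport Z W z₀) z ∧ ∀ v, fderiv ℝ (transport Z W z₀) z v =
      transport Z W z₀ z * (v • Z z + (starRingEnd ℂ) v • W z) := by
  obtain ⟨hd, hv⟩ := fderiv_odeSol_comp (differentiableAt_pathForm hΩ hs hZ hW hz)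
  have hev' : HasFDerivAt (transport Z W z₀) _ z :=
    (ContinuousMap.evalCLM ℝ (1 : I) : C(I, 𝔸) →L[ℝ] 𝔸).hasFDerivAt.comp z hd.hasFDerivAt
  refine ⟨hev'.differentiableAt, fun v => ?_⟩
  rw [hev'.fderiv]
  -- The choice is `m(s) = s α(v)`, the connection form evaluated at the point `z₀ + s (z - z₀)` on
  -- the velocity `s v` with which that point moves. At `s = 1` it is the form at `z`.
  have h := odeSol_variation (hv v) (fun s : ℝ =>
    s • (v • Z (z₀ + s * (z - z₀)) + (starRingEnd ℂ) v • W (z₀ + s * (z - z₀)))) (by simp) ?_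
  · refine Eq.trans h ?_
    simp [transport]
  · intro s hs1
    have hγ : HasDerivAt (fun s : ℝ => z₀ + s * (z - z₀)) (z - z₀) s := by
      simpa using ((hasDerivAt_id s).ofReal_comp.mul_const (z - z₀)).const_add z₀
    have hmem := segment_mem hs hz hs1.1 hs1.2
    have hd (Y : ℂ → 𝔸) (hY : ContDiffOn ℝ ∞ Y Ω) :
        HasDerivAt (fun s : ℝ => Y (z₀ + s * (z - z₀)))
          (fderiv ℝ Y (z₀ + s * (z - z₀)) (z - z₀)) s :=
      HasFDerivAt.comp_hasDerivAt (f := fun s : ℝ => z₀ + s * (z - z₀)) s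
        ((hY.differentiableOn (by simp)).differentiableAt (hΩ.mem_nhds hmem)).hasFDerivAt hγ
    have h2 := (hasDerivAt_id s).smul (((hd Z hZ).const_smul v).add
      ((hd W hW).const_smul ((starRingEnd ℂ) v)))
    convert! h2 using 1
    -- Flatness for the radial direction and `v`, multiplied by `s`, is exactly the difference
    -- between `m'` and `B + m A - A m`.
    have hf := hflat _ hmem (z - z₀) v
    rw [fderiv_pathForm_apply hΩ hs hZ hW hz, pathForm_apply hs hZ.continuousOn hW.continuousOn hz]
    simp only [id, one_smul, Pi.add_apply, Pi.smul_apply]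
    rw [smul_mul_assoc, mul_smul_comm]
    rw [← sub_eq_zero] at hf ⊢
    have hf' := congrArg (fun x => (-s) • x) hf
    simp only [smul_zero] at hf'
    rw [← hf']
    module

end Transport

/-! ### The square roots of `-H / 2` and `-2 H` -/

/-- The root `k` of `-H/2` is `I` for `H = 2` and `1` for `H = -2`. In later computations it is an
opaque `k`; the relations `k² = -H/2`, `k̄ = -(H/2) k` and `H² = 4` treat both signs at once. -/
lemma sqrt_neg_half_sq {H : ℝ} (hH : H = 2 ∨ H = -2) :
    Complex.sqrt ((-H / 2 : ℝ) : ℂ) ^ 2 = -(H : ℂ) / 2 := by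
  rcases hH with rfl | rfl <;> norm_num [Complex.sqrt_neg_one]

lemma sqrt_neg_two_mul {H : ℝ} (hH : H = 2 ∨ H = -2) :
    Complex.sqrt ((-2 * H : ℝ) : ℂ) = 2 * Complex.sqrt ((-H / 2 : ℝ) : ℂ) := by
  have h4 : Complex.sqrt 4 = 2 := by
    rw [Complex.sqrt_of_nonneg (by norm_num)]
    have : √(4 : ℝ) = 2 := by rw [show (4 : ℝ) = 2 ^ 2 by norm_num]; simp
    simp [this]
  have hm4 : Complex.sqrt (-4) = 2 * I := by
    rw [Complex.sqrt_neg_of_nonneg (by norm_num), h4, mul_comm]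
  rcases hH with rfl | rfl
  · norm_num [Complex.sqrt_neg_one, hm4]
  · norm_num [h4]

lemma conj_sqrt_neg_half {H : ℝ} (hH : H = 2 ∨ H = -2) :
    (starRingEnd ℂ) (Complex.sqrt ((-H / 2 : ℝ) : ℂ)) =
      -(H : ℂ) / 2 * Complex.sqrt ((-H / 2 : ℝ) : ℂ) := by
  rcases hH with rfl | rfl <;> norm_num [Complex.sqrt_neg_one]

lemma sqrt_neg_half_ne_zero {H : ℝ} (hH : H = 2 ∨ H = -2) :
    Complex.sqrt ((-H / 2 : ℝ) : ℂ) ≠ 0 := by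
  rcases hH with rfl | rfl <;> norm_num [Complex.sqrt_neg_one]

/-! ### Flat connections have frames -/

section

attribute [local instance] Matrix.linftyOpNormedRing Matrix.linftyOpNormedAlgebra

/-- The entry of a matrix, as a continuous linear map for the operator norm. -/
def entryCLM (i j : Fin 3) : M3 →L[ℂ] ℂ :=
  LinearMap.toContinuousLinearMap (Matrix.entryLinearMap ℂ ℂ i j)

/-- Passage from entrywise smoothness to the Banach algebra of matrices, where the transport lemmas
live. -/
lemma SmoothM.contDiffOn {F : ℂ → M3} {Ω : Set ℂ} (hF : SmoothM F Ω) : ContDiffOn ℝ ∞ F Ω := by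
  have e : F = fun z => ∑ i, ∑ j, F z i j • Matrix.single i j (1 : ℂ) := by
    ext z : 1
    conv_lhs => rw [Matrix.matrix_eq_sum_single (F z)]
    simp
  rw [e]
  exact ContDiffOn.sum fun i _ => ContDiffOn.sum fun j _ => (hF i j).smul contDiffOn_const

lemma fderiv_eq_of_hasWM {F : ℂ → M3} {P Q : M3} {z : ℂ} (h : HasWM F P Q z)
    (hd : DifferentiableAt ℝ F z) (v : ℂ) : fderiv ℝ F z v = v • P + (starRingEnd ℂ) v • Q := by
  ext i j
  have h1 : HasFDerivAt (fun w => F w i j)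
      (((entryCLM i j).restrictScalars ℝ) ∘L fderiv ℝ F z) z :=
    ((entryCLM i j).restrictScalars ℝ).hasFDerivAt.comp z hd.hasFDerivAt
  have h2 := congrArg (fun T : ℂ →L[ℝ] ℂ => T v) (h1.unique (h i j))
  refine Eq.trans h2 ?_
  simp [mul_comm]

lemma hasWM_of_fderiv {F : ℂ → M3} {P Q : M3} {z : ℂ} (hd : DifferentiableAt ℝ F z)
    (h : ∀ v, fderiv ℝ F z v = v • P + (starRingEnd ℂ) v • Q) : HasWM F P Q z := by
  intro i j
  have h1 : HasFDerivAt (fun w => F w i j) _ z :=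
    ((entryCLM i j).restrictScalars ℝ).hasFDerivAt.comp z hd.hasFDerivAt
  unfold HasW
  convert! h1 using 1
  ext v
  refine Eq.trans ?_ (congrArg (fun A : M3 => A i j) (h v)).symm
  simp [mul_comm]

/-- The difference of the two sides is alternating in `c`, `v`: it equals `v c̄ - c v̄` times the
single matrix of `h3`. -/
lemma curvature_eq_zero {Z W : ℂ → M3} {Pz Pb Qz Qb : M3} {w : ℂ} (h1 : HasWM Z Pz Pb w)
    (h2 : HasWM W Qz Qb w) (hZ : DifferentiableAt ℝ Z w) (hW : DifferentiableAt ℝ W w)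
    (h3 : Pb - Qz + W w * Z w - Z w * W w = 0) (c v : ℂ) :
    (c • Z w + (starRingEnd ℂ) c • W w) * (v • Z w + (starRingEnd ℂ) v • W w)
        + (v • fderiv ℝ Z w c + (starRingEnd ℂ) v • fderiv ℝ W w c) =
      (v • Z w + (starRingEnd ℂ) v • W w) * (c • Z w + (starRingEnd ℂ) c • W w)
        + (c • fderiv ℝ Z w v + (starRingEnd ℂ) c • fderiv ℝ W w v) := by
  rw [fderiv_eq_of_hasWM h1 hZ, fderiv_eq_of_hasWM h1 hZ, fderiv_eq_of_hasWM h2 hW,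
    fderiv_eq_of_hasWM h2 hW, ← sub_eq_zero]
  have h4 := congrArg (fun X : M3 => (v * (starRingEnd ℂ) c - c * (starRingEnd ℂ) v) • X) h3
  simp only [smul_zero] at h4
  rw [← h4]
  simp only [add_mul, mul_add, smul_mul_assoc, mul_smul_comm, smul_smul]
  module

/-- A family of flat connections `(Z₀ + l Z₁) dz + (W₀ + l⁻¹ W₁) dz̄` on a star-shaped domain has
normalized frames, which are holomorphic in `l`. -/
theorem exists_frame_of_flat {Z₀ Z₁ W₀ W₁ : ℂ → M3} {Ω : Set ℂ} {z₀ : ℂ} (hΩ : IsOpen Ω)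
    (hs : StarConvex ℝ z₀ Ω) (hZ₀ : SmoothM Z₀ Ω) (hZ₁ : SmoothM Z₁ Ω) (hW₀ : SmoothM W₀ Ω)
    (hW₁ : SmoothM W₁ Ω)
    (hflat : ∀ l : ℂ, l ≠ 0 → ∀ w ∈ Ω, ∃ Pz Pb Qz Qb : M3,
      HasWM (fun w => Z₀ w + l • Z₁ w) Pz Pb w ∧ HasWM (fun w => W₀ w + l⁻¹ • W₁ w) Qz Qb w ∧
      Pb - Qz + (W₀ w + l⁻¹ • W₁ w) * (Z₀ w + l • Z₁ w)
        - (Z₀ w + l • Z₁ w) * (W₀ w + l⁻¹ • W₁ w) = 0) :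
    ∃ E : ℂ → ℂ → M3, (∀ l, E z₀ l = 1) ∧
      (∀ l : ℂ, l ≠ 0 → ∀ z ∈ Ω, HasWM (fun w => E w l) (E z l * (Z₀ z + l • Z₁ z))
        (E z l * (W₀ z + l⁻¹ • W₁ z)) z) ∧
      ∀ z ∈ Ω, ∀ i j, DifferentiableOn ℂ (fun l => E z l i j) {l | l ≠ 0} := by
  refine ⟨fun z l => transport (fun w => Z₀ w + l • Z₁ w) (fun w => W₀ w + l⁻¹ • W₁ w) z₀ z,
    fun l => transport_self _ _ _, ?_, ?_⟩
  · intro l hl z hz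
    have hZ : ContDiffOn ℝ ∞ (fun w => Z₀ w + l • Z₁ w) Ω :=
      SmoothM.contDiffOn fun i j => (hZ₀ i j).add (contDiffOn_const.mul (hZ₁ i j))
    have hW : ContDiffOn ℝ ∞ (fun w => W₀ w + l⁻¹ • W₁ w) Ω :=
      SmoothM.contDiffOn fun i j => (hW₀ i j).add (contDiffOn_const.mul (hW₁ i j))
    obtain ⟨hd, hv⟩ := hasFDerivAt_transport hΩ hs hZ hW (fun w hw c v => by
      obtain ⟨Pz, Pb, Qz, Qb, h1, h2, h3⟩ := hflat l hl w hw
      exact curvature_eq_zero h1 h2 ((hZ.differentiableOn (by simp)).differentiableAt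
        (hΩ.mem_nhds hw)) ((hW.differentiableOn (by simp)).differentiableAt
        (hΩ.mem_nhds hw)) h3 c v) hz
    refine hasWM_of_fderiv hd fun v => (hv v).trans ?_
    simp only [mul_add, mul_smul_comm]
  · intro z hz i j l hl
    have h1 := differentiableAt_transport_param hs hZ₀.contDiffOn.continuousOn
      hZ₁.contDiffOn.continuousOn hW₀.contDiffOn.continuousOn hW₁.contDiffOn.continuousOn hz hl
    exact ((entryCLM i j).differentiableAt.comp l h1).differentiableWithinAt

end

/-! ### The Gauss-Codazzi equations -/

lemma hasW_exp_real {ψ : ℂ → ℝ} {p q z : ℂ} (h : HasW (fun w => (ψ w : ℂ)) p q z) (c : ℝ) :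
    HasW (fun w => ((Real.exp (c * ψ w) : ℝ) : ℂ)) (c * p * (Real.exp (c * ψ z) : ℝ))
      (c * q * (Real.exp (c * ψ z) : ℝ)) z := by
  have := (h.const_mul (c : ℂ)).cexp
  simp only [← ofReal_mul, ← ofReal_exp] at this
  exact this.congr_deriv (by ring) (by ring)

lemma hasW_exp_half {ψ : ℂ → ℝ} {p q z : ℂ} (h : HasW (fun w => (ψ w : ℂ)) p q z) :
    HasW (fun w => ((Real.exp (ψ w / 2) : ℝ) : ℂ)) (p / 2 * (Real.exp (ψ z / 2) : ℝ))
      (q / 2 * (Real.exp (ψ z / 2) : ℝ)) z := by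
  have := hasW_exp_real h (1 / 2)
  simp only [one_div, inv_mul_eq_div] at this
  exact this.congr_deriv (by push_cast; ring) (by push_cast; ring)

lemma hasW_exp_neg {ψ : ℂ → ℝ} {p q z : ℂ} (h : HasW (fun w => (ψ w : ℂ)) p q z) :
    HasW (fun w => ((Real.exp (-ψ w) : ℝ) : ℂ)) (-p * (Real.exp (-ψ z) : ℝ))
      (-q * (Real.exp (-ψ z) : ℝ)) z := by
  have := hasW_exp_real h (-1)
  simp only [neg_one_mul] at this
  exact this.congr_deriv (by push_cast; ring) (by push_cast; ring)

lemma hasW_exp_neg_half {ψ : ℂ → ℝ} {p q z : ℂ} (h : HasW (fun w => (ψ w : ℂ)) p q z) :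
    HasW (fun w => ((Real.exp (-ψ w / 2) : ℝ) : ℂ)) (-p / 2 * (Real.exp (-ψ z / 2) : ℝ))
      (-q / 2 * (Real.exp (-ψ z / 2) : ℝ)) z := by
  have := hasW_exp_real h (-1 / 2)
  have e : ∀ w, -1 / 2 * ψ w = -ψ w / 2 := fun w => by ring
  simp only [e] at this
  exact this.congr_deriv (by push_cast; ring) (by push_cast; ring)

/-- The derivatives of `connZ`. -/
lemma hasWM_connZ {H : ℝ} {ψ : ℂ → ℝ} {U : ℂ → ℂ} {z p q pz pb u v : ℂ} (l : ℂ)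
    (h : HasW (fun w => (ψ w : ℂ)) p q z) (hp : HasW (dz fun w => (ψ w : ℂ)) pz pb z)
    (hU : HasW U u v z) :
    HasWM (connZ H ψ U l)
      !![pz / 2, 0, Complex.sqrt ((-H / 2 : ℝ) : ℂ) * l * (p / 2 * (Real.exp (ψ z / 2) : ℝ));
        l * (u - p * U z) * (Real.exp (-ψ z) : ℝ), -(pz / 2), 0;
        0, Complex.sqrt ((-H / 2 : ℝ) : ℂ) * l * (p / 2 * (Real.exp (ψ z / 2) : ℝ)), 0]
      !![pb / 2, 0, Complex.sqrt ((-H / 2 : ℝ) : ℂ) * l * (q / 2 * (Real.exp (ψ z / 2) : ℝ));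
        l * (v - q * U z) * (Real.exp (-ψ z) : ℝ), -(pb / 2), 0;
        0, Complex.sqrt ((-H / 2 : ℝ) : ℂ) * l * (q / 2 * (Real.exp (ψ z / 2) : ℝ)), 0] z := by
  have h1 := (hasW_exp_half h).const_mul (Complex.sqrt ((-H / 2 : ℝ) : ℂ) * l)
  have h2 := (hU.const_mul l).mul (hasW_exp_neg h)
  have h3 : HasW (fun w => dz (fun w => (ψ w : ℂ)) w / 2) (pz / 2) (pb / 2) z := by
    simpa [div_eq_inv_mul] using hp.const_mul 2⁻¹
  intro i j
  fin_cases i <;> fin_cases j <;> simp only [connZ] <;> simp [-ofReal_exp]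
  · exact h3
  · exact hasW_const 0 z
  · simpa using h1
  · exact h2.congr_deriv (by ring) (by ring)
  · exact h3.neg
  · exact hasW_const 0 z
  · exact hasW_const 0 z
  · simpa using h1
  · exact hasW_const 0 z

/-- The derivatives of `connZbar`. -/
lemma hasWM_connZbar {H : ℝ} {ψ : ℂ → ℝ} {U : ℂ → ℂ} {z p q qz qb u v : ℂ} (l : ℂ)
    (h : HasW (fun w => (ψ w : ℂ)) p q z) (hq : HasW (dzbar fun w => (ψ w : ℂ)) qz qb z)
    (hU : HasW U u v z) :
    HasWM (connZbar H ψ U l)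
      !![-(qz / 2), l⁻¹ * ((starRingEnd ℂ) v - p * (starRingEnd ℂ) (U z)) * (Real.exp (-ψ z) : ℝ), 0;
        0, qz / 2, Complex.sqrt ((-H / 2 : ℝ) : ℂ) * l⁻¹ * (p / 2 * (Real.exp (ψ z / 2) : ℝ));
        Complex.sqrt ((-H / 2 : ℝ) : ℂ) * l⁻¹ * (p / 2 * (Real.exp (ψ z / 2) : ℝ)), 0, 0]
      !![-(qb / 2), l⁻¹ * ((starRingEnd ℂ) u - q * (starRingEnd ℂ) (U z)) * (Real.exp (-ψ z) : ℝ), 0;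
        0, qb / 2, Complex.sqrt ((-H / 2 : ℝ) : ℂ) * l⁻¹ * (q / 2 * (Real.exp (ψ z / 2) : ℝ));
        Complex.sqrt ((-H / 2 : ℝ) : ℂ) * l⁻¹ * (q / 2 * (Real.exp (ψ z / 2) : ℝ)), 0, 0] z := by
  have h1 := (hasW_exp_half h).const_mul (Complex.sqrt ((-H / 2 : ℝ) : ℂ) * l⁻¹)
  have h2 := (hU.conj.const_mul l⁻¹).mul (hasW_exp_neg h)
  have h3 : HasW (fun w => dzbar (fun w => (ψ w : ℂ)) w / 2) (qz / 2) (qb / 2) z := by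
    simpa [div_eq_inv_mul] using hq.const_mul 2⁻¹
  intro i j
  fin_cases i <;> fin_cases j <;> simp only [connZbar] <;> simp [-ofReal_exp]
  · exact h3.neg
  · exact h2.congr_deriv (by ring) (by ring)
  · exact hasW_const 0 z
  · exact hasW_const 0 z
  · exact h3
  · simpa using h1
  · simpa using h1
  · exact hasW_const 0 z
  · exact hasW_const 0 z

/-- The equations of Gauss and Codazzi for the invariants `ψ`, `U`, `H`. -/
def GaussCodazzi (Ω : Set ℂ) (H : ℝ) (ψ : ℂ → ℝ) (U : ℂ → ℂ) : Prop :=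
  ∀ z ∈ Ω, dzbar U z = 0 ∧ dzbar (dz fun w => (ψ w : ℂ)) z =
    -(U z * (starRingEnd ℂ) (U z) * (Real.exp (-ψ z) : ℝ) ^ 2) - H / 2 * (Real.exp (ψ z / 2) : ℝ) ^ 2

lemma contDiffOn_ofReal {ψ : ℂ → ℝ} {Ω : Set ℂ} (hψ : ContDiffOn ℝ ∞ ψ Ω) :
    ContDiffOn ℝ ∞ (fun w => (ψ w : ℂ)) Ω := ofRealCLM.contDiff.comp_contDiffOn hψ

/-- The curvature matrix has the Gauss equation, with opposite signs, in its first two diagonal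
entries, the Codazzi equation below them and its conjugate above; the other entries vanish
identically. The right-hand side of the equivalence is free of `l`, so flatness at one parameter
gives flatness at all. -/
lemma hasWM_conn {Ω : Set ℂ} (hΩ : IsOpen Ω) {H : ℝ} {ψ : ℂ → ℝ}
    {U : ℂ → ℂ} (hψ : ContDiffOn ℝ ∞ ψ Ω) (hU : ContDiffOn ℝ ∞ U Ω)
    {z : ℂ} (hz : z ∈ Ω) (hH : H = 2 ∨ H = -2) {l : ℂ} (hl : l ≠ 0) :
    ∃ Pz Pb Qz Qb : M3, HasWM (connZ H ψ U l) Pz Pb z ∧ HasWM (connZbar H ψ U l) Qz Qb z ∧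
      (Pb - Qz + connZbar H ψ U l z * connZ H ψ U l z - connZ H ψ U l z * connZbar H ψ U l z = 0 ↔
        (dzbar U z = 0 ∧ dzbar (dz fun w => (ψ w : ℂ)) z =
          -(U z * (starRingEnd ℂ) (U z) * (Real.exp (-ψ z) : ℝ) ^ 2)
            - H / 2 * (Real.exp (ψ z / 2) : ℝ) ^ 2)) := by
  have hψ' := contDiffOn_ofReal hψ
  have h1 := hasW_of_contDiffOn hΩ hψ' hz
  have h2 := hasW_of_contDiffOn hΩ (contDiffOn_dz hΩ hψ') hz
  have h3 := hasW_of_contDiffOn hΩ (contDiffOn_dzbar hΩ hψ') hz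
  rw [dz_dzbar_comm hΩ hψ' hz] at h3
  have h4 := hasW_of_contDiffOn hΩ hU hz
  refine ⟨_, _, _, _, hasWM_connZ l h1 h2 h4, hasWM_connZbar l h1 h3 h4, ?_⟩
  have hk := sqrt_neg_half_sq hH
  have he : ((Real.exp (-ψ z) : ℝ) : ℂ) ≠ 0 := by exact_mod_cast (Real.exp_pos _).ne'
  simp only [connZ, connZbar]
  generalize Complex.sqrt ((-H / 2 : ℝ) : ℂ) = k at *
  generalize ((Real.exp (-ψ z) : ℝ) : ℂ) = e at *
  generalize ((Real.exp (ψ z / 2) : ℝ) : ℂ) = f at *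
  constructor
  · intro h
    have e00 := congrFun (congrFun h 0) 0
    have e10 := congrFun (congrFun h 1) 0
    simp at e00 e10
    constructor
    · have : l * e * dzbar U z = 0 := by linear_combination e10
      simpa [hl, he] using this
    · field_simp at e00
      have : l * (dzbar (dz fun w => (ψ w : ℂ)) z -
        (-(U z * (starRingEnd ℂ) (U z) * e ^ 2) - H / 2 * f ^ 2)) = 0 := by
        linear_combination (l / 4) * e00 + l * f ^ 2 * hk
      simpa [hl, sub_eq_zero] using this
  · rintro ⟨c1, c2⟩
    ext i j
    fin_cases i <;> fin_cases j <;>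
      simp [c1, c2] <;> field_simp
    · linear_combination (-4 * f ^ 2) * hk
    · ring
    · ring
    · ring
    · linear_combination (4 * f ^ 2) * hk
    all_goals ring

lemma smoothM_connZ {Ω : Set ℂ} (hΩ : IsOpen Ω) (H : ℝ) {ψ : ℂ → ℝ} {U : ℂ → ℂ}
    (hψ : ContDiffOn ℝ ∞ ψ Ω) (hU : ContDiffOn ℝ ∞ U Ω) (l : ℂ) :
    SmoothM (connZ H ψ U l) Ω := by
  have h1 := (contDiffOn_dz hΩ (contDiffOn_ofReal hψ)).div_const 2
  have h2 : ContDiffOn ℝ ∞ (fun z => ((Real.exp (ψ z / 2) : ℝ) : ℂ)) Ω :=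
    contDiffOn_ofReal (hψ.div_const 2).exp
  have h3 : ContDiffOn ℝ ∞ (fun z => ((Real.exp (-ψ z) : ℝ) : ℂ)) Ω :=
    contDiffOn_ofReal hψ.neg.exp
  intro i j
  fin_cases i <;> fin_cases j <;> simp only [connZ] <;> simp [-ofReal_exp]
  any_goals exact contDiffOn_const
  · exact h1
  · exact contDiffOn_const.mul h2
  · exact (contDiffOn_const.mul hU).mul h3
  · exact h1.neg
  · exact contDiffOn_const.mul h2

lemma smoothM_connZbar {Ω : Set ℂ} (hΩ : IsOpen Ω) (H : ℝ) {ψ : ℂ → ℝ} {U : ℂ → ℂ}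
    (hψ : ContDiffOn ℝ ∞ ψ Ω) (hU : ContDiffOn ℝ ∞ U Ω) (l : ℂ) :
    SmoothM (connZbar H ψ U l) Ω := by
  have h1 := (contDiffOn_dzbar hΩ (contDiffOn_ofReal hψ)).div_const 2
  have h2 : ContDiffOn ℝ ∞ (fun z => ((Real.exp (ψ z / 2) : ℝ) : ℂ)) Ω :=
    contDiffOn_ofReal (hψ.div_const 2).exp
  have h3 : ContDiffOn ℝ ∞ (fun z => ((Real.exp (-ψ z) : ℝ) : ℂ)) Ω :=
    contDiffOn_ofReal hψ.neg.exp
  have h4 : ContDiffOn ℝ ∞ (fun z => (starRingEnd ℂ) (U z)) Ω :=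
    (Complex.conjCLE : ℂ →L[ℝ] ℂ).contDiff.comp_contDiffOn hU
  intro i j
  fin_cases i <;> fin_cases j <;> simp only [connZbar] <;> simp [-ofReal_exp]
  any_goals exact contDiffOn_const
  · exact h1.neg
  · exact (contDiffOn_const.mul h4).mul h3
  · exact h1
  · exact contDiffOn_const.mul h2
  · exact contDiffOn_const.mul h2

lemma connZ_eq (H : ℝ) (ψ : ℂ → ℝ) (U : ℂ → ℂ) (l z : ℂ) :
    connZ H ψ U l z = connZ H ψ U 0 z + l • (connZ H ψ U 1 z - connZ H ψ U 0 z) := by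
  ext i j
  fin_cases i <;> fin_cases j <;> simp [connZ] <;> ring

/-- By the convention `0⁻¹ = 0`, the value at parameter `0` is the part of the form that does not
depend on `l`. -/
lemma connZbar_eq (H : ℝ) (ψ : ℂ → ℝ) (U : ℂ → ℂ) (l z : ℂ) :
    connZbar H ψ U l z = connZbar H ψ U 0 z + l⁻¹ • (connZbar H ψ U 1 z - connZbar H ψ U 0 z) := by
  ext i j
  fin_cases i <;> fin_cases j <;> simp [connZbar] <;> ring

/-- Under the Gauss-Codazzi equations, normalized frames exist on star-shaped domains. -/
theorem exists_frame {Ω : Set ℂ} (hΩ : IsOpen Ω) {H : ℝ} (hH : H = 2 ∨ H = -2) {ψ : ℂ → ℝ}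
    {U : ℂ → ℂ} (hψ : ContDiffOn ℝ ∞ ψ Ω) (hU : ContDiffOn ℝ ∞ U Ω)
    (hGC : GaussCodazzi Ω H ψ U) {z₀ : ℂ} (hs : StarConvex ℝ z₀ Ω) :
    ∃ E : ℂ → ℂ → M3, (∀ l, E z₀ l = 1) ∧
      (∀ l : ℂ, l ≠ 0 → ∀ z ∈ Ω, HasWM (fun w => E w l) (E z l * connZ H ψ U l z)
        (E z l * connZbar H ψ U l z) z) ∧
      ∀ z ∈ Ω, ∀ i j, DifferentiableOn ℂ (fun l => E z l i j) {l | l ≠ 0} := by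
  have hZ := smoothM_connZ hΩ H hψ hU
  have hW := smoothM_connZbar hΩ H hψ hU
  obtain ⟨E, h1, h2, h3⟩ := exists_frame_of_flat hΩ hs (Z₀ := connZ H ψ U 0)
    (Z₁ := fun z => connZ H ψ U 1 z - connZ H ψ U 0 z) (W₀ := connZbar H ψ U 0)
    (W₁ := fun z => connZbar H ψ U 1 z - connZbar H ψ U 0 z) (hZ 0)
    (fun i j => (hZ 1 i j).sub (hZ 0 i j)) (hW 0) (fun i j => (hW 1 i j).sub (hW 0 i j))
    (fun l hl w hw => by
      simp only [← connZ_eq, ← connZbar_eq]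
      obtain ⟨Pz, Pb, Qz, Qb, hP, hQ, hiff⟩ := hasWM_conn hΩ hψ hU hw hH hl
      exact ⟨Pz, Pb, Qz, Qb, hP, hQ, hiff.mpr (hGC w hw)⟩)
  simp only [← connZ_eq, ← connZbar_eq] at h2
  exact ⟨E, h1, h2, h3⟩

/-- The existence of one frame implies the Gauss-Codazzi equations. -/
theorem gaussCodazzi_of_frame {Ω : Set ℂ} (hΩ : IsOpen Ω) {H : ℝ} (hH : H = 2 ∨ H = -2)
    {ψ : ℂ → ℝ} {U : ℂ → ℂ} (hψ : ContDiffOn ℝ ∞ ψ Ω) (hU : ContDiffOn ℝ ∞ U Ω) {l : ℂ}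
    (hl : l ≠ 0) {F : ℂ → M3} (hF : ∀ z ∈ Ω, HasWM F (F z * connZ H ψ U l z)
      (F z * connZbar H ψ U l z) z) (hdet : ∀ z ∈ Ω, (F z).det ≠ 0) :
    GaussCodazzi Ω H ψ U := by
  intro z hz
  obtain ⟨Pz, Pb, Qz, Qb, hP, hQ, hiff⟩ := hasWM_conn hΩ hψ hU hz hH hl
  refine hiff.mp ?_
  have hsm := smoothM_of_hasWM hΩ (smoothM_connZ hΩ H hψ hU l) (smoothM_connZbar hΩ H hψ hU l) hF
  have h1 := (hF z hz).mul hP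
  have h2 := (hF z hz).mul hQ
  -- The mixed derivatives `F_{z z̄}` and `F_{z̄ z}`, each expanded by the linear system; cancelling
  -- the invertible `F` leaves the vanishing of the curvature.
  have key : F z * (connZ H ψ U l z * connZbar H ψ U l z + Qz) =
      F z * (connZbar H ψ U l z * connZ H ψ U l z + Pb) := by
    ext i j
    have e1 := (h1.congr (G := fun w => Matrix.of fun i j => dz (fun w => F w i j) w) (by
      filter_upwards [hΩ.mem_nhds hz] with w hw
      ext i j
      exact (hF w hw i j).dz_eq) i j).dzbar_eq
    have e2 := (h2.congr (G := fun w => Matrix.of fun i j => dzbar (fun w => F w i j) w) (by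
      filter_upwards [hΩ.mem_nhds hz] with w hw
      ext i j
      exact (hF w hw i j).dzbar_eq) i j).dz_eq
    have e3 := dz_dzbar_comm hΩ (hsm i j) hz
    simp only [Matrix.of_apply] at e1 e2
    rw [mul_add, mul_add, ← mul_assoc, ← mul_assoc]
    exact e2.symm.trans (e3.trans e1)
  have hu : IsUnit (F z).det := isUnit_iff_ne_zero.mpr (hdet z hz)
  have := congrArg (fun X => (F z)⁻¹ * X) key
  simp only [← mul_assoc, Matrix.nonsing_inv_mul _ hu, one_mul] at this
  rw [← sub_eq_zero] at this
  rw [← neg_eq_zero, ← this]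
  abel

/-! ### Structure equations of definite affine spheres -/

lemma pd_eq_of_hasW {g : ℂ → ℝ} {p q z : ℂ} (h : HasW (fun w => (g w : ℂ)) p q z) (v : ℂ) :
    (pd v g z : ℂ) = p * v + q * (starRingEnd ℂ) v := by
  have hg : DifferentiableAt ℝ g z := by
    simpa using! reCLM.differentiableAt.comp z h.differentiableAt
  have h1 : HasFDerivAt (fun w => (g w : ℂ)) (ofRealCLM ∘L fderiv ℝ g z) z :=
    ofRealCLM.hasFDerivAt.comp z hg.hasFDerivAt
  have h2 := congrArg (fun T : ℂ →L[ℝ] ℂ => T v) (h1.unique h)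
  simpa [pd] using h2

lemma contDiffOn_pd {g : ℂ → ℝ} {D : Set ℂ} (hD : IsOpen D) (hg : ContDiffOn ℝ ∞ g D) (v : ℂ) :
    ContDiffOn ℝ ∞ (pd v g) D :=
  (hg.fderiv_of_isOpen hD (m := ∞) (by simp)).clm_apply contDiffOn_const

/-- First derivatives of a real function through Wirtinger derivatives. -/
lemma pd_first {f : ℂ → ℝ} {D : Set ℂ} (hD : IsOpen D) (hf : ContDiffOn ℝ ∞ f D) {z : ℂ}
    (hz : z ∈ D) :
    (pd 1 f z : ℂ) = dz (fun w => (f w : ℂ)) z + dzbar (fun w => (f w : ℂ)) z ∧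
    (pd I f z : ℂ) = I * (dz (fun w => (f w : ℂ)) z - dzbar (fun w => (f w : ℂ)) z) := by
  have h := hasW_of_contDiffOn hD (contDiffOn_ofReal hf) hz
  constructor
  · rw [pd_eq_of_hasW h]; simp
  · rw [pd_eq_of_hasW h]; simp; ring

lemma dzbar_eq_conj_dz {f : ℂ → ℝ} {D : Set ℂ} (hD : IsOpen D) (hf : ContDiffOn ℝ ∞ f D) {z : ℂ}
    (hz : z ∈ D) : dzbar (fun w => (f w : ℂ)) z = (starRingEnd ℂ) (dz (fun w => (f w : ℂ)) z) := by
  have h := (hasW_of_contDiffOn hD (contDiffOn_ofReal hf) hz).conj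
  simp only [conj_ofReal] at h
  exact h.dzbar_eq

lemma hasW_dz_dzbar {f : ℂ → ℝ} {D : Set ℂ} (hD : IsOpen D) (hf : ContDiffOn ℝ ∞ f D) {z : ℂ}
    (hz : z ∈ D) :
    HasW (dz fun w => (f w : ℂ)) (dz (dz fun w => (f w : ℂ)) z)
      (dzbar (dz fun w => (f w : ℂ)) z) z ∧
    HasW (dzbar fun w => (f w : ℂ)) (dzbar (dz fun w => (f w : ℂ)) z)
      ((starRingEnd ℂ) (dz (dz fun w => (f w : ℂ)) z)) z := by
  have hf' := contDiffOn_ofReal hf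
  have h1 := hasW_of_contDiffOn hD (contDiffOn_dz hD hf') hz
  refine ⟨h1, ?_⟩
  have h2 := hasW_of_contDiffOn hD (contDiffOn_dzbar hD hf') hz
  have h3 : HasW (dzbar fun w => (f w : ℂ)) _ _ z := h1.conj.congr (by
    filter_upwards [hD.mem_nhds hz] with w hw using dzbar_eq_conj_dz hD hf hw)
  refine h2.congr_deriv (dz_dzbar_comm hD hf' hz) (h2.unique h3).2

/-- Second derivatives of a real function through Wirtinger derivatives. -/
lemma pd_second {f : ℂ → ℝ} {D : Set ℂ} (hD : IsOpen D) (hf : ContDiffOn ℝ ∞ f D) {z : ℂ}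
    (hz : z ∈ D) {A B : ℂ} (hA : dz (dz fun w => (f w : ℂ)) z = A)
    (hB : dzbar (dz fun w => (f w : ℂ)) z = B) :
    (pd 1 (pd 1 f) z : ℂ) = A + 2 * B + (starRingEnd ℂ) A ∧
    (pd I (pd I f) z : ℂ) = 2 * B - A - (starRingEnd ℂ) A ∧
    (pd 1 (pd I f) z : ℂ) = I * (A - (starRingEnd ℂ) A) ∧
    (pd I (pd 1 f) z : ℂ) = I * (A - (starRingEnd ℂ) A) := by
  obtain ⟨h1, h2⟩ := hasW_dz_dzbar hD hf hz
  rw [hA, hB] at h1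
  rw [hA, hB] at h2
  have hX : HasW (fun w => (pd 1 f w : ℂ)) _ _ z := (h1.add h2).congr (by
    filter_upwards [hD.mem_nhds hz] with w hw using (pd_first hD hf hw).1)
  have hY : HasW (fun w => (pd I f w : ℂ)) _ _ z := ((h1.sub h2).const_mul I).congr (by
    filter_upwards [hD.mem_nhds hz] with w hw using (pd_first hD hf hw).2)
  refine ⟨?_, ?_, ?_, ?_⟩
  · rw [pd_eq_of_hasW hX]; simp; ring
  · rw [pd_eq_of_hasW hY]; simp only [conj_I]; linear_combination (A - 2 * B + (starRingEnd ℂ) A) * I_sq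
  · rw [pd_eq_of_hasW hY]; simp; ring
  · rw [pd_eq_of_hasW hX]; simp; ring

/-- The structure equations of a definite affine sphere. -/
structure StructureEq (D : Set ℂ) (r : ℂ → Fin 3 → ℝ) (ψ : ℂ → ℝ) (U : ℂ → ℂ) (H : ℝ) : Prop where
  smooth : ∀ k, ContDiffOn ℝ ∞ (fun w => r w k) D
  dz_dz : ∀ z ∈ D, ∀ k, dz (dz fun w => (r w k : ℂ)) z =
    dz (fun w => (ψ w : ℂ)) z * dz (fun w => (r w k : ℂ)) z
      + U z * (Real.exp (-ψ z) : ℂ) * dzbar (fun w => (r w k : ℂ)) z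
  dz_dzbar : ∀ z ∈ D, ∀ k, dzbar (dz fun w => (r w k : ℂ)) z =
    -(H / 2) * (Real.exp (ψ z) : ℂ) * (r z k : ℂ)
  -- This is the trace of `Λ = e^{2ψ} I`: one has `det(·, r_x, r_y) = -2i det(·, r_z, r_z̄)` and
  -- `r_xx + r_yy = 4 r_{z z̄} = -2H e^ψ r`.
  volume : ∀ z ∈ D, Matrix.det (Matrix.of ![fun k => dz (fun w => (r w k : ℂ)) z,
    fun k => dzbar (fun w => (r w k : ℂ)) z, fun k => (r z k : ℂ)]) * H =
      -(I / 2 * (Real.exp (ψ z) : ℂ))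

/-- In dimension two the conformal factor cancels in `√det g · g⁻¹`, so only the outer factor
`e^{-ψ}` remains. -/
lemma laplaceBeltrami_eq {g : ℂ → Matrix (Fin 2) (Fin 2) ℝ} {ψ : ℂ → ℝ} {D : Set ℂ}
    (hD : IsOpen D) (hg : ∀ z ∈ D, g z = Real.exp (ψ z) • (1 : Matrix (Fin 2) (Fin 2) ℝ))
    (f : ℂ → ℝ) {z : ℂ} (hz : z ∈ D) :
    laplaceBeltrami g f z = (Real.exp (ψ z))⁻¹ * (pd 1 (pd 1 f) z + pd I (pd I f) z) := by
  have hdet : ∀ w ∈ D, √(g w).det = Real.exp (ψ w) := by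
    intro w hw
    rw [hg w hw, Matrix.det_smul]
    simp [Real.sqrt_sq (Real.exp_pos _).le]
  have hinv : ∀ w ∈ D, (g w)⁻¹ = (Real.exp (ψ w))⁻¹ • (1 : Matrix (Fin 2) (Fin 2) ℝ) := by
    intro w hw
    apply Matrix.inv_eq_right_inv
    rw [hg w hw]
    simp [smul_smul, (Real.exp_pos (ψ w)).ne']
  have hfun (i : Fin 2) : pd (coordDir i)
      (fun w => √(g w).det * ∑ j : Fin 2, (g w)⁻¹ i j * pd (coordDir j) f w) z =
      pd (coordDir i) (pd (coordDir i) f) z := by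
    unfold pd
    congr 1
    refine Filter.EventuallyEq.fderiv_eq ?_
    filter_upwards [hD.mem_nhds hz] with w hw
    rw [hdet w hw, hinv w hw]
    have := (Real.exp_pos (ψ w)).ne'
    fin_cases i <;> simp [this]
  rw [laplaceBeltrami, hdet z hz]
  simp only [hfun]
  simp [coordDir]

/-- If `Λ = m I` with `m > 0`, then `|det Λ|^{-1/4} = m^{-1/2}`, so the metric is `m^{1/2} I`. -/
lemma affineMetric_eq_iff {r : ℂ → Fin 3 → ℝ} {z : ℂ} {a : ℝ} :
    affineMetric r z = Real.exp a • (1 : Matrix (Fin 2) (Fin 2) ℝ) ↔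
      fundamentalForm r z = Real.exp (2 * a) • (1 : Matrix (Fin 2) (Fin 2) ℝ) := by
  unfold affineMetric
  constructor
  · intro h
    set c := |(fundamentalForm r z).det| ^ (-(1 / 4) : ℝ) with hc
    -- For a degenerate `Λ` the convention `0 ^ (-1/4) = 0` makes the affine metric zero, which is
    -- not `e^a I`.
    have hc0 : c ≠ 0 := by
      intro h0
      rw [h0, zero_smul] at h
      have := congrFun (congrFun h 0) 0
      simp [(Real.exp_pos a).ne] at this
    have hcpos : 0 < c := lt_of_le_of_ne (by positivity) hc0.symm
    have h1 : fundamentalForm r z = (c⁻¹ * Real.exp a) • (1 : Matrix (Fin 2) (Fin 2) ℝ) := by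
      rw [← smul_smul, ← h, smul_smul, inv_mul_cancel₀ hc0, one_smul]
    set m := c⁻¹ * Real.exp a with hm
    have hmpos : 0 < m := by positivity
    have hdet : |(fundamentalForm r z).det| = m ^ 2 := by
      rw [h1, Matrix.det_smul]
      simp
    have hce : c = m ^ (-(1 / 2) : ℝ) := by
      rw [hc, hdet, ← Real.rpow_natCast, ← Real.rpow_mul hmpos.le]
      norm_num
    have hea : Real.exp a = m ^ (1 / 2 : ℝ) := by
      have : Real.exp a = c * m := by rw [hm]; field_simp
      rw [this, hce]
      nth_rw 2 [← Real.rpow_one m]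
      rw [← Real.rpow_add hmpos]
      norm_num
    rw [h1]
    congr 1
    rw [mul_comm, Real.exp_mul, hea, ← Real.rpow_mul hmpos.le]
    norm_num
  · intro h
    rw [h, Matrix.det_smul, smul_smul]
    congr 1
    simp only [Fintype.card_fin, Matrix.det_one, mul_one]
    rw [abs_of_nonneg (by positivity), ← Real.exp_nat_mul, ← Real.exp_mul, ← Real.exp_add]
    congr 1
    push_cast
    ring

/-- The equation for `r_{z z̄}` is the affine normal condition in conformal coordinates, and the
volume equation is the trace of `Λ`. Smoothness of `ψ` is not part of the definition of an affine
sphere and is recovered here. -/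
lemma structureEq_of_sphere {D : Set ℂ} (hD : IsOpen D) {r : ℂ → Fin 3 → ℝ} {ψ : ℂ → ℝ}
    {U : ℂ → ℂ} {H : ℝ} (h : IsDefiniteAffineSphere D r ψ U H) :
    StructureEq D r ψ U H ∧ ContDiffOn ℝ ∞ ψ D := by
  have hsm : ∀ k, ContDiffOn ℝ ∞ (fun w => r w k) D := fun k => contDiffOn_pi.mp h.smooth k
  have hff := fun z hz => affineMetric_eq_iff.mp (h.metric z hz)
  have hlap : ∀ z ∈ D, ∀ k, (pd 1 (pd 1 fun w => r w k) z + pd I (pd I fun w => r w k) z) =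
      -2 * H * Real.exp (ψ z) * r z k := by
    intro z hz k
    have h1 := congrFun (h.sphere z hz) k
    rw [affineNormal, laplaceBeltrami_eq hD h.metric _ hz] at h1
    simp only [Pi.smul_apply, smul_eq_mul] at h1
    have := (Real.exp_pos (ψ z)).ne'
    field_simp at h1
    linarith
  -- `ψ` is half the logarithm of `Λ₁₁`, which is polynomial in the derivatives of `r`.
  have hψ : ContDiffOn ℝ ∞ ψ D := by
    have h1 : ContDiffOn ℝ ∞ (fun z => fundamentalForm r z 0 0) D := by
      simp only [fundamentalForm, Matrix.of_apply, Matrix.det_fin_three]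
      have a1 := fun v k => contDiffOn_pd hD (hsm k) v
      have a2 := fun u v k => contDiffOn_pd hD (a1 v k) u
      simp only [Matrix.cons_val_zero, Matrix.cons_val_one, Matrix.cons_val]
      fun_prop
    have h2 : ContDiffOn ℝ ∞ (fun z => Real.log (fundamentalForm r z 0 0) / 2) D := by
      refine (h1.log fun z hz => ?_).div_const 2
      rw [hff z hz]
      simp
    refine h2.congr fun z hz => ?_
    rw [hff z hz]
    simp
  have hdzb : ∀ z ∈ D, ∀ k, dzbar (dz fun w => (r w k : ℂ)) z =
      -(H / 2) * (Real.exp (ψ z) : ℂ) * (r z k : ℂ) := by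
    intro z hz k
    obtain ⟨e1, e2, -, -⟩ := pd_second hD (hsm k) hz rfl rfl
    have e3 := congrArg (fun x : ℝ => (x : ℂ)) (hlap z hz k)
    push_cast [e1, e2, -ofReal_exp] at e3
    linear_combination e3 / 4
  refine ⟨⟨hsm, h.cubic, hdzb, ?_⟩, hψ⟩
  intro z hz
  have h00 := congrFun (congrFun (hff z hz) 0) 0
  have h11 := congrFun (congrFun (hff z hz) 1) 1
  have hadd := congrArg (fun x : ℝ => (x : ℂ)) (congrArg₂ (· + ·) h00 h11)
  have e1 := fun k => (pd_first hD (hsm k) hz).1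
  have e2 := fun k => (pd_first hD (hsm k) hz).2
  have l1 := fun k => (pd_second hD (hsm k) hz rfl (hdzb z hz k)).1
  have l2 := fun k => (pd_second hD (hsm k) hz rfl (hdzb z hz k)).2.1
  have hexp : Real.exp (2 * ψ z) = Real.exp (ψ z) ^ 2 := by rw [← Real.exp_nat_mul]; simp
  have hE : ((Real.exp (ψ z) : ℝ) : ℂ) ≠ 0 := by exact_mod_cast (Real.exp_pos _).ne'
  rw [Matrix.det_fin_three]
  simp only [fundamentalForm, Matrix.of_apply, Matrix.det_fin_three, coordDir] at hadd
  simp only [Matrix.smul_apply, Matrix.one_apply_eq, smul_eq_mul, mul_one, hexp,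
    Matrix.cons_val_zero, Matrix.cons_val_one, Matrix.cons_val] at hadd
  push_cast [-ofReal_exp, e1, e2, l1, l2] at hadd
  simp only [Matrix.of_apply, Matrix.cons_val_zero, Matrix.cons_val_one, Matrix.cons_val]
  generalize ((Real.exp (ψ z) : ℝ) : ℂ) = E at *
  obtain ⟨a, ha⟩ : ∃ a : Fin 3 → ℂ, ∀ k, dz (fun w => (r w k : ℂ)) z = a k := ⟨_, fun _ => rfl⟩
  obtain ⟨b, hb⟩ : ∃ b : Fin 3 → ℂ, ∀ k, dzbar (fun w => (r w k : ℂ)) z = b k := ⟨_, fun _ => rfl⟩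
  obtain ⟨A, hA⟩ : ∃ A : Fin 3 → ℂ, ∀ k, dz (dz fun w => (r w k : ℂ)) z = A k := ⟨_, fun _ => rfl⟩
  simp only [ha, hb, hA] at hadd ⊢
  apply mul_left_cancel₀ hE
  linear_combination (-I / 4) * hadd + E * H *
    (a 0 * b 1 * r z 2 - a 0 * b 2 * r z 1 - a 1 * b 0 * r z 2 + a 1 * b 2 * r z 0
      + a 2 * b 0 * r z 1 - a 2 * b 1 * r z 0) * I_sq

/-- The parts `r_zz` and `r_z̄z̄` of the second derivatives are tangential and drop out of
`det(r_ij, r_x, r_y)`. Only `r_{z z̄}` survives; it enters `r_xx` and `r_yy` equally and `r_xy` not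
at all, so `Λ` is conformal. -/
lemma sphere_of_structureEq {D : Set ℂ} (hD : IsOpen D) {r : ℂ → Fin 3 → ℝ} {ψ : ℂ → ℝ}
    {U : ℂ → ℂ} {H : ℝ} (h : StructureEq D r ψ U H) :
    IsDefiniteAffineSphere D r ψ U H := by
  have hsm := h.smooth
  have hmetric : ∀ z ∈ D, affineMetric r z = Real.exp (ψ z) • (1 : Matrix (Fin 2) (Fin 2) ℝ) := by
    intro z hz
    rw [affineMetric_eq_iff]
    have e1 := fun k => (pd_first hD (hsm k) hz).1
    have e2 := fun k => (pd_first hD (hsm k) hz).2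
    have l := fun k => pd_second hD (hsm k) hz (h.dz_dz z hz k) (h.dz_dzbar z hz k)
    have l1 := fun k => (l k).1
    have l2 := fun k => (l k).2.1
    have l3 := fun k => (l k).2.2.1
    have l4 := fun k => (l k).2.2.2
    have hv := h.volume z hz
    have hcj := fun k => dzbar_eq_conj_dz hD (hsm k) hz
    have hcj' : ∀ k, (starRingEnd ℂ) (dzbar (fun w => (r w k : ℂ)) z) =
        dz (fun w => (r w k : ℂ)) z := fun k => by rw [hcj, conj_conj]
    have hexp : Real.exp (2 * ψ z) = Real.exp (ψ z) ^ 2 := by rw [← Real.exp_nat_mul]; simp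
    rw [Matrix.det_fin_three] at hv
    simp only [Matrix.of_apply, Matrix.cons_val_zero, Matrix.cons_val_one, Matrix.cons_val] at hv
    simp only [map_add, map_mul, ← hcj, hcj'] at l1 l2 l3 l4
    ext i j
    apply ofReal_injective
    have hone : ((Real.exp (2 * ψ z) • (1 : Matrix (Fin 2) (Fin 2) ℝ)) i j : ℂ) =
      ((Real.exp (ψ z) : ℝ) : ℂ) ^ 2 * (if i = j then 1 else 0) := by
      rw [hexp]
      by_cases hij : i = j <;> simp [hij]
    rw [hone]
    simp only [fundamentalForm, Matrix.of_apply, Matrix.det_fin_three]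
    simp only [Matrix.cons_val_zero, Matrix.cons_val_one, Matrix.cons_val]
    fin_cases i <;> fin_cases j <;>
      simp only [coordDir, Matrix.cons_val_zero, Matrix.cons_val_one, Fin.zero_eta, Fin.mk_one] <;>
      push_cast [-ofReal_exp, e1, e2, l1, l2, l3, l4] <;>
      generalize ((Real.exp (ψ z) : ℝ) : ℂ) = E at * <;>
      generalize ((Real.exp (-ψ z) : ℝ) : ℂ) = E' at *
    · linear_combination (2 * I * E) * hv - E ^ 2 * I_sq
    · simp
      ring
    · simp
      ring
    · linear_combination (2 * I * E) * hv - E ^ 2 * I_sq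
  refine ⟨contDiffOn_pi.mpr h.smooth, hmetric, ?_, h.dz_dz⟩
  intro z hz
  ext k
  rw [affineNormal, laplaceBeltrami_eq hD hmetric _ hz]
  obtain ⟨e1, e2, -, -⟩ := pd_second hD (hsm k) hz rfl (h.dz_dzbar z hz k)
  apply ofReal_injective
  have hE : ((Real.exp (ψ z) : ℝ) : ℂ) ≠ 0 := by exact_mod_cast (Real.exp_pos _).ne'
  push_cast [e1, e2, -ofReal_exp]
  simp [-ofReal_exp]
  field_simp
  ring

/-! ### Frames of affine spheres -/

/-- All exponentials become powers of the single nonzero quantity `e^{x/2}`, so that the later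
identities are rational in it. -/
lemma exp_half_identities (x : ℝ) :
    ((Real.exp (x / 2) : ℝ) : ℂ) ≠ 0 ∧
    ((Real.exp x : ℝ) : ℂ) = ((Real.exp (x / 2) : ℝ) : ℂ) ^ 2 ∧
    ((Real.exp (-x) : ℝ) : ℂ) = (((Real.exp (x / 2) : ℝ) : ℂ) ^ 2)⁻¹ ∧
    ((Real.exp (-x / 2) : ℝ) : ℂ) = (((Real.exp (x / 2) : ℝ) : ℂ))⁻¹ := by
  have h1 : Real.exp x = Real.exp (x / 2) ^ 2 := by
    rw [← Real.exp_nat_mul]; congr 1; push_cast; ring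
  refine ⟨by exact_mod_cast (Real.exp_pos _).ne', by rw [h1]; push_cast; rfl, ?_, ?_⟩
  · rw [Real.exp_neg, h1]; push_cast; rfl
  · rw [neg_div, Real.exp_neg]; push_cast; rfl

/-- The scalings of the first two columns multiply to `-2H e^{-ψ}`, in which `l` cancels and which
cancels the `e^ψ` of the volume equation. -/
lemma det_surfaceFrame {D : Set ℂ} {r : ℂ → Fin 3 → ℝ} {ψ : ℂ → ℝ} {U : ℂ → ℂ} {H : ℝ}
    (hH : H = 2 ∨ H = -2) (h : StructureEq D r ψ U H) {l z : ℂ} (hl : l ≠ 0) (hz : z ∈ D) :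
    (surfaceFrame H ψ r l z).det = -I * H := by
  have hv := h.volume z hz
  have hk := sqrt_neg_half_sq hH
  obtain ⟨hf, e1, e2, e3⟩ := exp_half_identities (ψ z)
  rw [Matrix.det_fin_three] at hv ⊢
  simp only [surfaceFrame, Matrix.of_apply, Matrix.cons_val_zero, Matrix.cons_val_one,
    Matrix.cons_val, sqrt_neg_two_mul hH, e1, e3] at hv ⊢
  generalize ((Real.exp (ψ z / 2) : ℝ) : ℂ) = f at *
  generalize Complex.sqrt ((-H / 2 : ℝ) : ℂ) = k at *
  field_simp
  linear_combination (-4 * k ^ 2) * hv + 2 * I * f ^ 2 * hk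

/-- The moving frame of an affine sphere satisfies the linear system with `l = 1`. -/
lemma hasWM_surfaceFrame {D : Set ℂ} (hD : IsOpen D) {r : ℂ → Fin 3 → ℝ} {ψ : ℂ → ℝ} {U : ℂ → ℂ}
    {H : ℝ} (hH : H = 2 ∨ H = -2) (h : StructureEq D r ψ U H) (hψ : ContDiffOn ℝ ∞ ψ D) {z : ℂ}
    (hz : z ∈ D) :
    HasWM (surfaceFrame H ψ r 1) (surfaceFrame H ψ r 1 z * connZ H ψ U 1 z)
      (surfaceFrame H ψ r 1 z * connZbar H ψ U 1 z) z := by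
  have hk := sqrt_neg_half_sq hH
  have hp := hasW_of_contDiffOn hD (contDiffOn_ofReal hψ) hz
  have hpc := dzbar_eq_conj_dz hD hψ hz
  obtain ⟨hf, e1, e2, e3⟩ := exp_half_identities (ψ z)
  have hs := (hasW_exp_neg_half hp).const_mul (Complex.sqrt ((-2 * H : ℝ) : ℂ))
  intro i j
  have hr := hasW_of_contDiffOn hD (contDiffOn_ofReal (h.smooth i)) hz
  have hrc := dzbar_eq_conj_dz hD (h.smooth i) hz
  have hrc' : (starRingEnd ℂ) (dzbar (fun w => (r w i : ℂ)) z) = dz (fun w => (r w i : ℂ)) z := by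
    rw [hrc, conj_conj]
  obtain ⟨h1, h2⟩ := hasW_dz_dzbar hD (h.smooth i) hz
  have hA := h.dz_dz z hz i
  have hB := h.dz_dzbar z hz i
  rw [hA, hB] at h1
  rw [hA, hB] at h2
  simp only [map_add, map_mul, ← hrc, hrc', ← hpc, conj_ofReal] at h2
  have a0 := hs.mul h1
  have a1 := hs.mul h2
  have a2 := hr.const_mul (-(H : ℂ))
  fin_cases j
  · simp only [surfaceFrame, connZ, connZbar, Matrix.mul_apply, Fin.sum_univ_three,
      Matrix.of_apply, Fin.zero_eta, Matrix.cons_val_zero, Matrix.cons_val_one, Matrix.cons_val,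
      Fin.isValue, Matrix.cons_val', inv_one, one_mul, mul_one]
    refine a0.congr_deriv ?_ ?_ <;>
    · simp only [e1, e2, e3, sqrt_neg_two_mul hH]
      field_simp
      ring
  · simp only [surfaceFrame, connZ, connZbar, Matrix.mul_apply, Fin.sum_univ_three,
      Matrix.of_apply, Fin.mk_one, Matrix.cons_val_zero, Matrix.cons_val_one, Matrix.cons_val,
      Fin.isValue, Matrix.cons_val', inv_one, one_mul, mul_one]
    refine a1.congr_deriv ?_ ?_ <;>
    · simp only [e1, e2, e3, sqrt_neg_two_mul hH]
      field_simp
      ring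
  · simp only [surfaceFrame, connZ, connZbar, Matrix.mul_apply, Fin.sum_univ_three,
      Matrix.of_apply, Fin.reduceFinMk, Matrix.cons_val_zero, Matrix.cons_val_one, Matrix.cons_val,
      Fin.isValue, Matrix.cons_val', inv_one, one_mul, mul_one]
    refine a2.congr_deriv ?_ ?_
    · simp only [e3, sqrt_neg_two_mul hH]
      generalize Complex.sqrt ((-H / 2 : ℝ) : ℂ) = k at *
      generalize ((Real.exp (ψ z / 2) : ℝ) : ℂ) = f at *
      field_simp
      linear_combination (-2 * f * dz (fun w => (r w i : ℂ)) z) * hk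
    · simp only [e3, sqrt_neg_two_mul hH]
      generalize Complex.sqrt ((-H / 2 : ℝ) : ℂ) = k at *
      generalize ((Real.exp (ψ z / 2) : ℝ) : ℂ) = f at *
      field_simp
      linear_combination (-2 * f * dzbar (fun w => (r w i : ℂ)) z) * hk

/-- `U e^{-ψ}` is an entry of `F⁻¹ F_z`, where `F` is the moving frame, which is smooth and
invertible. -/
lemma contDiffOn_cubic {D : Set ℂ} (hD : IsOpen D) {r : ℂ → Fin 3 → ℝ} {ψ : ℂ → ℝ} {U : ℂ → ℂ}
    {H : ℝ} (hH : H = 2 ∨ H = -2) (h : StructureEq D r ψ U H) (hψ : ContDiffOn ℝ ∞ ψ D) :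
    ContDiffOn ℝ ∞ U D := by
  have hs : ContDiffOn ℝ ∞ (fun z => ((Real.exp (-ψ z / 2) : ℝ) : ℂ)) D :=
    contDiffOn_ofReal (hψ.neg.div_const 2).exp
  have he : ContDiffOn ℝ ∞ (fun z => ((Real.exp (ψ z) : ℝ) : ℂ)) D := contDiffOn_ofReal hψ.exp
  have hr := fun k => contDiffOn_ofReal (h.smooth k)
  have hF : SmoothM (surfaceFrame H ψ r 1) D := by
    intro i j
    fin_cases j <;> simp only [surfaceFrame]
    · exact (contDiffOn_const.mul hs).mul (contDiffOn_dz hD (hr i))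
    · exact (contDiffOn_const.mul hs).mul (contDiffOn_dzbar hD (hr i))
    · exact contDiffOn_const.mul (hr i)
  have hH0 : (H : ℂ) ≠ 0 := by rcases hH with rfl | rfl <;> norm_num
  have hdet : ∀ z ∈ D, (surfaceFrame H ψ r 1 z).det ≠ 0 := fun z hz => by
    rw [det_surfaceFrame hH h one_ne_zero hz]; simp [hH0]
  have hFi := hF.inv hdet
  have hDF : ∀ i j, ContDiffOn ℝ ∞ (dz fun z => surfaceFrame H ψ r 1 z i j) D :=
    fun i j => contDiffOn_dz hD (hF i j)
  have key : ContDiffOn ℝ ∞ (fun z => ((Real.exp (ψ z) : ℝ) : ℂ) *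
      ∑ k, (surfaceFrame H ψ r 1 z)⁻¹ 1 k * dz (fun z => surfaceFrame H ψ r 1 z k 0) z) D :=
    he.mul (ContDiffOn.sum fun k _ => (hFi 1 k).mul (hDF k 0))
  refine key.congr fun z hz => ?_
  have hW := hasWM_surfaceFrame hD hH h hψ hz
  have h1 : ∑ k, (surfaceFrame H ψ r 1 z)⁻¹ 1 k * dz (fun z => surfaceFrame H ψ r 1 z k 0) z =
      ((surfaceFrame H ψ r 1 z)⁻¹ * (surfaceFrame H ψ r 1 z * connZ H ψ U 1 z)) 1 0 := by
    rw [Matrix.mul_apply]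
    exact Finset.sum_congr rfl fun k _ => by rw [(hW k 0).dz_eq]
  rw [h1, ← mul_assoc, Matrix.nonsing_inv_mul _ (isUnit_iff_ne_zero.mpr (hdet z hz)), one_mul]
  obtain ⟨hf, e1, e2, e3⟩ := exp_half_identities (ψ z)
  simp only [connZ, Matrix.of_apply, Matrix.cons_val_zero, Matrix.cons_val_one, Matrix.cons_val',
    e1, e2]
  field_simp

/-- A solution of the linear system whose last column is real up to the factor `-H` is the frame
of an affine sphere. -/
lemma sphere_of_frame {G : Set ℂ} (hG : IsOpen G) {r : ℂ → Fin 3 → ℝ} {ψ : ℂ → ℝ} {U : ℂ → ℂ}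
    {H : ℝ} (hH : H = 2 ∨ H = -2) (hψ : ContDiffOn ℝ ∞ ψ G) (hU : ContDiffOn ℝ ∞ U G) {l : ℂ}
    (hl : l ≠ 0) {F : ℂ → M3} (hF : ∀ z ∈ G, HasWM F (F z * connZ H ψ U l z)
      (F z * connZbar H ψ U l z) z) (hdet : ∀ z ∈ G, (F z).det = -I * H)
    (hr : ∀ z ∈ G, ∀ k, F z k 2 = -(H : ℂ) * (r z k : ℂ)) :
    IsDefiniteAffineSphere G r ψ (fun z => l ^ 3 * U z) H ∧
      ∀ z ∈ G, surfaceFrame H ψ r l z = F z := by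
  have hk := sqrt_neg_half_sq hH
  have hk0 := sqrt_neg_half_ne_zero hH
  have hH0 : (H : ℂ) ≠ 0 := by rcases hH with rfl | rfl <;> norm_num
  have hH2 : (H : ℂ) ^ 2 = 4 := by rcases hH with rfl | rfl <;> norm_num
  have hsm := smoothM_of_hasWM hG (smoothM_connZ hG H hψ hU l) (smoothM_connZbar hG H hψ hU l) hF
  have hcancel : ∀ x : ℂ, -(H : ℂ)⁻¹ * (-(H : ℂ) * x) = x := fun x => by field_simp
  have hrsm : ∀ k, ContDiffOn ℝ ∞ (fun w => r w k) G := by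
    intro k
    have h1 : ContDiffOn ℝ ∞ (fun w => (-(H : ℂ)⁻¹ * F w k 2).re) G :=
      reCLM.contDiff.comp_contDiffOn (contDiffOn_const.mul (hsm k 2))
    refine h1.congr fun z hz => ?_
    rw [hr z hz k, hcancel, ofReal_re]
  -- The last column of the linear system expresses `r_z` and `r_z̄` through the first two columns
  -- of `F`; with `k² = -H/2` this identifies `F` with the frame of `r`.
  have hrW : ∀ z ∈ G, ∀ k, HasW (fun w => (r w k : ℂ))
      (-(H : ℂ)⁻¹ * Complex.sqrt ((-H / 2 : ℝ) : ℂ) * l * (Real.exp (ψ z / 2) : ℝ) * F z k 0)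
      (-(H : ℂ)⁻¹ * Complex.sqrt ((-H / 2 : ℝ) : ℂ) * l⁻¹ * (Real.exp (ψ z / 2) : ℝ) * F z k 1)
      z := by
    intro z hz k
    refine ((hF z hz k 2).const_mul (-(H : ℂ)⁻¹)).congr (g := fun w => (r w k : ℂ)) ?_
      |>.congr_deriv ?_ ?_
    · filter_upwards [hG.mem_nhds hz] with w hw
      rw [hr w hw k, hcancel]
    · simp [connZ, Matrix.mul_apply, Fin.sum_univ_three, -ofReal_exp]; ring
    · simp [connZbar, Matrix.mul_apply, Fin.sum_univ_three, -ofReal_exp]; ring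
  have hrz := fun z hz k => (hrW z hz k).dz_eq
  have hrb := fun z hz k => (hrW z hz k).dzbar_eq
  have hframe : ∀ z ∈ G, surfaceFrame H ψ r l z = F z := by
    intro z hz
    obtain ⟨hf, e1, e2, e3⟩ := exp_half_identities (ψ z)
    ext k j
    fin_cases j <;> simp only [surfaceFrame, Matrix.of_apply, Fin.zero_eta, Fin.mk_one,
      Fin.reduceFinMk, Matrix.cons_val_zero, Matrix.cons_val_one, Matrix.cons_val, hrz z hz,
      hrb z hz, e3, sqrt_neg_two_mul hH]
    · generalize Complex.sqrt ((-H / 2 : ℝ) : ℂ) = κ at *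
      field_simp
      linear_combination (-2 * F z k 0) * hk
    · generalize Complex.sqrt ((-H / 2 : ℝ) : ℂ) = κ at *
      field_simp
      linear_combination (-2 * F z k 1) * hk
    · exact (hr z hz k).symm
  refine ⟨sphere_of_structureEq hG ⟨hrsm, ?_, ?_, ?_⟩, hframe⟩
  · intro z hz k
    obtain ⟨hf, e1, e2, e3⟩ := exp_half_identities (ψ z)
    have hp := hasW_of_contDiffOn hG (contDiffOn_ofReal hψ) hz
    have h1 : HasW (dz fun w => (r w k : ℂ)) _ _ z :=
      (((hasW_exp_half hp).const_mul (-(H : ℂ)⁻¹ * Complex.sqrt ((-H / 2 : ℝ) : ℂ) * l)).mul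
        (hF z hz k 0)).congr (by filter_upwards [hG.mem_nhds hz] with w hw using hrz w hw k)
    rw [h1.dz_eq, hrz z hz, hrb z hz]
    simp [connZ, Matrix.mul_apply, Fin.sum_univ_three, -ofReal_exp, e2]
    field_simp
    ring
  · intro z hz k
    obtain ⟨hf, e1, e2, e3⟩ := exp_half_identities (ψ z)
    have hp := hasW_of_contDiffOn hG (contDiffOn_ofReal hψ) hz
    have h1 : HasW (dz fun w => (r w k : ℂ)) _ _ z :=
      (((hasW_exp_half hp).const_mul (-(H : ℂ)⁻¹ * Complex.sqrt ((-H / 2 : ℝ) : ℂ) * l)).mul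
        (hF z hz k 0)).congr (by filter_upwards [hG.mem_nhds hz] with w hw using hrz w hw k)
    rw [h1.dzbar_eq]
    simp only [connZbar, Matrix.mul_apply, Fin.sum_univ_three, e1, hr z hz, Matrix.of_apply,
      Matrix.cons_val', Matrix.cons_val_zero, Matrix.cons_val_one, Matrix.cons_val]
    generalize Complex.sqrt ((-H / 2 : ℝ) : ℂ) = κ at *
    generalize ((Real.exp (ψ z / 2) : ℝ) : ℂ) = f at *
    field_simp
    linear_combination (2 * H * f * (r z k : ℂ)) * hk
  · intro z hz
    obtain ⟨hf, e1, e2, e3⟩ := exp_half_identities (ψ z)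
    have hd := hdet z hz
    rw [← hframe z hz, Matrix.det_fin_three] at hd
    rw [Matrix.det_fin_three]
    simp only [surfaceFrame, Matrix.of_apply, Matrix.cons_val_zero, Matrix.cons_val_one,
      Matrix.cons_val, sqrt_neg_two_mul hH, e1, e3] at hd ⊢
    generalize ((Real.exp (ψ z / 2) : ℝ) : ℂ) = f at *
    generalize Complex.sqrt ((-H / 2 : ℝ) : ℂ) = k at *
    obtain ⟨a, ha⟩ : ∃ a : Fin 3 → ℂ, ∀ k, dz (fun w => (r w k : ℂ)) z = a k := ⟨_, fun _ => rfl⟩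
    obtain ⟨b, hb⟩ : ∃ b : Fin 3 → ℂ, ∀ k, dzbar (fun w => (r w k : ℂ)) z = b k :=
      ⟨_, fun _ => rfl⟩
    simp only [ha, hb] at hd ⊢
    field_simp at hd ⊢
    linear_combination hd + (4 * (a 0 * (b 1 * (r z 2 : ℂ) - (r z 1 : ℂ) * b 2) -
      (r z 2 : ℂ) * b 0 * a 1 + b 2 * a 1 * (r z 0 : ℂ) + (r z 1 : ℂ) * b 0 * a 2 -
        b 1 * a 2 * (r z 0 : ℂ))) * hk

/-- For real `r`, conjugation swaps `r_z` and `r_z̄`, and the root of `-2H` contributes the sign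
`-H/2`. This is the condition on a constant left factor under which `τ`-real frames give real
surfaces, see `last_column_real`. -/
lemma conj_surfaceFrame {D : Set ℂ} (hD : IsOpen D) {r : ℂ → Fin 3 → ℝ} {ψ : ℂ → ℝ}
    {H : ℝ} (hH : H = 2 ∨ H = -2) (h : ∀ k, ContDiffOn ℝ ∞ (fun w => r w k) D) {z : ℂ}
    (hz : z ∈ D) : (surfaceFrame H ψ r 1 z).map (starRingEnd ℂ) =
      (-(H : ℂ) / 2) • (surfaceFrame H ψ r 1 z * matT H) := by
  have hH2 : (H : ℂ) ^ 2 = 4 := by rcases hH with rfl | rfl <;> norm_num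
  have hc := conj_sqrt_neg_half hH
  ext i j
  have hrc := dzbar_eq_conj_dz hD (h i) hz
  have hrc' : (starRingEnd ℂ) (dzbar (fun w => (r w i : ℂ)) z) = dz (fun w => (r w i : ℂ)) z := by
    rw [hrc, conj_conj]
  have hc2 : (starRingEnd ℂ) (2 : ℂ) = 2 := map_ofNat _ 2
  simp only [surfaceFrame, sqrt_neg_two_mul hH]
  generalize Complex.sqrt ((-H / 2 : ℝ) : ℂ) = k at *
  fin_cases j <;>
    simp [matT, Matrix.mul_apply, Fin.sum_univ_three, ← hrc, hrc', -ofReal_exp, hc, hc2]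
  · ring
  · ring
  · linear_combination (-(H : ℂ) * r z i / 4) * hH2

/-! ### The loop-group symmetries of a frame -/

/-- `F` solves the linear system `dF = F α_l` on `Ω`. -/
abbrev SolvesOn (Ω : Set ℂ) (H : ℝ) (ψ : ℂ → ℝ) (U : ℂ → ℂ) (l : ℂ) (F : ℂ → M3) : Prop :=
  ∀ z ∈ Ω, HasWM F (F z * connZ H ψ U l z) (F z * connZbar H ψ U l z) z

lemma IsExtendedFrame.solvesOn {Ω : Set ℂ} (hΩ : IsOpen Ω) {H : ℝ} {ψ : ℂ → ℝ} {U : ℂ → ℂ}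
    {E : ℂ → ℂ → M3} (hE : IsExtendedFrame Ω H ψ U E) {l : ℂ} (hl : l ≠ 0) :
    SolvesOn Ω H ψ U l fun w => E w l := fun z hz =>
  (SmoothM.hasWM hΩ (hE.smooth l hl) hz).congr_deriv (hE.eq_dz l hl z hz) (hE.eq_dzbar l hl z hz)

lemma isExtendedFrame_of_solvesOn {Ω : Set ℂ} (hΩ : IsOpen Ω) {H : ℝ} {ψ : ℂ → ℝ} {U : ℂ → ℂ}
    (hψ : ContDiffOn ℝ ∞ ψ Ω) (hU : ContDiffOn ℝ ∞ U Ω) {E : ℂ → ℂ → M3}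
    (hE : ∀ l : ℂ, l ≠ 0 → SolvesOn Ω H ψ U l fun w => E w l)
    (hdet : ∀ l : ℂ, l ≠ 0 → ∀ z ∈ Ω, (E z l).det ≠ 0) : IsExtendedFrame Ω H ψ U E where
  smooth l hl := smoothM_of_hasWM hΩ (smoothM_connZ hΩ H hψ hU l) (smoothM_connZbar hΩ H hψ hU l)
    (hE l hl)
  det_ne_zero := hdet
  eq_dz l hl z hz := by ext i j; exact (hE l hl z hz i j).dz_eq
  eq_dzbar l hl z hz := by ext i j; exact (hE l hl z hz i j).dzbar_eq

lemma trace_connZ (H : ℝ) (ψ : ℂ → ℝ) (U : ℂ → ℂ) (l z : ℂ) : (connZ H ψ U l z).trace = 0 := by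
  simp [connZ, Matrix.trace_fin_three]

lemma trace_connZbar (H : ℝ) (ψ : ℂ → ℝ) (U : ℂ → ℂ) (l z : ℂ) :
    (connZbar H ψ U l z).trace = 0 := by
  simp [connZbar, Matrix.trace_fin_three]

lemma SolvesOn.det_eq {Ω : Set ℂ} (hΩ : IsOpen Ω) (hc : IsPreconnected Ω) {H : ℝ} {ψ : ℂ → ℝ}
    {U : ℂ → ℂ} {l : ℂ} {F : ℂ → M3} (hF : SolvesOn Ω H ψ U l F) {x y : ℂ} (hx : x ∈ Ω)
    (hy : y ∈ Ω) : (F x).det = (F y).det :=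
  det_const_of_hasWM hΩ hc hF (fun _ _ => trace_connZ ..) (fun _ _ => trace_connZbar ..) hx hy

/-- Entrywise holomorphy on a set. -/
def HoloM (F : ℂ → M3) (S : Set ℂ) : Prop := ∀ i j, DifferentiableOn ℂ (fun l => F l i j) S

lemma HoloM.mul {F G : ℂ → M3} {S : Set ℂ} (hF : HoloM F S) (hG : HoloM G S) :
    HoloM (fun l => F l * G l) S := by
  intro i j
  simp only [Matrix.mul_apply]
  exact DifferentiableOn.fun_sum fun k _ => (hF i k).mul (hG k j)

lemma holoM_const (C : M3) (S : Set ℂ) : HoloM (fun _ => C) S :=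
  fun _ _ => differentiableOn_const _

lemma HoloM.congr {F G : ℂ → M3} {S : Set ℂ} (hF : HoloM F S) (h : ∀ l ∈ S, G l = F l) :
    HoloM G S := fun i j => (hF i j).congr fun z hz => by rw [h z hz]

lemma HoloM.transpose {F : ℂ → M3} {S : Set ℂ} (hF : HoloM F S) : HoloM (fun l => (F l)ᵀ) S :=
  fun i j => hF j i

lemma HoloM.inv {F : ℂ → M3} {S : Set ℂ} (hF : HoloM F S) (h0 : ∀ z ∈ S, (F z).det ≠ 0) :
    HoloM (fun z => (F z)⁻¹) S := by
  have h := hF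
  unfold HoloM at h
  have hd : DifferentiableOn ℂ (fun w => ((F w).det)⁻¹) S := by
    refine DifferentiableOn.inv ?_ h0
    simp only [Matrix.det_fin_three]
    fun_prop
  intro i j
  have e : (fun w => (F w)⁻¹ i j) = fun w => ((F w).det)⁻¹ * (F w).adjugate i j := by
    ext w; simp [Matrix.inv_def]
  rw [e]
  refine hd.mul ?_
  simp only [Matrix.adjugate_fin_three]
  fin_cases i <;> fin_cases j <;> simp <;> fun_prop

/-- Near each point, frames are products of their value at the point with a normalized frame. -/
lemma exists_local_frame {Ω : Set ℂ} (hΩ : IsOpen Ω) {H : ℝ} (hH : H = 2 ∨ H = -2) {ψ : ℂ → ℝ}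
    {U : ℂ → ℂ} (hψ : ContDiffOn ℝ ∞ ψ Ω) (hU : ContDiffOn ℝ ∞ U Ω)
    (hGC : GaussCodazzi Ω H ψ U) {x : ℂ} (hx : x ∈ Ω) :
    ∃ e > 0, Metric.ball x e ⊆ Ω ∧ ∃ G : ℂ → ℂ → M3,
      (∀ l : ℂ, l ≠ 0 → SolvesOn (Metric.ball x e) H ψ U l fun w => G w l) ∧
      (∀ l : ℂ, l ≠ 0 → ∀ z ∈ Metric.ball x e, (G z l).det = 1) ∧
      (∀ z ∈ Metric.ball x e, HoloM (G z) {l | l ≠ 0}) ∧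
      ∀ l : ℂ, l ≠ 0 → ∀ F : ℂ → M3, SolvesOn (Metric.ball x e) H ψ U l F →
        ∀ z ∈ Metric.ball x e, F z = F x * G z l := by
  obtain ⟨e, he, hsub⟩ := Metric.isOpen_iff.mp hΩ x hx
  have hb : IsOpen (Metric.ball x e) := Metric.isOpen_ball
  have hxe : x ∈ Metric.ball x e := Metric.mem_ball_self he
  have hpc : IsPreconnected (Metric.ball x e) := (convex_ball x e).isPreconnected
  obtain ⟨G, h1, h2, h3⟩ := exists_frame hb hH (hψ.mono hsub) (hU.mono hsub)
    (fun z hz => hGC z (hsub hz)) ((convex_ball x e).starConvex hxe)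
  have hdet : ∀ l : ℂ, l ≠ 0 → ∀ z ∈ Metric.ball x e, (G z l).det = 1 := fun l hl z hz => by
    rw [SolvesOn.det_eq (F := fun w => G w l) hb hpc (h2 l hl) hz hxe, h1, Matrix.det_one]
  refine ⟨e, he, hsub, G, h2, hdet, h3, fun l hl F hF z hz => ?_⟩
  have := frame_unique hb hpc hF (h2 l hl)
    (fun z hz => by rw [hdet l hl z hz]; exact one_ne_zero) hxe hz
  rw [this, h1, inv_one, mul_one]

/-- Holomorphy in `l` is not part of the notion of a frame. It propagates over the connected domain,
because locally `E(y, l)` is `E(x, l)` times a frame built by transport, which is holomorphic in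
`l`. -/
lemma holoM_frame {Ω : Set ℂ} (hΩ : IsOpen Ω) (hc : IsPreconnected Ω) {H : ℝ}
    (hH : H = 2 ∨ H = -2) {ψ : ℂ → ℝ} {U : ℂ → ℂ} (hψ : ContDiffOn ℝ ∞ ψ Ω)
    (hU : ContDiffOn ℝ ∞ U Ω) (hGC : GaussCodazzi Ω H ψ U) {E : ℂ → ℂ → M3}
    (hE : IsExtendedFrame Ω H ψ U E) {x y : ℂ} (hx : x ∈ Ω) (hy : y ∈ Ω)
    (h : HoloM (E x) {l | l ≠ 0}) : HoloM (E y) {l | l ≠ 0} := by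
  refine (hc.induction₂ (fun x y => HoloM (E x) {l | l ≠ 0} ↔ HoloM (E y) {l | l ≠ 0})
    (fun x hx => ?_) (fun _ _ _ _ _ _ => Iff.trans) (fun _ _ _ _ => Iff.symm) hx hy).mp h
  obtain ⟨e, he, hsub, G, -, h2, h3, h4⟩ := exists_local_frame hΩ hH hψ hU hGC hx
  filter_upwards [nhdsWithin_le_nhds (Metric.ball_mem_nhds x he)] with y hy
  have key : ∀ l : ℂ, l ≠ 0 → E y l = E x l * G y l := fun l hl =>
    h4 l hl (fun w => E w l) (fun z hz => hE.solvesOn hΩ hl z (hsub hz)) y hy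
  have hne : ∀ l : ℂ, l ≠ 0 → (G y l).det ≠ 0 := fun l hl => by
    rw [h2 l hl y hy]; exact one_ne_zero
  refine ⟨fun h => (h.mul (h3 y hy)).congr key, fun h =>
    (h.mul ((h3 y hy).inv hne)).congr fun l hl => ?_⟩
  rw [key l hl, mul_assoc, Matrix.mul_nonsing_inv _ (isUnit_iff_ne_zero.mpr (hne l hl)), mul_one]

/-! #### The two involutions -/

lemma matT_mul_matT {H : ℝ} (hH : H = 2 ∨ H = -2) : matT H * matT H = 1 := by
  have hH2 : (H : ℂ) ^ 2 = 4 := by rcases hH with rfl | rfl <;> norm_num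
  ext i j
  fin_cases i <;> fin_cases j <;>
    simp [matT, Matrix.mul_apply, Fin.sum_univ_three, -Matrix.cons_mul]
  linear_combination hH2 / 4

lemma matT_inv {H : ℝ} (hH : H = 2 ∨ H = -2) : (matT H)⁻¹ = matT H :=
  Matrix.inv_eq_left_inv (matT_mul_matT hH)

lemma eps_pow_three : eps ^ 3 = -1 := by
  rw [eps, ← Complex.exp_nat_mul, ← Complex.exp_pi_mul_I]
  congr 1
  push_cast
  ring

/-- Among the roots of `X³ + 1 = (X + 1)(X² - X + 1)`, the real part `1/2` excludes `-1`. -/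
lemma eps_sq : eps ^ 2 = eps - 1 := by
  have h : (eps + 1) * (eps ^ 2 - eps + 1) = 0 := by linear_combination eps_pow_three
  rcases mul_eq_zero.mp h with h | h
  · exfalso
    have h1 : eps.re = 1 / 2 := by
      rw [eps, show (Real.pi : ℂ) * I / 3 = ((Real.pi / 3 : ℝ) : ℂ) * I by push_cast; ring,
        Complex.exp_ofReal_mul_I_re, Real.cos_pi_div_three]
    have h2 := congrArg Complex.re h
    simp [h1] at h2
    norm_num at h2
  · linear_combination h

lemma eps_ne_zero : eps ≠ 0 := Complex.exp_ne_zero _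

lemma eps_inv : eps⁻¹ = -eps ^ 2 := by
  rw [inv_eq_iff_eq_inv, eq_comm, inv_eq_iff_eq_inv]
  refine eq_inv_of_mul_eq_one_left ?_
  linear_combination -eps_pow_three

lemma matP_mul_matP : matP * matP = 1 := by
  have h := eps_pow_three
  have h' : eps ^ 4 * eps ^ 2 = 1 := by linear_combination (eps ^ 3 - 1) * h
  ext i j
  fin_cases i <;> fin_cases j <;> simp [matP, Matrix.mul_apply, Fin.sum_univ_three, h']
  rw [mul_comm, h']

lemma matP_inv : matP⁻¹ = matP := Matrix.inv_eq_left_inv matP_mul_matP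

lemma tau_eq {H : ℝ} (hH : H = 2 ∨ H = -2) (g : M3) : tau H g =
    !![(starRingEnd ℂ) (g 1 1), (starRingEnd ℂ) (g 1 0), -(H : ℂ) / 2 * (starRingEnd ℂ) (g 1 2);
      (starRingEnd ℂ) (g 0 1), (starRingEnd ℂ) (g 0 0), -(H : ℂ) / 2 * (starRingEnd ℂ) (g 0 2);
      -(H : ℂ) / 2 * (starRingEnd ℂ) (g 2 1), -(H : ℂ) / 2 * (starRingEnd ℂ) (g 2 0),
        (starRingEnd ℂ) (g 2 2)] := by
  have hH2 : (H : ℂ) ^ 2 = 4 := by rcases hH with rfl | rfl <;> norm_num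
  rw [tau, matT_inv hH]
  ext i j
  fin_cases i <;> fin_cases j <;> simp only [matT, Matrix.mul_apply, Fin.sum_univ_three, Matrix.of_apply,
      Matrix.cons_val', Matrix.cons_val_zero, Matrix.cons_val_one, Matrix.cons_val, Matrix.map_apply,
      Matrix.transpose_apply, Fin.zero_eta, Fin.mk_one, Fin.reduceFinMk, Fin.isValue]
  all_goals try ring1
  linear_combination ((starRingEnd ℂ) (g 2 2) / 4) * hH2

lemma matP_conj_transpose (g : M3) : matP * gᵀ * matP =
    !![g 1 1, eps ^ 2 * g 0 1, -eps * g 2 1;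
      -eps * g 1 0, g 0 0, eps ^ 2 * g 2 0;
      eps ^ 2 * g 1 2, -eps * g 0 2, g 2 2] := by
  have h := eps_pow_three
  have h4 : eps ^ 4 = -eps := by linear_combination eps * h
  ext i j
  fin_cases i <;> fin_cases j <;> simp only [matP, h4, Matrix.mul_apply, Fin.sum_univ_three, Matrix.of_apply,
      Matrix.cons_val', Matrix.cons_val_zero, Matrix.cons_val_one, Matrix.cons_val, Matrix.map_apply,
      Matrix.transpose_apply, Fin.zero_eta, Fin.mk_one, Fin.reduceFinMk, Fin.isValue]
  · linear_combination (-g 1 1) * h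
  · ring
  · ring
  · linear_combination (eps * g 1 0) * h
  · linear_combination (-g 0 0) * h
  · ring
  · ring
  · ring
  · ring

lemma tau_mul {H : ℝ} (hH : H = 2 ∨ H = -2) (A B : M3) : tau H (A * B) = tau H A * tau H B := by
  have h := matT_mul_matT hH
  simp only [tau, matT_inv hH, Matrix.map_mul]
  calc _ = matT H * A.map (starRingEnd ℂ) * 1 * B.map (starRingEnd ℂ) * matT H := by
        simp only [mul_one, mul_assoc]
    _ = _ := by rw [← h]; simp only [mul_assoc]

lemma tau_one {H : ℝ} (hH : H = 2 ∨ H = -2) : tau H 1 = 1 := by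
  simp [tau, matT_inv hH, matT_mul_matT hH]

lemma tau_tau {H : ℝ} (hH : H = 2 ∨ H = -2) (A : M3) : tau H (tau H A) = A := by
  have hH2 : (H : ℂ) ^ 2 = 4 := by rcases hH with rfl | rfl <;> norm_num
  have hc2 : (starRingEnd ℂ) (2 : ℂ) = 2 := map_ofNat _ 2
  rw [tau_eq hH, tau_eq hH]
  ext i j
  fin_cases i <;> fin_cases j <;> simp [hc2]
  · linear_combination (A 0 2 / 4) * hH2
  · linear_combination (A 1 2 / 4) * hH2
  · linear_combination (A 2 0 / 4) * hH2
  · linear_combination (A 2 1 / 4) * hH2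

lemma det_tau {H : ℝ} (hH : H = 2 ∨ H = -2) (A : M3) :
    (tau H A).det = (starRingEnd ℂ) A.det := by
  have h : (matT H).det * (matT H).det = 1 := by
    rw [← Matrix.det_mul, matT_mul_matT hH, Matrix.det_one]
  have h' : (A.map (starRingEnd ℂ)).det = (starRingEnd ℂ) A.det := by
    rw [RingHom.map_det]; rfl
  rw [tau, matT_inv hH, Matrix.det_mul, Matrix.det_mul, h']
  linear_combination ((starRingEnd ℂ) A.det) * h

lemma tau_inv {H : ℝ} (hH : H = 2 ∨ H = -2) (A : M3) (hA : A.det ≠ 0) :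
    tau H A⁻¹ = (tau H A)⁻¹ := by
  refine (Matrix.inv_eq_left_inv ?_).symm
  rw [← tau_mul hH, Matrix.nonsing_inv_mul _ (isUnit_iff_ne_zero.mpr hA), tau_one hH]

lemma sigma_mul (A B : M3) : sigma (A * B) = sigma A * sigma B := by
  have h := matP_mul_matP
  simp only [sigma, matP_inv, Matrix.transpose_mul, Matrix.mul_inv_rev]
  calc _ = matP * Aᵀ⁻¹ * 1 * Bᵀ⁻¹ * matP := by simp only [mul_one, mul_assoc]
    _ = _ := by rw [← h]; simp only [mul_assoc]

lemma sigma_one : sigma 1 = 1 := by simp [sigma, matP_inv, matP_mul_matP]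

lemma HasWM.transpose {F : ℂ → M3} {P Q : M3} {z : ℂ} (h : HasWM F P Q z) :
    HasWM (fun w => (F w)ᵀ) Pᵀ Qᵀ z := fun i j => h j i

lemma HasWM.mul_const {F : ℂ → M3} {P Q : M3} {z : ℂ} (hF : HasWM F P Q z) (C : M3) :
    HasWM (fun w => F w * C) (P * C) (Q * C) z := by
  refine (hF.mul (hasWM_const C z)).congr_deriv ?_ ?_ <;> simp

lemma HasWM.tau {H : ℝ} {F : ℂ → M3} {P Q : M3} {z : ℂ} (h : HasWM F P Q z) :
    HasWM (fun w => tau H (F w)) (tau H Q) (tau H P) z := by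
  have h1 : HasWM (fun w => (F w).map (starRingEnd ℂ)) (Q.map (starRingEnd ℂ))
      (P.map (starRingEnd ℂ)) z := fun i j => (h i j).conj
  exact (h1.const_mul (matT H)).mul_const _

/-- The inverse transpose of a solution again solves a system of the form `dF = F α`, with form
`-αᵗ`; conjugation by `P` uses `P² = 1`. -/
lemma HasWM.sigma {F : ℂ → M3} {Z W : M3} {z : ℂ} (h : HasWM F (F z * Z) (F z * W) z)
    (h0 : (F z).det ≠ 0) : HasWM (fun w => sigma (F w)) (sigma (F z) * -(matP * Zᵀ * matP))
      (sigma (F z) * -(matP * Wᵀ * matP)) z := by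
  have h1 := h.transpose.inv (by rwa [Matrix.det_transpose])
  have hu : IsUnit (F z)ᵀ.det := by rw [Matrix.det_transpose]; exact isUnit_iff_ne_zero.mpr h0
  refine ((h1.const_mul matP).mul_const matP⁻¹).congr_deriv ?_ ?_ <;>
  · simp only [AffineSphere.sigma, matP_inv, Matrix.transpose_mul]
    simp only [mul_neg, neg_mul, neg_inj, mul_assoc]
    rw [← mul_assoc matP matP, matP_mul_matP, one_mul, ← mul_assoc (F z)ᵀ,
      Matrix.mul_nonsing_inv _ hu, one_mul]

/-- Reality of `α_λ`. Applied once more at the reflected parameter, with `tau_tau`, it also covers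
the `dz̄` part. -/
lemma tau_connZ {Ω : Set ℂ} (hΩ : IsOpen Ω) {H : ℝ} (hH : H = 2 ∨ H = -2) {ψ : ℂ → ℝ} {U : ℂ → ℂ}
    (hψ : ContDiffOn ℝ ∞ ψ Ω) {z : ℂ} (hz : z ∈ Ω) (l : ℂ) :
    tau H (connZ H ψ U ((starRingEnd ℂ) l)⁻¹ z) = connZbar H ψ U l z := by
  have hc := conj_sqrt_neg_half hH
  have hp := (dzbar_eq_conj_dz hΩ hψ hz).symm
  have hc2 : (starRingEnd ℂ) (2 : ℂ) = 2 := map_ofNat _ 2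
  have hH2 : (H : ℂ) ^ 2 = 4 := by rcases hH with rfl | rfl <;> norm_num
  rw [tau_eq hH]
  simp only [connZ, connZbar]
  generalize Complex.sqrt ((-H / 2 : ℝ) : ℂ) = k at *
  ext i j
  fin_cases i <;> fin_cases j <;> simp [hc, hp, hc2, -ofReal_exp]
  all_goals linear_combination (k * l⁻¹ * (Real.exp (ψ z / 2) : ℂ) / 4) * hH2

lemma sigma_connZ (H : ℝ) (ψ : ℂ → ℝ) (U : ℂ → ℂ) (l z : ℂ) :
    -(matP * (connZ H ψ U l z)ᵀ * matP) = connZ H ψ U (eps * l) z := by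
  rw [matP_conj_transpose]
  simp only [connZ]
  generalize Complex.sqrt ((-H / 2 : ℝ) : ℂ) = k
  ext i j
  fin_cases i <;> fin_cases j <;> simp [-ofReal_exp] <;> ring

lemma sigma_connZbar (H : ℝ) (ψ : ℂ → ℝ) (U : ℂ → ℂ) (l z : ℂ) :
    -(matP * (connZbar H ψ U l z)ᵀ * matP) = connZbar H ψ U (eps * l) z := by
  rw [matP_conj_transpose]
  simp only [connZbar, mul_inv, eps_inv]
  generalize Complex.sqrt ((-H / 2 : ℝ) : ℂ) = k
  ext i j
  fin_cases i <;> fin_cases j <;> simp [-ofReal_exp] <;> ring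

/-- `τ` and `σ` fix the identity and turn a solution at one parameter into a solution at the
transformed parameter, so uniqueness with initial value `I` gives both symmetries. The form is
trace-free, whence determinant one. -/
theorem inLoopSL_of_normalizedFrame {Ω : Set ℂ} (hΩ : IsOpen Ω) (hc : IsPreconnected Ω)
    (h0 : (0 : ℂ) ∈ Ω) {H : ℝ} (hH : H = 2 ∨ H = -2) {ψ : ℂ → ℝ} {U : ℂ → ℂ}
    (hψ : ContDiffOn ℝ ∞ ψ Ω) (hU : ContDiffOn ℝ ∞ U Ω) (hGC : GaussCodazzi Ω H ψ U)
    {E : ℂ → ℂ → M3} (hE : IsNormalizedFrame Ω H ψ U E) {z : ℂ} (hz : z ∈ Ω) :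
    InLoopSL H (E z) := by
  have hs := fun {l : ℂ} (hl : l ≠ 0) => hE.toIsExtendedFrame.solvesOn hΩ hl
  refine ⟨?_, fun l hl => ?_, fun l hl => ?_, fun l hl => ?_⟩
  · exact holoM_frame hΩ hc hH hψ hU hGC hE.toIsExtendedFrame h0 hz
      ((holoM_const 1 _).congr fun l hl => hE.base l hl)
  · rw [SolvesOn.det_eq hΩ hc (hs hl) hz h0, hE.base l hl, Matrix.det_one]
  · have hl' : ((starRingEnd ℂ) l)⁻¹ ≠ 0 := by simpa using hl
    have h1 : SolvesOn Ω H ψ U l fun w => tau H (E w ((starRingEnd ℂ) l)⁻¹) := fun w hw => by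
      refine (hs hl' w hw).tau.congr_deriv ?_ ?_
      · rw [tau_mul hH, ← tau_connZ hΩ hH hψ hw ((starRingEnd ℂ) l)⁻¹, tau_tau hH]
        simp
      · rw [tau_mul hH, tau_connZ hΩ hH hψ hw]
    rw [frame_unique hΩ hc h1 (hs hl) (hE.det_ne_zero l hl) h0 hz, hE.base l hl, hE.base _ hl',
      tau_one hH]
    simp
  · have hl' : eps * l ≠ 0 := mul_ne_zero eps_ne_zero hl
    have h1 : SolvesOn Ω H ψ U (eps * l) fun w => sigma (E w l) := fun w hw => by
      refine ((hs hl w hw).sigma (hE.det_ne_zero l hl w hw)).congr_deriv ?_ ?_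
      · rw [sigma_connZ]
      · rw [sigma_connZbar]
    rw [frame_unique hΩ hc h1 (hs hl') (hE.det_ne_zero _ hl') h0 hz, hE.base l hl,
      hE.base _ hl', sigma_one]
    simp

/-! ### The associated family -/

lemma gaussCodazzi_of_sphere {D : Set ℂ} (hD : IsOpen D) {r : ℂ → Fin 3 → ℝ} {ψ : ℂ → ℝ}
    {U : ℂ → ℂ} {H : ℝ} (hH : H = 2 ∨ H = -2) (h : StructureEq D r ψ U H)
    (hψ : ContDiffOn ℝ ∞ ψ D) : GaussCodazzi D H ψ U := by
  refine gaussCodazzi_of_frame hD hH hψ (contDiffOn_cubic hD hH h hψ) one_ne_zero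
    (fun z hz => hasWM_surfaceFrame hD hH h hψ hz) fun z hz => ?_
  rw [det_surfaceFrame hH h one_ne_zero hz]
  rcases hH with rfl | rfl <;> simp

theorem exists_normalizedFrame {Ω : Set ℂ} (hΩ : IsOpen Ω) (h0 : (0 : ℂ) ∈ Ω)
    (hs : StarConvex ℝ 0 Ω) {H : ℝ} (hH : H = 2 ∨ H = -2) {ψ : ℂ → ℝ} {U : ℂ → ℂ}
    (hψ : ContDiffOn ℝ ∞ ψ Ω) (hU : ContDiffOn ℝ ∞ U Ω) (hGC : GaussCodazzi Ω H ψ U) :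
    ∃ E, IsNormalizedFrame Ω H ψ U E := by
  obtain ⟨E, h1, h2, -⟩ := exists_frame hΩ hH hψ hU hGC hs
  have hc : IsPreconnected Ω := (hs.isPathConnected h0).isConnected.isPreconnected
  refine ⟨E, ⟨isExtendedFrame_of_solvesOn hΩ hψ hU h2 fun l hl z hz => ?_, fun l _ => h1 l⟩⟩
  rw [SolvesOn.det_eq (F := fun w => E w l) hΩ hc (h2 l hl) hz h0, h1, Matrix.det_one]
  exact one_ne_zero

lemma SolvesOn.const_mul {Ω : Set ℂ} {H : ℝ} {ψ : ℂ → ℝ} {U : ℂ → ℂ} {l : ℂ} {F : ℂ → M3}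
    (hF : SolvesOn Ω H ψ U l F) (C : M3) : SolvesOn Ω H ψ U l fun w => C * F w := fun z hz =>
  ((hF z hz).const_mul C).congr_deriv (mul_assoc ..).symm (mul_assoc ..).symm

/-- On the unit circle a `τ`-real matrix satisfies `T ḡ = g T`. -/
lemma map_conj_of_tau_eq {H : ℝ} (hH : H = 2 ∨ H = -2) {A : M3} (h : tau H A = A) :
    A.map (starRingEnd ℂ) = matT H * A * matT H := by
  have ht := matT_mul_matT hH
  conv_rhs => rw [← h]
  rw [tau, matT_inv hH]
  simp only [mul_assoc]
  rw [ht, mul_one, ← mul_assoc, ht, one_mul]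

lemma conj_inv_of_norm_one {l : ℂ} (hl : ‖l‖ = 1) : ((starRingEnd ℂ) l)⁻¹ = l := by
  have h : l * (starRingEnd ℂ) l = 1 := by rw [mul_conj, normSq_eq_norm_sq, hl]; simp
  exact (eq_inv_of_mul_eq_one_left h).symm

/-- If `C̄ = t C T` with `t = ± 1` the sign of `-H`, then `C A` has a real last column whenever
`A` is `τ`-real. -/
lemma last_column_real {H : ℝ} (hH : H = 2 ∨ H = -2) {C A : M3}
    (hC : C.map (starRingEnd ℂ) = (-(H : ℂ) / 2) • (C * matT H)) (hA : tau H A = A) (k : Fin 3) :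
    (starRingEnd ℂ) ((C * A) k 2) = (C * A) k 2 := by
  have hH2 : (H : ℂ) ^ 2 = 4 := by rcases hH with rfl | rfl <;> norm_num
  have h1 : (C * A).map (starRingEnd ℂ) = (-(H : ℂ) / 2) • (C * A * matT H) := by
    rw [Matrix.map_mul, hC, map_conj_of_tau_eq hH hA, Matrix.smul_mul]
    congr 1
    calc C * matT H * (matT H * A * matT H) = C * (matT H * matT H) * A * matT H := by
          simp only [mul_assoc]
      _ = _ := by rw [matT_mul_matT hH, mul_one]
  have h2 := congrFun (congrFun h1 k) 2
  rw [Matrix.map_apply] at h2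
  rw [h2, Matrix.smul_apply, Matrix.mul_apply (M := C * A), Fin.sum_univ_three]
  simp [matT]
  linear_combination ((C * A) k 2 / 4) * hH2

/-- The associated family of an affine sphere. -/
theorem exists_associated_family {D Ω : Set ℂ} (hD : IsOpen D) (hsub : Ω ⊆ D) (hΩ : IsOpen Ω)
    (hc : IsPreconnected Ω) (h0 : (0 : ℂ) ∈ Ω) {H : ℝ} (hH : H = 2 ∨ H = -2)
    {r : ℂ → Fin 3 → ℝ} {ψ : ℂ → ℝ} {U : ℂ → ℂ} (h : StructureEq D r ψ U H)
    (hψ : ContDiffOn ℝ ∞ ψ D) {E : ℂ → ℂ → M3} (hE : IsNormalizedFrame Ω H ψ U E) 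
    (hL : ∀ z ∈ Ω, InLoopSL H (E z)) :
    ∃ rfam : ℂ → ℂ → Fin 3 → ℝ, (∀ z ∈ Ω, rfam 1 z = r z) ∧
      ∃ C : M3, C.det = -I * H ∧ C.map (starRingEnd ℂ) = (-(H : ℂ) / 2) • (C * matT H) ∧
      ∀ l : ℂ, ‖l‖ = 1 → IsDefiniteAffineSphere Ω (rfam l) ψ (fun z => l ^ 3 * U z) H ∧
        ∀ z ∈ Ω, surfaceFrame H ψ (rfam l) l z = C * E z l := by
  have hU := contDiffOn_cubic hD hH h hψ
  have hH0 : (H : ℂ) ≠ 0 := by rcases hH with rfl | rfl <;> norm_num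
  set C := surfaceFrame H ψ r 1 0 with hCdef
  have hCdet : C.det = -I * H := det_surfaceFrame hH h one_ne_zero (hsub h0)
  have hCc : C.map (starRingEnd ℂ) = (-(H : ℂ) / 2) • (C * matT H) :=
    conj_surfaceFrame hD hH h.smooth (hsub h0)
  -- `r_λ` is read off the last column of `C E`, with `C` the frame of `r` at `0`. Taking real parts
  -- loses nothing for `|λ| = 1`, by `last_column_real`.
  refine ⟨fun l z k => (-(H : ℂ)⁻¹ * (C * E z l) k 2).re, fun z hz => ?_, C, hCdet, hCc,
    fun l hl => ?_⟩
  · have h1 : surfaceFrame H ψ r 1 z = C * E z 1 := by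
      have := frame_unique (F := surfaceFrame H ψ r 1) hΩ hc
        (fun z hz => hasWM_surfaceFrame hD hH h hψ (hsub hz))
        (hE.toIsExtendedFrame.solvesOn hΩ one_ne_zero) (hE.det_ne_zero 1 one_ne_zero) h0 hz
      rw [this, hE.base 1 one_ne_zero, inv_one, mul_one]
    ext k
    change (-(H : ℂ)⁻¹ * (C * E z 1) k 2).re = r z k
    rw [← h1]
    simp only [surfaceFrame, Matrix.of_apply, Matrix.cons_val]
    rw [show -(H : ℂ)⁻¹ * (-(H : ℂ) * (r z k : ℂ)) = (r z k : ℂ) by field_simp, ofReal_re]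
  · have hl0 : l ≠ 0 := by rintro rfl; simp at hl
    have hs : SolvesOn Ω H ψ U l fun w => C * E w l :=
      (hE.toIsExtendedFrame.solvesOn hΩ hl0).const_mul C
    refine sphere_of_frame hΩ hH (hψ.mono hsub) (hU.mono hsub) hl0 hs (fun z hz => ?_)
      fun z hz k => ?_
    · rw [Matrix.det_mul, (hL z hz).det_eq_one l hl0, mul_one, hCdet]
    · have ht : tau H (E z l) = E z l := by
        conv_rhs => rw [← (hL z hz).tau_eq l hl0, conj_inv_of_norm_one hl]
      have hre := last_column_real hH hCc ht k
      obtain ⟨x, hx⟩ := conj_eq_iff_real.mp hre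
      change (C * E z l) k 2 = -(H : ℂ) * ((-(H : ℂ)⁻¹ * (C * E z l) k 2).re : ℂ)
      rw [hx, show -(H : ℂ)⁻¹ * (x : ℂ) = ((-H⁻¹ * x : ℝ) : ℂ) by push_cast; rfl, ofReal_re]
      push_cast
      field_simp

/-! ### Algebra of the simple elements -/

/-- The numerator `(l³ - α³) g_{α,ℓ}(l)`. -/
def simpleNum (α b c l : ℂ) : M3 :=
  !![l ^ 3 - α ^ 3 + 2 * (α ^ 3 * b * c / (2 * b * c - 1)),
      2 * (α * l ^ 2 * c ^ 2 / (2 * b * c - 1)), 2 * (α ^ 2 * l * c / (2 * b * c - 1));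
    2 * (α ^ 2 * l * b ^ 2), l ^ 3 - α ^ 3 + 2 * (α ^ 3 * b * c), 2 * (α * l ^ 2 * b);
    2 * (α * l ^ 2 * b), 2 * (α ^ 2 * l * c), l ^ 3 - α ^ 3 + 2 * α ^ 3]

/-- The numerator `(l³ + α³) g_{α,ℓ}(l)⁻¹`. -/
def simpleInvNum (α b c l : ℂ) : M3 :=
  !![l ^ 3 + α ^ 3 - 2 * (α ^ 3 * b * c), -(2 * (α * l ^ 2 * c ^ 2 / (2 * b * c - 1))),
      2 * (α ^ 2 * l * c);
    2 * (α ^ 2 * l * b ^ 2), l ^ 3 + α ^ 3 - 2 * (α ^ 3 * b * c / (2 * b * c - 1)),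
      -(2 * (α * l ^ 2 * b));
    -(2 * (α * l ^ 2 * b)), 2 * (α ^ 2 * l * c / (2 * b * c - 1)), l ^ 3 + α ^ 3 - 2 * α ^ 3]

lemma simpleElt_eq {α b c l : ℂ} (hl : l ^ 3 ≠ α ^ 3) :
    simpleElt α b c l = (l ^ 3 - α ^ 3)⁻¹ • simpleNum α b c l := by
  have h : l ^ 3 - α ^ 3 ≠ 0 := sub_ne_zero.mpr hl
  ext i j
  fin_cases i <;> fin_cases j <;>
    simp [simpleElt, simpleNum] <;> field_simp

lemma simpleInvNum_mul_simpleNum {α b c l : ℂ} (hn : 2 * b * c - 1 ≠ 0) :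
    simpleInvNum α b c l * simpleNum α b c l = (l ^ 6 - α ^ 6) • 1 := by
  ext i j
  rw [Matrix.mul_apply, Fin.sum_univ_three]
  fin_cases i <;> fin_cases j <;>
    simp [simpleNum, simpleInvNum] <;> field_simp <;> ring

lemma det_simpleNum {α b c l : ℂ} (hn : 2 * b * c - 1 ≠ 0) :
    (simpleNum α b c l).det = (l ^ 3 - α ^ 3) ^ 2 * (l ^ 3 + α ^ 3) := by
  rw [Matrix.det_fin_three]
  simp [simpleNum]
  field_simp
  ring

lemma det_simpleElt {α b c l : ℂ} (hn : 2 * b * c - 1 ≠ 0) (hl : l ^ 3 ≠ α ^ 3) :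
    (simpleElt α b c l).det = (l ^ 3 + α ^ 3) / (l ^ 3 - α ^ 3) := by
  have h : l ^ 3 - α ^ 3 ≠ 0 := sub_ne_zero.mpr hl
  rw [simpleElt_eq hl, Matrix.det_smul, det_simpleNum hn, Fintype.card_fin]
  field_simp

lemma simpleElt_inv {α b c l : ℂ} (hn : 2 * b * c - 1 ≠ 0) (hl : l ^ 6 ≠ α ^ 6) :
    (simpleElt α b c l)⁻¹ = (l ^ 3 + α ^ 3)⁻¹ • simpleInvNum α b c l := by
  have hl3 : (l ^ 3 - α ^ 3) * (l ^ 3 + α ^ 3) ≠ 0 := fun h => hl (by linear_combination h)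
  have h1 := left_ne_zero_of_mul hl3
  have h2 := right_ne_zero_of_mul hl3
  refine Matrix.inv_eq_left_inv ?_
  rw [simpleElt_eq (sub_ne_zero.mp h1), Matrix.smul_mul, Matrix.mul_smul,
    simpleInvNum_mul_simpleNum hn, smul_smul, smul_smul]
  rw [show (l ^ 3 + α ^ 3)⁻¹ * (l ^ 3 - α ^ 3)⁻¹ * (l ^ 6 - α ^ 6) = 1 by field_simp; ring,
    one_smul]

/-- With `simpleInvNum_eps` this is the `σ`-symmetry of `g_{α,ℓ}` cleared of denominators, hence
valid at the poles as well. -/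
lemma simpleNum_eps (α b c l : ℂ) :
    simpleNum α b c (eps * l) = -(matP * (simpleInvNum α b c l)ᵀ * matP) := by
  have h3 := eps_pow_three
  rw [matP_conj_transpose]
  ext i j
  fin_cases i <;> fin_cases j <;> simp [simpleNum, simpleInvNum, mul_pow, h3] <;> ring

lemma simpleInvNum_eps (α b c l : ℂ) :
    simpleInvNum α b c (eps * l) = -(matP * (simpleNum α b c l)ᵀ * matP) := by
  have h3 := eps_pow_three
  rw [matP_conj_transpose]
  ext i j
  fin_cases i <;> fin_cases j <;> simp [simpleNum, simpleInvNum, mul_pow, h3] <;> ring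

lemma eps_mul_pow_three (l : ℂ) : (eps * l) ^ 3 = -l ^ 3 := by rw [mul_pow, eps_pow_three]; ring

lemma eps_mul_pow_six (l : ℂ) : (eps * l) ^ 6 = l ^ 6 := by
  linear_combination ((eps * l) ^ 3 - l ^ 3) * eps_mul_pow_three l

lemma pow_three_ne_of_pow_six_ne {l α : ℂ} (h : l ^ 6 ≠ α ^ 6) :
    l ^ 3 ≠ α ^ 3 ∧ l ^ 3 + α ^ 3 ≠ 0 :=
  ⟨fun h' => h (by linear_combination (l ^ 3 + α ^ 3) * h'),
    fun h' => h (by linear_combination (l ^ 3 - α ^ 3) * h')⟩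

lemma sigma_simpleElt {α b c l : ℂ} (hn : 2 * b * c - 1 ≠ 0) (hl : l ^ 6 ≠ α ^ 6) :
    sigma (simpleElt α b c l) = simpleElt α b c (eps * l) := by
  obtain ⟨h1, h2⟩ := pow_three_ne_of_pow_six_ne hl
  have h2' : (eps * l) ^ 3 ≠ α ^ 3 := by
    rw [eps_mul_pow_three]; exact fun h => h2 (by linear_combination -h)
  rw [sigma, ← Matrix.transpose_nonsing_inv, simpleElt_inv hn hl, simpleElt_eq h2', simpleNum_eps,
    matP_inv, Matrix.transpose_smul, Matrix.mul_smul, Matrix.smul_mul, smul_neg, ← neg_smul,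
    eps_mul_pow_three, ← inv_neg]
  congr 2
  ring

lemma det_simpleElt_ne_zero {α b c l : ℂ} (hn : 2 * b * c - 1 ≠ 0) (hl : l ^ 6 ≠ α ^ 6) :
    (simpleElt α b c l).det ≠ 0 := by
  obtain ⟨h1, h2⟩ := pow_three_ne_of_pow_six_ne hl
  rw [det_simpleElt hn h1]
  exact div_ne_zero h2 (sub_ne_zero.mpr h1)

lemma holoM_simpleNum (α b c : ℂ) (S : Set ℂ) : HoloM (simpleNum α b c) S := by
  intro i j
  fin_cases i <;> fin_cases j <;> simp [simpleNum] <;> fun_prop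

lemma holoM_simpleInvNum (α b c : ℂ) (S : Set ℂ) : HoloM (simpleInvNum α b c) S := by
  intro i j
  fin_cases i <;> fin_cases j <;> simp [simpleInvNum] <;> fun_prop

/-- The residue at `l = α` has rank one and row space `ℓ`; together with `vecMul_simpleInvNum_self`
this is what dressing rests on. -/
lemma simpleNum_self (α b c : ℂ) (hn : 2 * b * c - 1 ≠ 0) :
    simpleNum α b c α = Matrix.vecMulVec
      ![2 * α ^ 3 * c / (2 * b * c - 1), 2 * α ^ 3 * b, 2 * α ^ 3] ![b, c, 1] := by
  ext i j
  fin_cases i <;> fin_cases j <;>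
    simp [simpleNum, Matrix.vecMulVec_apply] <;> field_simp

/-- By `simpleInvNum_mul_simpleNum` the two numerators annihilate each other at `l = α`; the row
space of one is the left kernel direction used here. -/
lemma vecMul_simpleInvNum_self (α b c : ℂ) (hn : 2 * b * c - 1 ≠ 0) :
    ![b, c, 1] ᵥ* simpleInvNum α b c α = 0 := by
  ext j
  fin_cases j <;> simp [simpleInvNum, Matrix.vecMul, dotProduct, Fin.sum_univ_three]
  · ring
  · simp only [div_eq_mul_inv]
    linear_combination (-2 * α ^ 3 * c) * mul_inv_cancel₀ hn
  · ring

lemma not_mem_cone_iff {v : Fin 3 → ℂ} :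
    v ∉ cone ↔ v 2 ≠ 0 ∧ 2 * lineB v * lineC v - 1 ≠ 0 := by
  simp only [cone, Set.mem_setOf_eq, not_or, lineB, lineC]
  rw [and_comm]
  refine and_congr_right fun h => not_congr ?_
  rw [sub_eq_zero]
  field_simp

lemma eq_smul_line {v : Fin 3 → ℂ} (hv : v 2 ≠ 0) : v = v 2 • ![lineB v, lineC v, 1] := by
  ext i
  fin_cases i <;> simp [lineB, lineC] <;> field_simp

/-! ### Dressing by one simple element -/

/-- Division of a holomorphic function on `ℂˣ` by `l⁶ - α⁶`. -/
lemma exists_div_pow_six {α : ℂ} {F : ℂ → ℂ}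
    (hF : DifferentiableOn ℂ F {l | l ≠ 0}) (h0 : ∀ l : ℂ, l ^ 6 = α ^ 6 → F l = 0) :
    ∃ G : ℂ → ℂ, DifferentiableOn ℂ G {l | l ≠ 0} ∧
      ∀ l : ℂ, l ≠ 0 → (l ^ 6 - α ^ 6) * G l = F l := by
  have hopen : IsOpen {l : ℂ | l ≠ 0} := isOpen_ne
  set q : ℂ → ℂ := fun l => l ^ 6 - α ^ 6 with hq
  have hqd : Differentiable ℂ q := by fun_prop
  -- The zeros of `q = l⁶ - α⁶` in `ℂˣ` are simple. There the quotient takes the value `F'/q'`, and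
  -- near such a point it is the quotient of the two difference quotients.
  refine ⟨fun l => if q l = 0 then deriv F l / deriv q l else F l / q l, fun l hl => ?_,
    fun l hl => ?_⟩
  · refine DifferentiableAt.differentiableWithinAt ?_
    by_cases hql : q l = 0
    · have hdq : deriv q l ≠ 0 := by
        have : deriv q l = 6 * l ^ 5 := by simp [hq]
        rw [this]
        exact mul_ne_zero (by norm_num) (pow_ne_zero _ hl)
      have hD1 : DifferentiableAt ℂ (dslope F l) l :=
        ((differentiableOn_dslope (hopen.mem_nhds hl)).mpr hF).differentiableAt
          (hopen.mem_nhds hl)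
      have hD2 : DifferentiableAt ℂ (dslope q l) l :=
        ((differentiableOn_dslope Filter.univ_mem).mpr hqd.differentiableOn).differentiableAt
          Filter.univ_mem
      have hne : dslope q l l ≠ 0 := by rwa [dslope_same]
      refine (hD1.div hD2 hne).congr_of_eventuallyEq ?_
      filter_upwards [hD2.continuousAt.eventually_ne hne] with w hw
      simp only [Pi.div_apply]
      rcases eq_or_ne w l with rfl | hwl
      · simp [hql]
      · have e1 : (w - l) * dslope q l w = q w := by
          have := sub_smul_dslope q l w
          rwa [hql, sub_zero, smul_eq_mul] at this
        have e2 : (w - l) * dslope F l w = F w := by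
          have := sub_smul_dslope F l w
          rwa [h0 l (sub_eq_zero.mp hql), sub_zero, smul_eq_mul] at this
        have hwl' : w - l ≠ 0 := sub_ne_zero.mpr hwl
        rw [if_neg (by rw [← e1]; exact mul_ne_zero hwl' hw), ← e1, ← e2]
        field_simp
    · refine ((hF.differentiableAt (hopen.mem_nhds hl)).div hqd.differentiableAt
        hql).congr_of_eventuallyEq ?_
      filter_upwards [hqd.continuous.continuousAt.eventually_ne hql] with w hw
      simp [hw]
  · change q l * (if q l = 0 then _ else _) = _
    by_cases hql : q l = 0
    · rw [hql, zero_mul, h0 l (sub_eq_zero.mp hql)]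
    · rw [if_neg hql]; field_simp

lemma finite_pow_six_eq (a : ℂ) : {l : ℂ | l ^ 6 = a}.Finite := by
  have h : {l : ℂ | l ^ 6 = a} ⊆ ((Polynomial.nthRoots 6 a).toFinset : Set ℂ) := fun l hl => by
    simpa [Polynomial.mem_nthRoots] using hl
  exact (Finset.finite_toSet _).subset h

/-- Holomorphic maps on `ℂˣ` that agree off a finite set are equal. -/
lemma HoloM.eq_of_eq_off_finite {F G : ℂ → M3} (hF : HoloM F {l | l ≠ 0})
    (hG : HoloM G {l | l ≠ 0}) {T : Set ℂ} (hT : T.Finite)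
    (h : ∀ l : ℂ, l ≠ 0 → l ∉ T → F l = G l) {l : ℂ} (hl : l ≠ 0) : F l = G l := by
  have hopen : IsOpen {l : ℂ | l ≠ 0} := isOpen_ne
  ext i j
  have c1 : ContinuousAt (fun l => F l i j) l :=
    ((hF i j).differentiableAt (hopen.mem_nhds hl)).continuousAt
  have c2 : ContinuousAt (fun l => G l i j) l :=
    ((hG i j).differentiableAt (hopen.mem_nhds hl)).continuousAt
  refine tendsto_nhds_unique (l := 𝓝[≠] l) (c1.mono_left nhdsWithin_le_nhds)
    ((c2.mono_left nhdsWithin_le_nhds).congr' ?_)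
  have h1 : ∀ᶠ w in 𝓝[≠] l, w ∉ T \ {l} :=
    nhdsWithin_le_nhds (((hT.subset Set.diff_subset).isClosed.isOpen_compl).mem_nhds (by simp))
  filter_upwards [h1, nhdsWithin_le_nhds (hopen.mem_nhds hl), self_mem_nhdsWithin] with w a b c
  rw [h w b fun hw => a ⟨hw, c⟩]

/-- Holomorphic maps `ℂˣ → SL(3, ℂ)` with `σ(g(l)) = g(ε l)`. -/
structure IsSigmaLoop (E : ℂ → M3) : Prop where
  holo : HoloM E {l | l ≠ 0}
  det_eq_one : ∀ l : ℂ, l ≠ 0 → (E l).det = 1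
  sigma_eq : ∀ l : ℂ, l ≠ 0 → sigma (E l) = E (eps * l)

lemma InLoopSL.isSigmaLoop {H : ℝ} {E : ℂ → M3} (h : InLoopSL H E) : IsSigmaLoop E :=
  ⟨h.holo, h.det_eq_one, h.sigma_eq⟩

lemma HoloM.comp_eps {F : ℂ → M3} (hF : HoloM F {l | l ≠ 0}) :
    HoloM (fun l => F (eps * l)) {l | l ≠ 0} := fun i j =>
  (hF i j).comp (t := {l | l ≠ 0}) (f := fun l => eps * l) (by fun_prop)
    fun _ hl => mul_ne_zero eps_ne_zero hl

lemma HoloM.sigma {F : ℂ → M3} {S : Set ℂ} (hF : HoloM F S) (h : ∀ l ∈ S, (F l).det ≠ 0) :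
    HoloM (fun l => sigma (F l)) S :=
  ((holoM_const matP S).mul (hF.transpose.inv fun l hl => by
    rw [Matrix.det_transpose]; exact h l hl)).mul (holoM_const _ S)

lemma exists_eps_pow {α l : ℂ} :
    l ^ 6 = α ^ 6 → ∃ k : ℕ, l = eps ^ k * α := by
  intro h
  have h2 := eps_sq
  have h3 := eps_pow_three
  have key : (l - α) * (l - eps * α) * (l - eps ^ 2 * α) * (l - eps ^ 3 * α) * (l - eps ^ 4 * α)
      * (l - eps ^ 5 * α) = 0 := by
    have e4 : eps ^ 4 = -eps := by linear_combination eps * h3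
    have e5 : eps ^ 5 = 1 - eps := by linear_combination eps ^ 2 * h3 - h2
    rw [e4, e5, h3, h2]
    have : (l - α) * (l - eps * α) * (l - (eps - 1) * α) * (l - -1 * α) * (l - -eps * α) *
        (l - (1 - eps) * α) = (l ^ 2 - α ^ 2) * (l ^ 2 - eps ^ 2 * α ^ 2) *
          (l ^ 2 - (eps ^ 2 - 2 * eps + 1) * α ^ 2) := by ring
    rw [this, h2]
    linear_combination h + (-l ^ 2 * α ^ 4 + α ^ 6) * h2
  simp only [mul_eq_zero, sub_eq_zero] at key
  rcases key with ((((h | h) | h) | h) | h) | h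
  exacts [⟨0, by simp [h]⟩, ⟨1, by simp [h]⟩, ⟨2, h⟩, ⟨3, h⟩, ⟨4, h⟩, ⟨5, h⟩]

/-- Dressing by one simple element: `g_{α,ℓ} E = E' g_{α,ℓ'}` with `ℓ' = ℓ E(α)`. -/
theorem exists_dressing {E : ℂ → M3} (hE : IsSigmaLoop E) {α b c : ℂ} (hα : α ≠ 0)
    (hn : 2 * b * c - 1 ≠ 0) (hv : ![b, c, 1] ᵥ* E α ∉ cone) :
    ∃ E' : ℂ → M3, IsSigmaLoop E' ∧ ∀ l : ℂ, l ≠ 0 → l ^ 3 ≠ α ^ 3 →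
      simpleElt α b c l * E l =
        E' l * simpleElt α (lineB (![b, c, 1] ᵥ* E α)) (lineC (![b, c, 1] ᵥ* E α)) l := by
  set v := ![b, c, 1] ᵥ* E α with hvdef
  obtain ⟨hv2, hn'⟩ := not_mem_cone_iff.mp hv
  have hvs := eq_smul_line hv2
  set b' := lineB v
  set c' := lineC v
  have hinv : ∀ l : ℂ, l ≠ 0 → IsUnit (E l).det := fun l hl => by simp [hE.det_eq_one l hl]
  have hne : ∀ l ∈ {l : ℂ | l ≠ 0}, (E l).det ≠ 0 := fun l hl => (hinv l hl).ne_zero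
  -- `N` is the numerator over `l⁶ - α⁶` of the dressed loop, and `N'` that of its inverse. Both are
  -- needed, since `l ↦ ε l` exchanges them.
  set N : ℂ → M3 := fun l => simpleNum α b c l * E l * simpleInvNum α b' c' l with hN
  set N' : ℂ → M3 := fun l => simpleNum α b' c' l * (E l)⁻¹ * simpleInvNum α b c l with hN'
  have hNh : HoloM N {l | l ≠ 0} :=
    ((holoM_simpleNum α b c _).mul hE.holo).mul (holoM_simpleInvNum α b' c' _)
  have hEs : ∀ l : ℂ, l ≠ 0 → E (eps * l) = matP * ((E l)⁻¹)ᵀ * matP := fun l hl => by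
    rw [← hE.sigma_eq l hl, sigma, matP_inv, Matrix.transpose_nonsing_inv]
  have hPinv : matP * matP = 1 := matP_mul_matP
  have hEs' : ∀ l : ℂ, l ≠ 0 → (E (eps * l))⁻¹ = matP * (E l)ᵀ * matP := fun l hl => by
    refine Matrix.inv_eq_left_inv ?_
    rw [hEs l hl]
    calc _ = matP * (E l)ᵀ * (matP * matP) * ((E l)⁻¹)ᵀ * matP := by simp only [mul_assoc]
      _ = matP * ((E l)⁻¹ * E l)ᵀ * matP := by
        rw [hPinv, mul_one, Matrix.transpose_mul]; simp only [mul_assoc]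
      _ = 1 := by rw [Matrix.nonsing_inv_mul _ (hinv l hl), Matrix.transpose_one, mul_one, hPinv]
  have hconj : ∀ A B C : M3, -(matP * Aᵀ * matP) * (matP * Bᵀ * matP) * -(matP * Cᵀ * matP) =
      matP * (C * B * A)ᵀ * matP := by
    intro A B C
    calc _ = matP * Aᵀ * (matP * matP) * Bᵀ * (matP * matP) * Cᵀ * matP := by
          simp only [neg_mul, mul_neg, neg_neg, mul_assoc]
      _ = _ := by rw [hPinv, mul_one, mul_one]; simp only [Matrix.transpose_mul, mul_assoc]
  have hNs : ∀ l : ℂ, l ≠ 0 → N (eps * l) = matP * (N' l)ᵀ * matP := fun l hl => by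
    simp only [hN, hN', simpleNum_eps, simpleInvNum_eps, hEs l hl, hconj]
  have hNs' : ∀ l : ℂ, l ≠ 0 → N' (eps * l) = matP * (N l)ᵀ * matP := fun l hl => by
    simp only [hN, hN', simpleNum_eps, simpleInvNum_eps, hEs' l hl, hconj]
  -- At `α` the left factor of `N` has row space `ℓ`, which `E(α)` maps to `ℓ'`, which the right
  -- factor kills. For `N'` the roles of `ℓ` and `ℓ'` are exchanged.
  have hbase : N α = 0 ∧ N' α = 0 := by
    constructor
    · simp only [hN]
      rw [simpleNum_self _ _ _ hn, Matrix.vecMulVec_mul, Matrix.vecMulVec_mul, ← hvdef, hvs,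
        Matrix.smul_vecMul, vecMul_simpleInvNum_self _ _ _ hn', smul_zero, Matrix.vecMulVec_zero]
    · have e : ![b', c', 1] ᵥ* (E α)⁻¹ = (v 2)⁻¹ • ![b, c, 1] := by
        have : ![b', c', 1] = (v 2)⁻¹ • v := by
          conv_rhs => rw [hvs, smul_smul]
          simp [hv2]
        rw [this, Matrix.smul_vecMul, hvdef, Matrix.vecMul_vecMul,
          Matrix.mul_nonsing_inv _ (hinv α hα), Matrix.vecMul_one]
      simp only [hN']
      rw [simpleNum_self _ _ _ hn', Matrix.vecMulVec_mul, Matrix.vecMulVec_mul, e,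
        Matrix.smul_vecMul, vecMul_simpleInvNum_self _ _ _ hn, smul_zero, Matrix.vecMulVec_zero]
  -- The exchange under multiplication by `ε` carries the zero at `α` around all six points with `l⁶
  -- = α⁶`.
  have hzero : ∀ k : ℕ, N (eps ^ k * α) = 0 ∧ N' (eps ^ k * α) = 0 := by
    intro k
    induction k with
    | zero => simpa using hbase
    | succ k ih =>
      have hk : eps ^ k * α ≠ 0 := mul_ne_zero (pow_ne_zero _ eps_ne_zero) hα
      rw [pow_succ', mul_assoc, hNs _ hk, hNs' _ hk, ih.1, ih.2]
      simp
  have hdiv : ∀ i j, ∃ G : ℂ → ℂ, DifferentiableOn ℂ G {l | l ≠ 0} ∧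
      ∀ l : ℂ, l ≠ 0 → (l ^ 6 - α ^ 6) * G l = N l i j := fun i j =>
    exists_div_pow_six (hNh i j) fun l hl => by
      obtain ⟨k, rfl⟩ := exists_eps_pow hl
      rw [(hzero k).1]; rfl
  choose G hG1 hG2 using hdiv
  set E' : ℂ → M3 := fun l => Matrix.of fun i j => G i j l with hE'
  have hE'h : HoloM E' {l | l ≠ 0} := hG1
  have hE'N : ∀ l : ℂ, l ≠ 0 → (l ^ 6 - α ^ 6) • E' l = N l := fun l hl => by
    ext i j; exact hG2 i j l hl
  have hfin := finite_pow_six_eq (α ^ 6)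
  have hmain : ∀ l : ℂ, l ≠ 0 → simpleNum α b c l * E l = E' l * simpleNum α b' c' l := by
    intro l hl
    refine HoloM.eq_of_eq_off_finite (F := fun l => simpleNum α b c l * E l)
      (G := fun l => E' l * simpleNum α b' c' l) ((holoM_simpleNum _ _ _ _).mul hE.holo)
      (hE'h.mul (holoM_simpleNum _ _ _ _)) hfin (fun l hl hl6 => ?_) hl
    have hl6' : l ^ 6 - α ^ 6 ≠ 0 := sub_ne_zero.mpr hl6
    have h1 : (l ^ 6 - α ^ 6) • (simpleNum α b c l * E l) =
        (l ^ 6 - α ^ 6) • (E' l * simpleNum α b' c' l) := by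
      rw [← Matrix.smul_mul _ (E' l), hE'N l hl]
      simp only [hN]
      rw [mul_assoc (simpleNum α b c l * E l), simpleInvNum_mul_simpleNum hn', Matrix.mul_smul,
        mul_one]
    exact smul_right_injective _ hl6' h1
  have hfac : ∀ l : ℂ, l ≠ 0 → l ^ 3 ≠ α ^ 3 →
      simpleElt α b c l * E l = E' l * simpleElt α b' c' l := fun l hl hl3 => by
    rw [simpleElt_eq hl3, simpleElt_eq hl3, Matrix.smul_mul, Matrix.mul_smul, hmain l hl]
  -- The determinant of a simple element does not depend on its line, so the two simple factors
  -- cancel.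
  have hdetoff : ∀ l : ℂ, l ≠ 0 → l ^ 6 ≠ α ^ 6 → (E' l).det = 1 := by
    intro l hl hl6
    have h3 := (pow_three_ne_of_pow_six_ne hl6).1
    have h := congrArg Matrix.det (hfac l hl h3)
    rw [Matrix.det_mul, Matrix.det_mul, hE.det_eq_one l hl, det_simpleElt hn h3,
      det_simpleElt hn' h3, mul_one] at h
    have hd := det_simpleElt_ne_zero (b := b) (c := c) hn hl6
    rw [det_simpleElt hn h3] at hd
    exact mul_right_cancel₀ hd (h.symm.trans (one_mul _).symm)
  have hdet : ∀ l : ℂ, l ≠ 0 → (E' l).det = 1 := by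
    intro l hl
    have hDh : HoloM (fun l => (E' l).det • (1 : M3)) {l | l ≠ 0} := by
      intro i j
      have h := hE'h
      unfold HoloM at h
      simp only [Matrix.det_fin_three, Matrix.smul_apply]
      fun_prop
    have := hDh.eq_of_eq_off_finite (holoM_const 1 _) hfin (fun l hl hl6 => by
      rw [hdetoff l hl hl6, one_smul]) hl
    have := congrFun (congrFun this 0) 0
    simpa using this
  refine ⟨E', ⟨hE'h, hdet, fun l hl => ?_⟩, hfac⟩
  refine HoloM.eq_of_eq_off_finite (F := fun l => sigma (E' l)) (G := fun l => E' (eps * l))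
    (hE'h.sigma fun l hl => by rw [hdet l hl]; exact one_ne_zero) hE'h.comp_eps hfin
    (fun l hl hl6 => ?_) hl
  have hl' : eps * l ≠ 0 := mul_ne_zero eps_ne_zero hl
  have hl6' : (eps * l) ^ 6 ≠ α ^ 6 := by rwa [eps_mul_pow_six]
  have h1 := hfac _ hl' (pow_three_ne_of_pow_six_ne hl6').1
  rw [← sigma_simpleElt hn hl6, ← sigma_simpleElt hn' hl6, ← hE.sigma_eq l hl, ← sigma_mul,
    hfac l hl (pow_three_ne_of_pow_six_ne hl6).1, sigma_mul, sigma_simpleElt hn' hl6] at h1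
  have hu : IsUnit (simpleElt α b' c' (eps * l)).det :=
    isUnit_iff_ne_zero.mpr (det_simpleElt_ne_zero hn' hl6')
  exact (Matrix.isUnit_iff_isUnit_det _ |>.mpr hu).mul_right_cancel h1

/-! ### Products of two simple elements -/

lemma pow_ne_pow_of_norm_ne {x y : ℂ} (h : ‖x‖ ≠ ‖y‖) {n : ℕ} (hn : n ≠ 0) : x ^ n ≠ y ^ n :=
  fun h' => h ((pow_left_inj₀ (norm_nonneg _) (norm_nonneg _) hn).mp (by
    rw [← norm_pow, ← norm_pow, h']))

/-- The torus element `diag (d, 1/d, 1)`. -/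
def torus (d : ℂ) : M3 := Matrix.diagonal ![d, d⁻¹, 1]

lemma sixPole_eq (α d b₁ c₁ b₂ c₂ l : ℂ) : sixPole α d b₁ c₁ b₂ c₂ l =
    torus d * simpleElt α b₁ c₁ l * simpleElt ((starRingEnd ℂ) α)⁻¹ b₂ c₂ l := rfl

lemma diagonal_mul_three (x y z x' y' z' : ℂ) :
    Matrix.diagonal ![x, y, z] * Matrix.diagonal ![x', y', z'] =
      Matrix.diagonal ![x * x', y * y', z * z'] := by
  rw [Matrix.diagonal_mul_diagonal]
  congr 1
  ext i
  fin_cases i <;> rfl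

lemma diagonal_one_three : (Matrix.diagonal ![1, 1, 1] : M3) = 1 := by
  rw [← Matrix.diagonal_one]
  congr 1
  ext i
  fin_cases i <;> rfl

lemma diagonal_inv_three {x y : ℂ} (hx : x ≠ 0) (hy : y ≠ 0) :
    (Matrix.diagonal ![x, y, 1] : M3)⁻¹ = Matrix.diagonal ![x⁻¹, y⁻¹, 1] := by
  refine Matrix.inv_eq_left_inv ?_
  rw [diagonal_mul_three, inv_mul_cancel₀ hx, inv_mul_cancel₀ hy, mul_one, diagonal_one_three]

lemma torus_inv {d : ℂ} (hd : d ≠ 0) : (torus d)⁻¹ = torus d⁻¹ := by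
  rw [torus, diagonal_inv_three hd (inv_ne_zero hd)]; rfl

lemma torus_inv_mul {d : ℂ} (hd : d ≠ 0) : torus d⁻¹ * torus d = 1 := by
  rw [torus, torus, diagonal_mul_three, inv_mul_cancel₀ hd, inv_mul_cancel₀ (inv_ne_zero hd),
    mul_one, diagonal_one_three]

lemma det_torus {d : ℂ} (hd : d ≠ 0) : (torus d).det = 1 := by
  rw [torus, Matrix.det_diagonal, Fin.prod_univ_three]; simp [hd]

lemma sigma_torus {d : ℂ} (hd : d ≠ 0) : sigma (torus d) = torus d := by
  have h3 := eps_pow_three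
  rw [sigma, ← Matrix.transpose_nonsing_inv, torus_inv hd, matP_inv, matP_conj_transpose]
  ext i j
  fin_cases i <;> fin_cases j <;> simp [torus]

lemma tau_diagonal {H : ℝ} (hH : H = 2 ∨ H = -2) (x y z : ℂ) :
    tau H (Matrix.diagonal ![x, y, z]) =
      Matrix.diagonal ![(starRingEnd ℂ) y, (starRingEnd ℂ) x, (starRingEnd ℂ) z] := by
  rw [tau_eq hH]
  ext i j
  fin_cases i <;> fin_cases j <;> simp

lemma det_sixPole {α d b₁ c₁ b₂ c₂ l : ℂ} (hd : d ≠ 0) (hn₁ : 2 * b₁ * c₁ - 1 ≠ 0)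
    (hn₂ : 2 * b₂ * c₂ - 1 ≠ 0) (h₁ : l ^ 3 ≠ α ^ 3) (h₂ : l ^ 3 ≠ ((starRingEnd ℂ) α)⁻¹ ^ 3) :
    (sixPole α d b₁ c₁ b₂ c₂ l).det = (l ^ 3 + α ^ 3) / (l ^ 3 - α ^ 3) *
      ((l ^ 3 + ((starRingEnd ℂ) α)⁻¹ ^ 3) / (l ^ 3 - ((starRingEnd ℂ) α)⁻¹ ^ 3)) := by
  rw [sixPole_eq, Matrix.det_mul, Matrix.det_mul, det_torus hd, det_simpleElt hn₁ h₁,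
    det_simpleElt hn₂ h₂, one_mul]

lemma det_sixPole_ne_zero {α d b₁ c₁ b₂ c₂ l : ℂ} (hd : d ≠ 0) (hn₁ : 2 * b₁ * c₁ - 1 ≠ 0)
    (hn₂ : 2 * b₂ * c₂ - 1 ≠ 0) (h₁ : l ^ 6 ≠ α ^ 6) (h₂ : l ^ 6 ≠ ((starRingEnd ℂ) α)⁻¹ ^ 6) :
    (sixPole α d b₁ c₁ b₂ c₂ l).det ≠ 0 := by
  rw [sixPole_eq, Matrix.det_mul, Matrix.det_mul, det_torus hd, one_mul]
  exact mul_ne_zero (det_simpleElt_ne_zero hn₁ h₁) (det_simpleElt_ne_zero hn₂ h₂)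

lemma sigma_sixPole {α d b₁ c₁ b₂ c₂ l : ℂ} (hd : d ≠ 0) (hn₁ : 2 * b₁ * c₁ - 1 ≠ 0)
    (hn₂ : 2 * b₂ * c₂ - 1 ≠ 0) (h₁ : l ^ 6 ≠ α ^ 6) (h₂ : l ^ 6 ≠ ((starRingEnd ℂ) α)⁻¹ ^ 6) :
    sigma (sixPole α d b₁ c₁ b₂ c₂ l) = sixPole α d b₁ c₁ b₂ c₂ (eps * l) := by
  rw [sixPole_eq, sixPole_eq, sigma_mul, sigma_mul, sigma_torus hd, sigma_simpleElt hn₁ h₁,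
    sigma_simpleElt hn₂ h₂]

lemma IsSigmaLoop.torus_mul_mul {E : ℂ → M3} (hE : IsSigmaLoop E) {d δ : ℂ} (hd : d ≠ 0)
    (hδ : δ ≠ 0) : IsSigmaLoop fun l => torus d * E l * torus δ where
  holo := ((holoM_const _ _).mul hE.holo).mul (holoM_const _ _)
  det_eq_one l hl := by
    rw [Matrix.det_mul, Matrix.det_mul, det_torus hd, det_torus hδ, hE.det_eq_one l hl]; simp
  sigma_eq l hl := by
    rw [sigma_mul, sigma_mul, sigma_torus hd, sigma_torus hδ, hE.sigma_eq l hl]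

/-- Dressing by `diag (d, 1/d, 1) g_{α,ℓ₁} g_{1/ᾱ,ℓ₂}` at a point where the transformed lines are
not in the cone. -/
theorem exists_sixPole_dressing {E : ℂ → ℂ → M3} {z α d δ b₁ c₁ b₂ c₂ : ℂ}
    (hE : IsSigmaLoop (E z)) (hα : α ≠ 0) (hα1 : ‖α‖ ≠ ‖((starRingEnd ℂ) α)⁻¹‖) (hd : d ≠ 0)
    (hδ : δ ≠ 0) (hn₁ : 2 * b₁ * c₁ - 1 ≠ 0) (hn₂ : 2 * b₂ * c₂ - 1 ≠ 0)
    (hl₂ : line₂ E α b₂ c₂ z ∉ cone) (hl₁ : line₁ E α b₁ c₁ b₂ c₂ z ∉ cone) :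
    ∃ E' : ℂ → M3, IsSigmaLoop E' ∧
      ∀ l : ℂ, l ≠ 0 → l ^ 3 ≠ α ^ 3 → l ^ 3 ≠ ((starRingEnd ℂ) α)⁻¹ ^ 3 →
        sixPole α d b₁ c₁ b₂ c₂ l * E z l = E' l * sixPole α δ (b₁t E α b₁ c₁ b₂ c₂ z)
          (c₁t E α b₁ c₁ b₂ c₂ z) (b₂t E α b₂ c₂ z) (c₂t E α b₂ c₂ z) l := by
  have hβ : ((starRingEnd ℂ) α)⁻¹ ≠ 0 := by simpa using hα
  obtain ⟨E₁, hE₁, hf₁⟩ := exists_dressing hE hβ hn₂ hl₂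
  have hn₂' : 2 * b₂t E α b₂ c₂ z * c₂t E α b₂ c₂ z - 1 ≠ 0 := (not_mem_cone_iff.mp hl₂).2
  have hα6 : α ^ 6 ≠ ((starRingEnd ℂ) α)⁻¹ ^ 6 := pow_ne_pow_of_norm_ne hα1 (by norm_num)
  -- The second step transports `ℓ₁` by the once-dressed frame at `α`, which is `g_{1/ᾱ,ℓ₂}(α) E(α)
  -- g_{1/ᾱ,ℓ̃₂}(α)⁻¹`; `α` is not singular there because `α` and `1/ᾱ` have different moduli.
  have hline : ![b₁, c₁, 1] ᵥ* E₁ α = line₁ E α b₁ c₁ b₂ c₂ z := by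
    rw [line₁, hf₁ α hα (pow_three_ne_of_pow_six_ne hα6).1]
    change _ = ![b₁, c₁, 1] ᵥ* (E₁ α * simpleElt ((starRingEnd ℂ) α)⁻¹ (b₂t E α b₂ c₂ z)
      (c₂t E α b₂ c₂ z) α * _)
    rw [mul_assoc, Matrix.mul_nonsing_inv _ (isUnit_iff_ne_zero.mpr
      (det_simpleElt_ne_zero hn₂' hα6)), mul_one]
  obtain ⟨E₂, hE₂, hf₂⟩ := exists_dressing hE₁ hα hn₁ (by rwa [hline])
  rw [hline] at hf₂
  refine ⟨_, hE₂.torus_mul_mul hd (inv_ne_zero hδ), fun l hl h1 h2 => ?_⟩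
  rw [sixPole_eq, sixPole_eq]
  calc _ = torus d * (simpleElt α b₁ c₁ l *
        (simpleElt ((starRingEnd ℂ) α)⁻¹ b₂ c₂ l * E z l)) := by simp only [mul_assoc]
    _ = torus d * ((simpleElt α b₁ c₁ l * E₁ l) * simpleElt ((starRingEnd ℂ) α)⁻¹
          (b₂t E α b₂ c₂ z) (c₂t E α b₂ c₂ z) l) := by
        rw [hf₁ l hl h2]; simp only [mul_assoc]; rfl
    _ = torus d * (E₂ l * 1 * simpleElt α (b₁t E α b₁ c₁ b₂ c₂ z) (c₁t E α b₁ c₁ b₂ c₂ z) l *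
          simpleElt ((starRingEnd ℂ) α)⁻¹ (b₂t E α b₂ c₂ z) (c₂t E α b₂ c₂ z) l) := by
        rw [hf₂ l hl h1, mul_one]; rfl
    _ = _ := by rw [← torus_inv_mul hδ]; simp only [mul_assoc]

/-! ### The coordinate at infinity -/

/-- The simple element in the coordinate `m = 1/l`. -/
def simpleEltInf (α b c m : ℂ) : M3 :=
  1 + (2 / (1 - α ^ 3 * m ^ 3)) •
    !![α ^ 3 * m ^ 3 * b * c / (2 * b * c - 1), α * m * c ^ 2 / (2 * b * c - 1),
        α ^ 2 * m ^ 2 * c / (2 * b * c - 1);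
      α ^ 2 * m ^ 2 * b ^ 2, α ^ 3 * m ^ 3 * b * c, α * m * b;
      α * m * b, α ^ 2 * m ^ 2 * c, α ^ 3 * m ^ 3]

lemma simpleElt_inv_eq {m : ℂ} (hm : m ≠ 0) (α b c : ℂ) :
    simpleElt α b c m⁻¹ = simpleEltInf α b c m := by
  have h : 2 / (m⁻¹ ^ 3 - α ^ 3) = m ^ 3 * (2 / (1 - α ^ 3 * m ^ 3)) := by
    rw [show m⁻¹ ^ 3 - α ^ 3 = (1 - α ^ 3 * m ^ 3) / m ^ 3 by field_simp, div_div_eq_mul_div]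
    ring
  rw [simpleElt, simpleEltInf, h]
  generalize 2 / (1 - α ^ 3 * m ^ 3) = x
  ext i j
  fin_cases i <;> fin_cases j <;> simp <;> field_simp

lemma holoM_simpleElt {α b c : ℂ} {S : Set ℂ} (h : ∀ l ∈ S, l ^ 3 ≠ α ^ 3) :
    HoloM (simpleElt α b c) S := by
  have h1 : DifferentiableOn ℂ (fun l : ℂ => 2 / (l ^ 3 - α ^ 3)) S :=
    DifferentiableOn.div (by fun_prop) (by fun_prop) fun l hl => sub_ne_zero.mpr (h l hl)
  intro i j
  simp only [simpleElt, Matrix.add_apply, Matrix.smul_apply, smul_eq_mul]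
  refine (differentiableOn_const _).add (h1.mul ?_)
  fin_cases i <;> fin_cases j <;> simp <;> fun_prop

lemma holoM_simpleEltInf {α b c : ℂ} {S : Set ℂ} (h : ∀ m ∈ S, α ^ 3 * m ^ 3 ≠ 1) :
    HoloM (simpleEltInf α b c) S := by
  have h1 : DifferentiableOn ℂ (fun m : ℂ => 2 / (1 - α ^ 3 * m ^ 3)) S :=
    DifferentiableOn.div (by fun_prop) (by fun_prop) fun l hl => sub_ne_zero.mpr (h l hl).symm
  intro i j
  simp only [simpleEltInf, Matrix.add_apply, Matrix.smul_apply, smul_eq_mul]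
  refine (differentiableOn_const _).add (h1.mul ?_)
  fin_cases i <;> fin_cases j <;> simp <;> fun_prop

/-- The six-pole element in the coordinate `m = 1/l`. -/
def sixPoleInf (α d b₁ c₁ b₂ c₂ m : ℂ) : M3 :=
  torus d * simpleEltInf α b₁ c₁ m * simpleEltInf ((starRingEnd ℂ) α)⁻¹ b₂ c₂ m

lemma sixPole_inv_eq {m : ℂ} (hm : m ≠ 0) (α d b₁ c₁ b₂ c₂ : ℂ) :
    sixPole α d b₁ c₁ b₂ c₂ m⁻¹ = sixPoleInf α d b₁ c₁ b₂ c₂ m := by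
  rw [sixPole_eq, sixPoleInf, simpleElt_inv_eq hm, simpleElt_inv_eq hm]

lemma simpleElt_zero {α : ℂ} (hα : α ≠ 0) {b c : ℂ} (hn : 2 * b * c - 1 ≠ 0) :
    simpleElt α b c 0 =
      Matrix.diagonal ![-(2 * b * c - 1)⁻¹, -(2 * b * c - 1), -1] := by
  ext i j
  fin_cases i <;> fin_cases j <;> simp [simpleElt] <;> field_simp <;> ring

/-- The quantities `2bc - 1` appear only at `l = 0`; at infinity the element is the bare torus
factor. Reality ties the two ends together and so fixes the modulus of `d`. -/
lemma sixPole_zero {α : ℂ} (hα : α ≠ 0) {d b₁ c₁ b₂ c₂ : ℂ} (hn₁ : 2 * b₁ * c₁ - 1 ≠ 0)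
    (hn₂ : 2 * b₂ * c₂ - 1 ≠ 0) : sixPole α d b₁ c₁ b₂ c₂ 0 =
      Matrix.diagonal ![d / ((2 * b₁ * c₁ - 1) * (2 * b₂ * c₂ - 1)),
        (2 * b₁ * c₁ - 1) * (2 * b₂ * c₂ - 1) / d, 1] := by
  have hβ : ((starRingEnd ℂ) α)⁻¹ ≠ 0 := by simpa using hα
  rw [sixPole_eq, simpleElt_zero hα hn₁, simpleElt_zero hβ hn₂, torus, diagonal_mul_three,
    diagonal_mul_three]
  congr 1
  ext i
  fin_cases i <;> simp <;> field_simp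
  ring

lemma sixPoleInf_zero (α d b₁ c₁ b₂ c₂ : ℂ) : sixPoleInf α d b₁ c₁ b₂ c₂ 0 = torus d := by
  have h : ∀ α b c : ℂ, simpleEltInf α b c 0 = 1 := fun α b c => by
    ext i j
    fin_cases i <;> fin_cases j <;> simp [simpleEltInf]
  rw [sixPoleInf, h, h, mul_one, mul_one]

/-! ### Reality of the dressed frame -/

lemma HoloM.continuousAt {F : ℂ → M3} {S : Set ℂ} (hF : HoloM F S) {l : ℂ} (hS : S ∈ 𝓝 l) :
    ContinuousAt F l :=
  continuousAt_pi.mpr fun i => continuousAt_pi.mpr fun j =>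
    ((hF i j).differentiableAt hS).continuousAt

lemma HoloM.smul {F : ℂ → M3} {a : ℂ → ℂ} {S : Set ℂ} (ha : DifferentiableOn ℂ a S)
    (hF : HoloM F S) : HoloM (fun l => a l • F l) S := fun i j => ha.mul (hF i j)

lemma ContinuousAt.matrix_inv {X : ℂ → M3} {l : ℂ} (h : ContinuousAt X l) (h0 : (X l).det ≠ 0) :
    ContinuousAt (fun w => (X w)⁻¹) l := by
  simp only [Matrix.inv_def, Ring.inverse_eq_inv']
  have h1 : ContinuousAt (fun w => (X w).det) l :=
    (continuous_id.matrix_det (A := fun X : M3 => X)).continuousAt.comp h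
  have h2 : ContinuousAt (fun w => (X w).adjugate) l :=
    (continuous_id.matrix_adjugate (A := fun X : M3 => X)).continuousAt.comp h
  exact (h1.inv₀ h0).smul h2

lemma continuous_tau (H : ℝ) : Continuous (tau H) :=
  (continuous_const.mul (continuous_id.matrix_map continuous_conj)).mul continuous_const

lemma continuousAt_mul_tau_conj_inv {H : ℝ} (hH : H = 2 ∨ H = -2) {F G : ℂ → M3}
    (hF : ContinuousAt F 0) (hG : ContinuousAt G 0) (h0 : (G 0).det ≠ 0) :
    ContinuousAt (fun l => F l * (tau H (G ((starRingEnd ℂ) l)))⁻¹) 0 := by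
  have h1 : ContinuousAt (fun l => G ((starRingEnd ℂ) l)) 0 :=
    ContinuousAt.comp (f := starRingEnd ℂ) (by rwa [map_zero]) continuous_conj.continuousAt
  have h2 : ContinuousAt (fun l => tau H (G ((starRingEnd ℂ) l))) 0 :=
    (continuous_tau H).continuousAt.comp h1
  refine ContinuousAt.mul hF (ContinuousAt.matrix_inv h2 ?_)
  rw [map_zero, det_tau hH]
  simpa using h0

lemma tau_smul (H : ℝ) (a : ℂ) (X : M3) : tau H (a • X) = (starRingEnd ℂ) a • tau H X := by
  have : (a • X).map (starRingEnd ℂ) = (starRingEnd ℂ) a • X.map (starRingEnd ℂ) := by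
    ext i j; simp
  rw [tau, tau, this, Matrix.mul_smul, Matrix.smul_mul]

/-- The two conjugations cancel, so reflection in the unit circle preserves holomorphy. -/
lemma differentiableOn_conj_inv {f : ℂ → ℂ} (hf : DifferentiableOn ℂ f {l | l ≠ 0}) :
    DifferentiableOn ℂ (fun l => (starRingEnd ℂ) (f ((starRingEnd ℂ) l)⁻¹)) {l | l ≠ 0} := by
  intro l hl
  have hl' : ((starRingEnd ℂ) l)⁻¹ ≠ 0 := by simpa using hl
  have h1 := (hf.differentiableAt (isOpen_ne.mem_nhds hl')).conj_conj
  rw [map_inv₀, conj_conj] at h1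
  have h2 := h1.comp l (differentiableAt_inv hl)
  refine (h2.congr_of_eventuallyEq (Filter.Eventually.of_forall fun w => ?_)).differentiableWithinAt
  simp

lemma HoloM.tau_conj_inv {H : ℝ} (hH : H = 2 ∨ H = -2) {F : ℂ → M3} (hF : HoloM F {l | l ≠ 0}) :
    HoloM (fun l => tau H (F ((starRingEnd ℂ) l)⁻¹)) {l | l ≠ 0} := by
  have h := fun i j => differentiableOn_conj_inv (hF i j)
  intro i j
  simp only [tau_eq hH]
  fin_cases i <;> fin_cases j <;> simp only [Matrix.of_apply, Matrix.cons_val', Fin.zero_eta,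
    Fin.mk_one, Fin.reduceFinMk, Fin.isValue, Matrix.cons_val_zero, Matrix.cons_val_one,
    Matrix.cons_val]
  · exact h 1 1
  · exact h 1 0
  · exact (h 1 2).const_mul _
  · exact h 0 1
  · exact h 0 0
  · exact (h 0 2).const_mul _
  · exact (h 2 1).const_mul _
  · exact (h 2 0).const_mul _
  · exact h 2 2

/-- Liouville's theorem on the sphere for a function holomorphic on `ℂˣ`. -/
lemma liouville_punctured {q : ℂ → ℂ} (hq : DifferentiableOn ℂ q {l | l ≠ 0}) {a b : ℂ}
    (h0 : Filter.Tendsto q (𝓝[≠] 0) (𝓝 a)) (hi : Filter.Tendsto q (Filter.cocompact ℂ) (𝓝 b)) :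
    a = b ∧ ∀ l : ℂ, l ≠ 0 → q l = b := by
  have hc : ContinuousAt (Function.update q 0 a) 0 := continuousAt_update_same.mpr h0
  have hd : Differentiable ℂ (Function.update q 0 a) := by
    rw [← differentiableOn_univ]
    refine (differentiableOn_compl_singleton_and_continuousAt_iff (c := 0) Filter.univ_mem).mp
      ⟨?_, hc⟩
    refine (hq.mono fun l hl => hl.2).congr fun l hl => Function.update_of_ne hl.2 _ _
  have ht : Filter.Tendsto (Function.update q 0 a) (Filter.cocompact ℂ) (𝓝 b) := by
    refine hi.congr' ?_
    have : ({0} : Set ℂ)ᶜ ∈ Filter.cocompact ℂ := isCompact_singleton.compl_mem_cocompact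
    filter_upwards [this] with l hl
    exact (Function.update_of_ne hl _ _).symm
  refine ⟨?_, fun l hl => ?_⟩
  · simpa using hd.apply_eq_of_tendsto_cocompact 0 ht
  · simpa [Function.update_of_ne hl] using hd.apply_eq_of_tendsto_cocompact l ht

/-- `R₀` and `R₁` are continuous extensions of `Q` over `0` and, in the coordinate `1/l`, over `∞`;
so `Q` lives on the sphere and is constant. -/
lemma HoloM.liouville {Q R₀ R₁ : ℂ → M3} (hQ : HoloM Q {l | l ≠ 0}) (h0 : ContinuousAt R₀ 0)
    (h1 : ContinuousAt R₁ 0) (e0 : ∀ᶠ l in 𝓝[≠] (0 : ℂ), Q l = R₀ l)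
    (e1 : ∀ᶠ m in 𝓝[≠] (0 : ℂ), Q m⁻¹ = R₁ m) :
    R₀ 0 = R₁ 0 ∧ ∀ l : ℂ, l ≠ 0 → Q l = R₁ 0 := by
  have hinv : Filter.Tendsto (Inv.inv : ℂ → ℂ) (Filter.cocompact ℂ) (𝓝[≠] 0) := by
    rw [← Metric.cobounded_eq_cocompact]
    exact Filter.tendsto_inv₀_cobounded'
  have key : ∀ i j, R₀ 0 i j = R₁ 0 i j ∧ ∀ l : ℂ, l ≠ 0 → Q l i j = R₁ 0 i j := by
    intro i j
    have c0 : ContinuousAt (fun l => R₀ l i j) 0 :=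
      continuousAt_pi.mp (continuousAt_pi.mp h0 i) j
    have c1 : ContinuousAt (fun l => R₁ l i j) 0 :=
      continuousAt_pi.mp (continuousAt_pi.mp h1 i) j
    refine liouville_punctured (hQ i j) ?_ ?_
    · refine (c0.tendsto.mono_left nhdsWithin_le_nhds).congr' ?_
      filter_upwards [e0] with l hl
      rw [hl]
    · refine ((c1.tendsto.mono_left nhdsWithin_le_nhds).comp hinv).congr' ?_
      filter_upwards [hinv.eventually e1] with l hl
      rw [Function.comp_apply, ← hl, inv_inv]
  exact ⟨by ext i j; exact (key i j).1, fun l hl => by ext i j; exact (key i j).2 l hl⟩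

lemma mem_nearZeroInfty_conj_inv {ρ : ℝ} (hρ : 0 < ρ) {l : ℂ} (hl : l ∈ nearZeroInfty ρ)
    (hl0 : l ≠ 0) : ((starRingEnd ℂ) l)⁻¹ ∈ nearZeroInfty ρ := by
  have hn : 0 < ‖l‖ := norm_pos_iff.mpr hl0
  rcases hl with h | h
  · right
    rw [norm_inv, RCLike.norm_conj]
    exact inv_strictAnti₀ hn h
  · left
    rw [norm_inv, RCLike.norm_conj]
    exact inv_lt_of_inv_lt₀ hρ h

/-- Points of `I` are not singular for the six-pole elements. -/
lemma pow_ne_of_mem_nearZeroInfty {ρ : ℝ} (hρ : 0 < ρ) {α : ℂ} (h1 : ρ < ‖α‖) (h2 : ‖α‖ < ρ⁻¹)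
    {l : ℂ} (hl : l ∈ nearZeroInfty ρ) {n : ℕ} (hn : n ≠ 0) :
    l ^ n ≠ α ^ n ∧ l ^ n ≠ ((starRingEnd ℂ) α)⁻¹ ^ n := by
  have hα : 0 < ‖α‖ := hρ.trans h1
  have e1 : ρ < ‖α‖⁻¹ := lt_inv_of_lt_inv₀ hα h2
  have e2 : ‖α‖⁻¹ < ρ⁻¹ := inv_strictAnti₀ hρ h1
  refine ⟨pow_ne_pow_of_norm_ne ?_ hn, pow_ne_pow_of_norm_ne ?_ hn⟩
  · rcases hl with h | h
    · exact (h.trans h1).ne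
    · exact (h2.trans h).ne'
  · rw [norm_inv, RCLike.norm_conj]
    rcases hl with h | h
    · exact (h.trans e1).ne
    · exact (e2.trans h).ne'

lemma mem_nearZeroInfty_of_ball {ρ : ℝ} {l : ℂ} (hl : l ∈ Metric.ball (0 : ℂ) ρ) :
    l ∈ nearZeroInfty ρ := Or.inl (by simpa using hl)

lemma holoM_sixPole {ρ : ℝ} (hρ : 0 < ρ) {α : ℂ} (h1 : ρ < ‖α‖) (h2 : ‖α‖ < ρ⁻¹)
    (d b₁ c₁ b₂ c₂ : ℂ) : HoloM (sixPole α d b₁ c₁ b₂ c₂) (Metric.ball 0 ρ) := by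
  have h := fun l hl => pow_ne_of_mem_nearZeroInfty hρ h1 h2 (mem_nearZeroInfty_of_ball (l := l) hl)
    (n := 3) (by norm_num)
  exact ((holoM_const _ _).mul (holoM_simpleElt fun l hl => (h l hl).1)).mul
    (holoM_simpleElt fun l hl => (h l hl).2)

lemma holoM_sixPoleInf {ρ : ℝ} (hρ : 0 < ρ) {α : ℂ} (h1 : ρ < ‖α‖) (h2 : ‖α‖ < ρ⁻¹)
    (d b₁ c₁ b₂ c₂ : ℂ) : HoloM (sixPoleInf α d b₁ c₁ b₂ c₂) (Metric.ball 0 ρ) := by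
  have hα0 : α ≠ 0 := norm_pos_iff.mp (hρ.trans h1)
  have h := fun l hl => pow_ne_of_mem_nearZeroInfty hρ h1 h2 (mem_nearZeroInfty_of_ball (l := l) hl)
    (n := 3) (by norm_num)
  have hconj : ∀ m ∈ Metric.ball (0 : ℂ) ρ, (starRingEnd ℂ) m ∈ Metric.ball (0 : ℂ) ρ := by
    intro m hm; simpa using hm
  refine ((holoM_const _ _).mul (holoM_simpleEltInf fun m hm e => ?_)).mul
    (holoM_simpleEltInf fun m hm e => ?_)
  · refine (h _ (hconj m hm)).2 ?_
    have : m ^ 3 = (α ^ 3)⁻¹ := eq_inv_of_mul_eq_one_right e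
    rw [← map_pow, this, map_inv₀, map_pow, inv_pow]
  · refine (h _ (hconj m hm)).1 ?_
    have : m ^ 3 = (((starRingEnd ℂ) α)⁻¹ ^ 3)⁻¹ := eq_inv_of_mul_eq_one_right e
    rw [← map_pow, this, inv_pow, inv_inv, map_pow, conj_conj]

/-- Reality of a dressed loop. -/
theorem tau_dressing {H : ℝ} (hH : H = 2 ∨ H = -2) {ρ : ℝ} (hρ : 0 < ρ) {α : ℂ} (h1 : ρ < ‖α‖)
    (h2 : ‖α‖ < ρ⁻¹) {E E' h : ℂ → M3}
    (hE : ∀ l : ℂ, l ≠ 0 → tau H (E ((starRingEnd ℂ) l)⁻¹) = E l)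
    (hE' : IsSigmaLoop E')
    (hh : ∀ l ∈ nearZeroInfty ρ, l ≠ 0 → tau H (h ((starRingEnd ℂ) l)⁻¹) = h l)
    {δ b₁ c₁ b₂ c₂ : ℂ} (hδ : δ ≠ 0) (hn₁ : 2 * b₁ * c₁ - 1 ≠ 0) (hn₂ : 2 * b₂ * c₂ - 1 ≠ 0)
    (hf : ∀ l : ℂ, l ≠ 0 → l ^ 3 ≠ α ^ 3 → l ^ 3 ≠ ((starRingEnd ℂ) α)⁻¹ ^ 3 →
      h l * E l = E' l * sixPole α δ b₁ c₁ b₂ c₂ l) :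
    (starRingEnd ℂ) ((2 * b₁ * c₁ - 1) * (2 * b₂ * c₂ - 1)) =
        (2 * b₁ * c₁ - 1) * (2 * b₂ * c₂ - 1) ∧
      (δ * (starRingEnd ℂ) δ = (2 * b₁ * c₁ - 1) * (2 * b₂ * c₂ - 1) →
        (∀ l : ℂ, l ≠ 0 → tau H (E' ((starRingEnd ℂ) l)⁻¹) = E' l) ∧
        ∀ l ∈ nearZeroInfty ρ, l ≠ 0 → tau H (sixPole α δ b₁ c₁ b₂ c₂ ((starRingEnd ℂ) l)⁻¹) =
          sixPole α δ b₁ c₁ b₂ c₂ l) := by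
  have hα : α ≠ 0 := norm_pos_iff.mp (hρ.trans h1)
  set g := sixPole α δ b₁ c₁ b₂ c₂ with hg
  set gi := sixPoleInf α δ b₁ c₁ b₂ c₂ with hgi
  set p := (2 * b₁ * c₁ - 1) * (2 * b₂ * c₂ - 1) with hp
  have hp0 : p ≠ 0 := mul_ne_zero hn₁ hn₂
  have hunit : ∀ l : ℂ, l ≠ 0 → IsUnit (E' l).det := fun l hl => by simp [hE'.det_eq_one l hl]
  have hgdet : ∀ l ∈ nearZeroInfty ρ, (g l).det ≠ 0 := fun l hl =>
    have h6 := pow_ne_of_mem_nearZeroInfty hρ h1 h2 hl (n := 6) (by norm_num)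
    det_sixPole_ne_zero hδ hn₁ hn₂ h6.1 h6.2
  -- `Q` measures the failure of `E'` to be `τ`-real. Since `h` and `E` are real, on `I` it is
  -- expressed through the new six-pole element alone, and so it extends over `0` and `∞`.
  set Q : ℂ → M3 := fun l => (E' l)⁻¹ * tau H (E' ((starRingEnd ℂ) l)⁻¹) with hQ
  have hQh : HoloM Q {l | l ≠ 0} := (hE'.holo.inv fun l hl => (hunit l hl).ne_zero).mul
    (hE'.holo.tau_conj_inv hH)
  have hQI : ∀ l ∈ nearZeroInfty ρ, l ≠ 0 → Q l = g l * (tau H (g ((starRingEnd ℂ) l)⁻¹))⁻¹ := by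
    intro l hl hl0
    have hl0' : ((starRingEnd ℂ) l)⁻¹ ≠ 0 := by simpa using hl0
    have hl' := mem_nearZeroInfty_conj_inv hρ hl hl0
    have a := pow_ne_of_mem_nearZeroInfty hρ h1 h2 hl (n := 3) (by norm_num)
    have a' := pow_ne_of_mem_nearZeroInfty hρ h1 h2 hl' (n := 3) (by norm_num)
    have f := hf l hl0 a.1 a.2
    have f' := congrArg (tau H) (hf _ hl0' a'.1 a'.2)
    rw [tau_mul hH, tau_mul hH, hh l hl hl0, hE l hl0, f] at f'
    have hu : IsUnit (tau H (g ((starRingEnd ℂ) l)⁻¹)).det := by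
      rw [det_tau hH]
      exact isUnit_iff_ne_zero.mpr (by simpa using hgdet _ hl')
    calc Q l = (E' l)⁻¹ * (tau H (E' ((starRingEnd ℂ) l)⁻¹) *
          tau H (g ((starRingEnd ℂ) l)⁻¹)) * (tau H (g ((starRingEnd ℂ) l)⁻¹))⁻¹ := by
          rw [mul_assoc, mul_assoc, Matrix.mul_nonsing_inv _ hu, mul_one]
      _ = _ := by rw [← f', ← mul_assoc, Matrix.nonsing_inv_mul _ (hunit l hl0), one_mul]
  have hball : Metric.ball (0 : ℂ) ρ ∈ 𝓝 0 := Metric.ball_mem_nhds 0 hρ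
  have hgc : ContinuousAt g 0 := (holoM_sixPole hρ h1 h2 δ b₁ c₁ b₂ c₂).continuousAt hball
  have hgic : ContinuousAt gi 0 := (holoM_sixPoleInf hρ h1 h2 δ b₁ c₁ b₂ c₂).continuousAt hball
  have hg0 : g 0 = Matrix.diagonal ![δ / p, p / δ, 1] := sixPole_zero hα hn₁ hn₂
  have hgi0 : gi 0 = Matrix.diagonal ![δ, δ⁻¹, 1] := sixPoleInf_zero ..
  have c0 := continuousAt_mul_tau_conj_inv hH hgc hgic (by
    rw [hgi0, Matrix.det_diagonal, Fin.prod_univ_three]; simp [hδ])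
  have c1 := continuousAt_mul_tau_conj_inv hH hgic hgc (by
    rw [hg0, Matrix.det_diagonal, Fin.prod_univ_three]; simp [hδ, hp0])
  obtain ⟨e, hconst⟩ := hQh.liouville c0 c1 (by
      filter_upwards [nhdsWithin_le_nhds hball, self_mem_nhdsWithin] with l hl hl0
      have hl0' : (starRingEnd ℂ) l ≠ 0 := by simpa using hl0
      rw [hQI l (mem_nearZeroInfty_of_ball hl) hl0, hg, sixPole_inv_eq hl0']) (by
      filter_upwards [nhdsWithin_le_nhds hball, self_mem_nhdsWithin] with m hm hm0
      have hm' : m⁻¹ ∈ nearZeroInfty ρ := by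
        have := mem_nearZeroInfty_conj_inv hρ (l := (starRingEnd ℂ) m)
          (mem_nearZeroInfty_of_ball (by simpa using hm)) (by simpa using hm0)
        rwa [conj_conj] at this
      rw [hQI _ hm' (inv_ne_zero hm0), map_inv₀, inv_inv, hg, sixPole_inv_eq hm0])
  have hcp0 : (starRingEnd ℂ) p ≠ 0 := by simpa using hp0
  have hcδ0 : (starRingEnd ℂ) δ ≠ 0 := by simpa using hδ
  simp only [map_zero, hg0, hgi0, tau_diagonal hH, map_one, map_inv₀, map_div₀] at e hconst
  rw [diagonal_inv_three (inv_ne_zero hcδ0) hcδ0,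
    diagonal_inv_three (div_ne_zero hcp0 hcδ0) (div_ne_zero hcδ0 hcp0), diagonal_mul_three,
    diagonal_mul_three] at e
  rw [diagonal_inv_three (div_ne_zero hcp0 hcδ0) (div_ne_zero hcδ0 hcp0),
    diagonal_mul_three] at hconst
  -- The first diagonal entry of `Q` is `δ δ̄ / p` at `0` and `δ δ̄ / p̄` at `∞`.
  have hreal : (starRingEnd ℂ) p = p := by
    have e00 := congrFun (congrFun e 0) 0
    simp only [Matrix.diagonal_apply_eq, Matrix.cons_val_zero] at e00
    field_simp at e00
    exact e00
  refine ⟨hreal, fun hδp => ?_⟩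
  -- With `δ δ̄ = p` the constant is the identity, which is the reality of `E'`, and then of the
  -- six-pole element on `I`.
  have hone : ∀ l : ℂ, l ≠ 0 → Q l = 1 := by
    intro l hl
    rw [hconst l hl, hreal, ← diagonal_one_three]
    congr 1
    ext i
    fin_cases i
    · simp; field_simp; exact hδp
    · simp; field_simp; exact hδp.symm
    · simp
  constructor
  · intro l hl
    have := congrArg (fun X => E' l * X) (hone l hl)
    simp only [hQ, ← mul_assoc, Matrix.mul_nonsing_inv _ (hunit l hl), one_mul, mul_one] at this
    exact this
  · intro l hl hl0
    have hu : IsUnit (tau H (g ((starRingEnd ℂ) l)⁻¹)).det := by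
      rw [det_tau hH]
      exact isUnit_iff_ne_zero.mpr (by
        simpa using hgdet _ (mem_nearZeroInfty_conj_inv hρ hl hl0))
    have := congrArg (fun X => X * tau H (g ((starRingEnd ℂ) l)⁻¹))
      ((hQI l hl hl0).symm.trans (hone l hl0))
    simp only [mul_assoc, Matrix.nonsing_inv_mul _ hu, one_mul, mul_one] at this
    exact this.symm

/-- The six-pole elements with real normalization lie in the loop group of `I`. -/
lemma inLoopI_sixPole {H ρ : ℝ} (hρ : 0 < ρ) {α : ℂ} (h1 : ρ < ‖α‖) (h2 : ‖α‖ < ρ⁻¹)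
    {δ b₁ c₁ b₂ c₂ : ℂ} (hδ : δ ≠ 0) (hn₁ : 2 * b₁ * c₁ - 1 ≠ 0) (hn₂ : 2 * b₂ * c₂ - 1 ≠ 0)
    (ht : ∀ l ∈ nearZeroInfty ρ, l ≠ 0 →
      tau H (sixPole α δ b₁ c₁ b₂ c₂ ((starRingEnd ℂ) l)⁻¹) = sixPole α δ b₁ c₁ b₂ c₂ l) :
    InLoopI H ρ (sixPole α δ b₁ c₁ b₂ c₂) where
  holo_zero := holoM_sixPole hρ h1 h2 δ b₁ c₁ b₂ c₂
  holo_infty := ⟨sixPoleInf α δ b₁ c₁ b₂ c₂, holoM_sixPoleInf hρ h1 h2 δ b₁ c₁ b₂ c₂,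
    fun m _ hm => (sixPole_inv_eq hm ..).symm, by
      rw [sixPoleInf_zero, det_torus hδ]; exact one_ne_zero⟩
  det_ne_zero l hl :=
    have h6 := pow_ne_of_mem_nearZeroInfty hρ h1 h2 hl (n := 6) (by norm_num)
    det_sixPole_ne_zero hδ hn₁ hn₂ h6.1 h6.2
  tau_eq := ht
  sigma_eq l hl :=
    have h6 := pow_ne_of_mem_nearZeroInfty hρ h1 h2 hl (n := 6) (by norm_num)
    sigma_sixPole hδ hn₁ hn₂ h6.1 h6.2

/-- The reality condition of a six-pole element extends from `I` to the unit circle. -/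
lemma tau_sixPole_of_norm_one {H : ℝ} (hH : H = 2 ∨ H = -2) {ρ : ℝ} (hρ : 0 < ρ)
    {α : ℂ} (h1 : ρ < ‖α‖) (h2 : ‖α‖ < ρ⁻¹) (hα1 : ‖α‖ ≠ 1) {d b₁ c₁ b₂ c₂ : ℂ}
    (ht : ∀ l ∈ nearZeroInfty ρ, l ≠ 0 →
      tau H (sixPole α d b₁ c₁ b₂ c₂ ((starRingEnd ℂ) l)⁻¹) = sixPole α d b₁ c₁ b₂ c₂ l)
    {l : ℂ} (hl : ‖l‖ = 1) : tau H (sixPole α d b₁ c₁ b₂ c₂ l) = sixPole α d b₁ c₁ b₂ c₂ l := by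
  set β := ((starRingEnd ℂ) α)⁻¹ with hβ
  -- The condition is given only near `0` and `∞`, away from the unit circle. Clearing the
  -- denominators turns it into an identity of holomorphic functions on the connected set `ℂˣ`.
  set q : ℂ → ℂ := fun l => (l ^ 3 - α ^ 3) * (l ^ 3 - β ^ 3) with hq
  set N : ℂ → M3 := fun l => torus d * simpleNum α b₁ c₁ l * simpleNum β b₂ c₂ l with hN
  have hNh : HoloM N {l | l ≠ 0} :=
    ((holoM_const _ _).mul (holoM_simpleNum _ _ _ _)).mul (holoM_simpleNum _ _ _ _)
  have hqd : Differentiable ℂ q := by fun_prop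
  have heq : ∀ l : ℂ, q l ≠ 0 → sixPole α d b₁ c₁ b₂ c₂ l = (q l)⁻¹ • N l := by
    intro l h
    have a1 := sub_ne_zero.mp (left_ne_zero_of_mul h)
    have a2 := sub_ne_zero.mp (right_ne_zero_of_mul h)
    rw [sixPole_eq, simpleElt_eq a1, ← hβ, simpleElt_eq a2, Matrix.mul_smul, Matrix.mul_smul,
      Matrix.smul_mul, smul_smul, hq, mul_inv, mul_comm (l ^ 3 - β ^ 3)⁻¹]
  have hI : ∀ l ∈ nearZeroInfty ρ, q l ≠ 0 := fun l hl => by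
    have a := pow_ne_of_mem_nearZeroInfty hρ h1 h2 hl (n := 3) (by norm_num)
    exact mul_ne_zero (sub_ne_zero.mpr a.1) (sub_ne_zero.mpr a.2)
  have hF : HoloM (fun l => q l • tau H (N ((starRingEnd ℂ) l)⁻¹)) {l | l ≠ 0} :=
    HoloM.smul hqd.differentiableOn (hNh.tau_conj_inv hH)
  have hG : HoloM (fun l => (starRingEnd ℂ) (q ((starRingEnd ℂ) l)⁻¹) • N l) {l | l ≠ 0} :=
    HoloM.smul (differentiableOn_conj_inv hqd.differentiableOn) hNh
  have hIeq : ∀ l ∈ nearZeroInfty ρ, l ≠ 0 → q l • tau H (N ((starRingEnd ℂ) l)⁻¹) =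
      (starRingEnd ℂ) (q ((starRingEnd ℂ) l)⁻¹) • N l := by
    intro l hl hl0
    have hl' := mem_nearZeroInfty_conj_inv hρ hl hl0
    have q1 := hI l hl
    have q2 : (starRingEnd ℂ) (q ((starRingEnd ℂ) l)⁻¹) ≠ 0 := by simpa using hI _ hl'
    have := ht l hl hl0
    rw [heq _ (hI l hl), heq _ (hI _ hl'), tau_smul, map_inv₀] at this
    have h3 := congrArg (fun X => (q l * (starRingEnd ℂ) (q ((starRingEnd ℂ) l)⁻¹)) • X) this
    simp only [smul_smul] at h3
    rwa [mul_assoc, mul_inv_cancel₀ q2, mul_one, mul_comm (q l), mul_assoc, mul_inv_cancel₀ q1,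
      mul_one] at h3
  have hopen : IsOpen {l : ℂ | l ≠ 0} := isOpen_ne
  have hconn : IsPreconnected {l : ℂ | l ≠ 0} :=
    (isConnected_compl_singleton_of_one_lt_rank (by simp) (0 : ℂ)).isPreconnected
  have hl0 : l ≠ 0 := by rintro rfl; simp at hl
  -- Identity theorem, starting from the point `ρ/2` of `I`.
  have hext : q l • tau H (N ((starRingEnd ℂ) l)⁻¹) =
      (starRingEnd ℂ) (q ((starRingEnd ℂ) l)⁻¹) • N l := by
    ext i j
    refine ((hF i j).analyticOnNhd hopen).eqOn_of_preconnected_of_eventuallyEq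
      ((hG i j).analyticOnNhd hopen) hconn (z₀ := ((ρ / 2 : ℝ) : ℂ))
      (by simp [hρ.ne']) ?_ hl0
    have hm : ((ρ / 2 : ℝ) : ℂ) ∈ Metric.ball (0 : ℂ) ρ := by
      rw [mem_ball_zero_iff, norm_real, Real.norm_of_nonneg (by positivity)]
      linarith
    filter_upwards [Metric.isOpen_ball.mem_nhds hm, hopen.mem_nhds
      (show ((ρ / 2 : ℝ) : ℂ) ∈ {l : ℂ | l ≠ 0} by simp [hρ.ne'])] with w hw hw0
    rw [hIeq w (mem_nearZeroInfty_of_ball hw) hw0]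
  rw [conj_inv_of_norm_one hl] at hext
  have hql : q l ≠ 0 := by
    refine mul_ne_zero (sub_ne_zero.mpr (pow_ne_pow_of_norm_ne ?_ (by norm_num)))
      (sub_ne_zero.mpr (pow_ne_pow_of_norm_ne ?_ (by norm_num)))
    · rw [hl]; exact hα1.symm
    · rw [hl, hβ, norm_inv, RCLike.norm_conj]
      exact fun h => hα1 (by rw [eq_comm, inv_eq_one] at h; exact h)
  have hcq : (starRingEnd ℂ) (q l) ≠ 0 := by simpa using hql
  rw [heq l hql, tau_smul, map_inv₀]
  have h3 := congrArg (fun X => ((q l)⁻¹ * ((starRingEnd ℂ) (q l))⁻¹) • X) hext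
  simp only [smul_smul] at h3
  rwa [mul_assoc, mul_comm _ (q l), ← mul_assoc, inv_mul_cancel₀ hql, one_mul, mul_assoc,
    inv_mul_cancel₀ hcq, mul_one] at h3

/-! ### The linear system under dressing -/

/-- The shape of the `dz`-part of the Maurer-Cartan forms. -/
def formZ (p x y l : ℂ) : M3 := !![p, 0, l * x; l * y, -p, 0; 0, l * x, 0]

/-- The shape of the `dz̄`-part of the Maurer-Cartan forms. -/
def formW (q x y l : ℂ) : M3 := !![-q, l⁻¹ * y, 0; 0, q, l⁻¹ * x; l⁻¹ * x, 0, 0]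

lemma connZ_eq_formZ (H : ℝ) (ψ : ℂ → ℝ) (U : ℂ → ℂ) (l z : ℂ) : connZ H ψ U l z =
    formZ (dz (fun w => (ψ w : ℂ)) z / 2)
      (Complex.sqrt ((-H / 2 : ℝ) : ℂ) * (Real.exp (ψ z / 2) : ℂ))
      (U z * (Real.exp (-ψ z) : ℂ)) l := by
  simp only [connZ, formZ]
  ext i j
  fin_cases i <;> fin_cases j <;> simp [-ofReal_exp] <;> ring

lemma connZbar_eq_formW (H : ℝ) (ψ : ℂ → ℝ) (U : ℂ → ℂ) (l z : ℂ) : connZbar H ψ U l z =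
    formW (dzbar (fun w => (ψ w : ℂ)) z / 2)
      (Complex.sqrt ((-H / 2 : ℝ) : ℂ) * (Real.exp (ψ z / 2) : ℂ))
      ((starRingEnd ℂ) (U z) * (Real.exp (-ψ z) : ℂ)) l := by
  simp only [connZbar, formW]
  ext i j
  fin_cases i <;> fin_cases j <;> simp [-ofReal_exp] <;> ring

/-- Gauge transformations of a linear system. -/
lemma HasWM.gauge {F g : ℂ → M3} {Z W Z' W' gz gb : M3} {z : ℂ}
    (hF : HasWM F (F z * Z) (F z * W) z) (hg : HasWM g gz gb z) (h0 : (g z).det ≠ 0)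
    (hZ : g z * Z - gz = Z' * g z) (hW : g z * W - gb = W' * g z) :
    HasWM (fun w => F w * (g w)⁻¹) (F z * (g z)⁻¹ * Z') (F z * (g z)⁻¹ * W') z := by
  have hu : IsUnit (g z).det := isUnit_iff_ne_zero.mpr h0
  have key : ∀ A B C : M3, g z * A - B = C * g z →
      F z * A * (g z)⁻¹ + F z * -((g z)⁻¹ * B * (g z)⁻¹) = F z * (g z)⁻¹ * C := by
    intro A B C h
    have h1 : C = (g z * A - B) * (g z)⁻¹ := by
      rw [h, mul_assoc, Matrix.mul_nonsing_inv _ hu, mul_one]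
    have h2 : (g z)⁻¹ * (g z * A) = A := by
      rw [← mul_assoc, Matrix.nonsing_inv_mul _ hu, one_mul]
    rw [h1, sub_mul, mul_sub, mul_neg, sub_eq_add_neg]
    congr 1
    · rw [mul_assoc (F z) (g z)⁻¹, ← mul_assoc (g z)⁻¹, h2, mul_assoc]
    · simp only [mul_assoc]
  exact (hF.mul (hg.inv h0)).congr_deriv (key _ _ _ hZ) (key _ _ _ hW)

/-- The coordinates of a line transported by a solution of the linear system. -/
lemma hasW_line {F : ℂ → M3} {p q x y x' y' α z : ℂ}
    (hF : HasWM F (F z * formZ p x y α) (F z * formW q x' y' α) z) (u : Fin 3 → ℂ)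
    (h2 : (u ᵥ* F z) 2 ≠ 0) :
    HasW (fun w => lineB (u ᵥ* F w))
      (lineB (u ᵥ* F z) * p + α * lineC (u ᵥ* F z) * y - α * x * lineB (u ᵥ* F z) ^ 2)
      (-lineB (u ᵥ* F z) * q + α⁻¹ * x' - α⁻¹ * x' * lineC (u ᵥ* F z) * lineB (u ᵥ* F z)) z ∧
    HasW (fun w => lineC (u ᵥ* F w))
      (-lineC (u ᵥ* F z) * p + α * x - α * x * lineB (u ᵥ* F z) * lineC (u ᵥ* F z))
      (α⁻¹ * y' * lineB (u ᵥ* F z) + lineC (u ᵥ* F z) * q - α⁻¹ * x' * lineC (u ᵥ* F z) ^ 2)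
      z := by
  -- The row vector satisfies the linear system itself; the quotients of its coordinates then
  -- satisfy Riccati equations by the quotient rule.
  have hv : ∀ j, HasW (fun w => (u ᵥ* F w) j) ((u ᵥ* F z ᵥ* formZ p x y α) j)
      ((u ᵥ* F z ᵥ* formW q x' y' α) j) z := by
    intro j
    have h := HasW.sum (f := fun i w => u i * F w i j) Finset.univ
      fun i _ => (hF i j).const_mul (u i)
    refine (h.congr (Filter.Eventually.of_forall fun w => rfl)).congr_deriv ?_ ?_ <;>
    · rw [Matrix.vecMul_vecMul]; rfl
  generalize hvz : u ᵥ* F z = v at *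
  have hz : ∀ j, (u ᵥ* F z) j = v j := fun j => by rw [hvz]
  have e0 : (v ᵥ* formZ p x y α) 0 = v 0 * p + v 1 * (α * y) := by
    simp [formZ, Matrix.vecMul, dotProduct, Fin.sum_univ_three]
  have e1 : (v ᵥ* formZ p x y α) 1 = -(v 1 * p) + v 2 * (α * x) := by
    simp [formZ, Matrix.vecMul, dotProduct, Fin.sum_univ_three]
  have e2 : (v ᵥ* formZ p x y α) 2 = v 0 * (α * x) := by
    simp [formZ, Matrix.vecMul, dotProduct, Fin.sum_univ_three]
  have f0 : (v ᵥ* formW q x' y' α) 0 = -(v 0 * q) + v 2 * (α⁻¹ * x') := by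
    simp [formW, Matrix.vecMul, dotProduct, Fin.sum_univ_three]
  have f1 : (v ᵥ* formW q x' y' α) 1 = v 0 * (α⁻¹ * y') + v 1 * q := by
    simp [formW, Matrix.vecMul, dotProduct, Fin.sum_univ_three]
  have f2 : (v ᵥ* formW q x' y' α) 2 = v 1 * (α⁻¹ * x') := by
    simp [formW, Matrix.vecMul, dotProduct, Fin.sum_univ_three]
  constructor
  · refine ((hv 0).div (hv 2) (by rwa [hz])).congr_deriv ?_ ?_
    · rw [e0, e2, hz, hz, lineB, lineC]; field_simp; try ring
    · rw [f0, f2, hz, hz, lineB, lineC]; field_simp; try ring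
  · refine ((hv 1).div (hv 2) (by rwa [hz])).congr_deriv ?_ ?_
    · rw [e1, e2, hz, hz, lineB, lineC]; field_simp; try ring
    · rw [f1, f2, hz, hz, lineB, lineC]; field_simp; try ring

/-- The derivative of the simple element along a variation `(b', c')` of its line. -/
def simpleEltDeriv (α b c b' c' l : ℂ) : M3 :=
  (2 / (l ^ 3 - α ^ 3)) •
    !![-(α ^ 3 * (b' * c + b * c')) / (2 * b * c - 1) ^ 2,
      α * l ^ 2 * (2 * c * c' * (2 * b * c - 1) - c ^ 2 * (2 * (b' * c + b * c'))) /
        (2 * b * c - 1) ^ 2,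
      α ^ 2 * l * (c' * (2 * b * c - 1) - c * (2 * (b' * c + b * c'))) / (2 * b * c - 1) ^ 2;
      α ^ 2 * l * (2 * b * b'), α ^ 3 * (b' * c + b * c'), α * l ^ 2 * b';
      α * l ^ 2 * b', α ^ 2 * l * c', 0]

lemma hasWM_simpleElt {b c : ℂ → ℂ} {bz bb cz cb z : ℂ} (hb : HasW b bz bb z)
    (hc : HasW c cz cb z) (hn : 2 * b z * c z - 1 ≠ 0) (α l : ℂ) :
    HasWM (fun w => simpleElt α (b w) (c w) l) (simpleEltDeriv α (b z) (c z) bz cz l)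
      (simpleEltDeriv α (b z) (c z) bb cb l) z := by
  have hN : HasW (fun w => 2 * b w * c w - 1) (2 * (bz * c z + b z * cz))
      (2 * (bb * c z + b z * cb)) z := by
    refine (((hb.const_mul 2).mul hc).sub (hasW_const 1 z)).congr_deriv ?_ ?_ <;> ring
  have key : ∀ {f : ℂ → ℂ} {p q p' q' : ℂ} (e : ℂ), HasW f p q z → 
      2 / (l ^ 3 - α ^ 3) * p = p' → 2 / (l ^ 3 - α ^ 3) * q = q' →
      HasW (fun w => e + 2 / (l ^ 3 - α ^ 3) * f w) p' q' z := by
    intro f p q p' q' e hf hp hq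
    exact ((hasW_const e z).add (hf.const_mul _)).congr_deriv (by rw [zero_add, hp])
      (by rw [zero_add, hq])
  intro i j
  simp only [simpleElt, simpleEltDeriv, Matrix.add_apply, Matrix.smul_apply, smul_eq_mul]
  fin_cases i <;> fin_cases j <;> simp only [Matrix.of_apply, Matrix.cons_val', Fin.zero_eta,
    Fin.mk_one, Fin.reduceFinMk, Fin.isValue, Matrix.cons_val_zero, Matrix.cons_val_one,
    Matrix.cons_val]
  · exact key _ ((((hb.const_mul (α ^ 3)).mul hc).div hN hn)) (by ring) (by ring)
  · exact key _ ((((hc.mul hc).const_mul (α * l ^ 2)).div hN hn).congr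
      (Filter.Eventually.of_forall fun w => by simp only [sq])) (by ring) (by ring)
  · exact key _ ((hc.const_mul (α ^ 2 * l)).div hN hn) (by ring) (by ring)
  · exact key _ (((hb.mul hb).const_mul (α ^ 2 * l)).congr
      (Filter.Eventually.of_forall fun w => by simp only [sq])) (by ring) (by ring)
  · exact key _ ((hb.const_mul (α ^ 3)).mul hc) (by ring) (by ring)
  · exact key _ (hb.const_mul (α * l ^ 2)) (by ring) (by ring)
  · exact key _ (hb.const_mul (α * l ^ 2)) (by ring) (by ring)
  · exact key _ (hc.const_mul (α ^ 2 * l)) (by ring) (by ring)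
  · exact key _ (hasW_const (α ^ 3) z) (by ring) (by ring)

/-- `hbz` and `hcz` are the Riccati equations of the line transported at `α`. They make the gauge
transform a form of the same shape; with `n = 2bc - 1`, only `p` changes, by `n_z / n`. -/
lemma simpleElt_mul_formZ {α b c l p x y bz cz : ℂ} (hn : 2 * b * c - 1 ≠ 0) (hl : l ^ 3 ≠ α ^ 3)
    (hbz : bz = b * p + α * c * y - α * x * b ^ 2) (hcz : cz = -c * p + α * x - α * x * b * c) :
    simpleElt α b c l * formZ p x y l - simpleEltDeriv α b c bz cz l =
      formZ (p + 2 * (bz * c + b * cz) / (2 * b * c - 1)) x y l * simpleElt α b c l := by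
  have hl' : l ^ 3 - α ^ 3 ≠ 0 := sub_ne_zero.mpr hl
  subst hbz hcz
  rw [simpleElt_eq hl, Matrix.smul_mul, Matrix.mul_smul]
  ext i j
  simp only [Matrix.sub_apply, Matrix.smul_apply, smul_eq_mul, Matrix.mul_apply,
    Fin.sum_univ_three, simpleEltDeriv, simpleNum, formZ]
  fin_cases i <;> fin_cases j <;> simp only [Matrix.of_apply, Matrix.cons_val', Fin.zero_eta,
    Fin.mk_one, Fin.reduceFinMk, Fin.isValue, Matrix.cons_val_zero, Matrix.cons_val_one,
    Matrix.cons_val, mul_zero, zero_mul, add_zero, zero_add] <;> field_simp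
  on_goal 2 =>
    simp only [div_eq_mul_inv, ← inv_pow]
    linear_combination (l ^ 2 * α * c ^ 2 * p * (2 * b * c - 1)⁻¹ + l ^ 2 * α ^ 2 * c * x *
      ((2 * b * c - 1) * (2 * b * c - 1)⁻¹ + 1)) * mul_inv_cancel₀ hn
  all_goals ring

/-- In contrast with the `dz` part, `q` is unchanged and the off-diagonal entries scale by `n` and
`n⁻²`. This asymmetry is removed at the end by the torus factor. -/
lemma simpleElt_mul_formW {α b c l q x y bb cb : ℂ} (hn : 2 * b * c - 1 ≠ 0) (hl : l ^ 3 ≠ α ^ 3)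
    (hl0 : l ≠ 0) (hα : α ≠ 0) (hbb : bb = -b * q + α⁻¹ * x - α⁻¹ * x * c * b)
    (hcb : cb = α⁻¹ * y * b + c * q - α⁻¹ * x * c ^ 2) :
    simpleElt α b c l * formW q x y l - simpleEltDeriv α b c bb cb l =
      formW q (x * (2 * b * c - 1)) (y / (2 * b * c - 1) ^ 2) l * simpleElt α b c l := by
  have hl' : l ^ 3 - α ^ 3 ≠ 0 := sub_ne_zero.mpr hl
  subst hbb hcb
  rw [simpleElt_eq hl, Matrix.smul_mul, Matrix.mul_smul]
  ext i j
  simp only [Matrix.sub_apply, Matrix.smul_apply, smul_eq_mul, Matrix.mul_apply,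
    Fin.sum_univ_three, simpleEltDeriv, simpleNum, formW]
  fin_cases i <;> fin_cases j <;> simp only [Matrix.of_apply, Matrix.cons_val', Fin.zero_eta,
    Fin.mk_one, Fin.reduceFinMk, Fin.isValue, Matrix.cons_val_zero, Matrix.cons_val_one,
    Matrix.cons_val, mul_zero, zero_mul, add_zero, zero_add] <;> field_simp
  on_goal 9 => linear_combination (-2 * α ^ 2 * c * x) * mul_inv_cancel₀ hn
  all_goals ring

/-- One dressing step of the linear system: `F` is the solution at the parameter `l`, and `(b, c)`
are the coordinates of the line transported by the solution at `α`. -/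
lemma HasWM.dressing {F : ℂ → M3} {b c : ℂ → ℂ} {p q x y x' y' α l z bz bb cz cb : ℂ}
    (hα : α ≠ 0) (hl : l ≠ 0) (hl6 : l ^ 6 ≠ α ^ 6) (hn : 2 * b z * c z - 1 ≠ 0)
    (hF : HasWM F (F z * formZ p x y l) (F z * formW q x' y' l) z)
    (hb : HasW b bz bb z) (hc : HasW c cz cb z)
    (hbz : bz = b z * p + α * c z * y - α * x * b z ^ 2)
    (hcz : cz = -c z * p + α * x - α * x * b z * c z)
    (hbb : bb = -b z * q + α⁻¹ * x' - α⁻¹ * x' * c z * b z)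
    (hcb : cb = α⁻¹ * y' * b z + c z * q - α⁻¹ * x' * c z ^ 2) :
    HasWM (fun w => F w * (simpleElt α (b w) (c w) l)⁻¹)
      (F z * (simpleElt α (b z) (c z) l)⁻¹ *
        formZ (p + 2 * (bz * c z + b z * cz) / (2 * b z * c z - 1)) x y l)
      (F z * (simpleElt α (b z) (c z) l)⁻¹ *
        formW q (x' * (2 * b z * c z - 1)) (y' / (2 * b z * c z - 1) ^ 2) l) z := by
  have hl3 := (pow_three_ne_of_pow_six_ne hl6).1
  exact hF.gauge (hasWM_simpleElt hb hc hn α l) (det_simpleElt_ne_zero hn hl6)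
    (simpleElt_mul_formZ hn hl3 hbz hcz) (simpleElt_mul_formW hn hl3 hl hα hbb hcb)

/-- A constant row vector times the once-dressed frame at `α`, the form to which `hasW_line`
applies. -/
lemma line₁_eq (E : ℂ → ℂ → M3) (α b₁ c₁ b₂ c₂ z : ℂ) : line₁ E α b₁ c₁ b₂ c₂ z =
    (![b₁, c₁, 1] ᵥ* simpleElt ((starRingEnd ℂ) α)⁻¹ b₂ c₂ α) ᵥ* (E z α *
      (simpleElt ((starRingEnd ℂ) α)⁻¹ (b₂t E α b₂ c₂ z) (c₂t E α b₂ c₂ z) α)⁻¹) := by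
  rw [line₁, Matrix.vecMul_vecMul, mul_assoc]

/-- The linear system satisfied by `E g̃₂⁻¹ g̃₁⁻¹`. -/
theorem hasWM_double_dressing {E : ℂ → ℂ → M3} {p q x y x' y' α b₁ c₁ b₂ c₂ z : ℂ}
    (hE : ∀ l : ℂ, l ≠ 0 → HasWM (fun w => E w l) (E z l * formZ p x y l)
      (E z l * formW q x' y' l) z) (hα : α ≠ 0) (hα1 : ‖α‖ ≠ ‖((starRingEnd ℂ) α)⁻¹‖)
    (hl₂ : line₂ E α b₂ c₂ z ∉ cone) (hl₁ : line₁ E α b₁ c₁ b₂ c₂ z ∉ cone) :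
    ∃ πz πb, HasW (prodT E α b₁ c₁ b₂ c₂) πz πb z ∧
      ∀ l : ℂ, l ≠ 0 → l ^ 6 ≠ α ^ 6 → l ^ 6 ≠ ((starRingEnd ℂ) α)⁻¹ ^ 6 →
        ∃ F : ℂ → M3, (∀ w, F w = E w l *
            (simpleElt ((starRingEnd ℂ) α)⁻¹ (b₂t E α b₂ c₂ w) (c₂t E α b₂ c₂ w) l)⁻¹ *
            (simpleElt α (b₁t E α b₁ c₁ b₂ c₂ w) (c₁t E α b₁ c₁ b₂ c₂ w) l)⁻¹) ∧
          HasWM F (F z * formZ (p + πz / prodT E α b₁ c₁ b₂ c₂ z) x y l)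
            (F z * formW q (x' * prodT E α b₁ c₁ b₂ c₂ z)
              (y' / prodT E α b₁ c₁ b₂ c₂ z ^ 2) l) z := by
  have hβ : ((starRingEnd ℂ) α)⁻¹ ≠ 0 := by simpa using hα
  have hα6 : α ^ 6 ≠ ((starRingEnd ℂ) α)⁻¹ ^ 6 := pow_ne_pow_of_norm_ne hα1 (by norm_num)
  obtain ⟨v2, n2⟩ := not_mem_cone_iff.mp hl₂
  obtain ⟨v1, n1⟩ := not_mem_cone_iff.mp hl₁
  have n2' : 2 * b₂t E α b₂ c₂ z * c₂t E α b₂ c₂ z - 1 ≠ 0 := n2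
  have n1' : 2 * b₁t E α b₁ c₁ b₂ c₂ z * c₁t E α b₁ c₁ b₂ c₂ z - 1 ≠ 0 := n1
  obtain ⟨hb2, hc2⟩ := hasW_line (hE _ hβ) ![b₂, c₂, 1] v2
  change HasW (b₂t E α b₂ c₂) _ _ z at hb2
  change HasW (c₂t E α b₂ c₂) _ _ z at hc2
  have step2 := fun (l : ℂ) (hl : l ≠ 0) (hl6 : l ^ 6 ≠ ((starRingEnd ℂ) α)⁻¹ ^ 6) =>
    (hE l hl).dressing hβ hl hl6 n2' hb2 hc2 rfl rfl rfl rfl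
  have hline := line₁_eq E α b₁ c₁ b₂ c₂
  obtain ⟨hb1, hc1⟩ := hasW_line (step2 α hα hα6)
    (![b₁, c₁, 1] ᵥ* simpleElt ((starRingEnd ℂ) α)⁻¹ b₂ c₂ α) (by rw [← hline]; exact v1)
  simp only [← hline] at hb1 hc1
  change HasW (b₁t E α b₁ c₁ b₂ c₂) _ _ z at hb1
  change HasW (c₁t E α b₁ c₁ b₂ c₂) _ _ z at hc1
  have hN1 := (((hb1.const_mul 2).mul hc1).sub (hasW_const 1 z))
  have hN2 := (((hb2.const_mul 2).mul hc2).sub (hasW_const 1 z))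
  refine ⟨_, _, hN1.mul hN2, fun l hl h1 h2 => ⟨_, fun w => rfl, ?_⟩⟩
  refine ((step2 l hl h2).dressing hα hl h1 n1' hb1 hc1 rfl rfl rfl rfl).congr_deriv ?_ ?_
  · congr 2
    simp only [prodT]
    generalize 2 * b₂t E α b₂ c₂ z * c₂t E α b₂ c₂ z - 1 = n₂ at *
    generalize 2 * b₁t E α b₁ c₁ b₂ c₂ z * c₁t E α b₁ c₁ b₂ c₂ z - 1 = n₁ at *
    field_simp
    ring
  · congr 2
    · simp only [prodT]; ring
    · simp only [prodT]; field_simp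

/-- After two simple factors the `dz` part has entries `x`, `y` and the `dz̄` part `x' n`, `y'/n²`,
where `n` is the product of the two `2b̃c̃ - 1`. A torus factor with `δ² = n` makes them `δ x`,
`y/δ²` and `δ x'`, `y'/δ²`. -/
lemma torus_mul_formZ {δ p x y l r : ℂ} (hδ : δ ≠ 0) :
    torus δ * formZ p x y l - Matrix.diagonal ![r, -r / δ ^ 2, 0] =
      formZ (p - r / δ) (x * δ) (y / δ ^ 2) l * torus δ := by
  ext i j
  rw [Matrix.sub_apply, torus, Matrix.diagonal_mul, Matrix.mul_diagonal]
  fin_cases i <;> fin_cases j <;> simp [formZ] <;> field_simp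
  ring

lemma torus_mul_formW {δ q x y l r : ℂ} (hδ : δ ≠ 0) :
    torus δ * formW q x y l - Matrix.diagonal ![r, -r / δ ^ 2, 0] =
      formW (q + r / δ) (x / δ) (y * δ ^ 2) l * torus δ := by
  ext i j
  rw [Matrix.sub_apply, torus, Matrix.diagonal_mul, Matrix.mul_diagonal]
  fin_cases i <;> fin_cases j <;> simp [formW] <;> field_simp
  all_goals ring

lemma hasWM_torus {δ : ℂ → ℂ} {p q z : ℂ} (h : HasW δ p q z) (h0 : δ z ≠ 0) :
    HasWM (fun w => torus (δ w)) (Matrix.diagonal ![p, -p / δ z ^ 2, 0])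
      (Matrix.diagonal ![q, -q / δ z ^ 2, 0]) z := by
  have h' : HasW (fun w => (δ w)⁻¹) (-p / δ z ^ 2) (-q / δ z ^ 2) z :=
    (h.inv h0).congr_deriv (by ring) (by ring)
  intro i j
  fin_cases i <;> fin_cases j <;> simp only [torus, Matrix.diagonal, Matrix.of_apply,
    Fin.zero_eta, Fin.mk_one, Fin.reduceFinMk, Fin.isValue, Matrix.cons_val_zero,
    Matrix.cons_val_one, Matrix.cons_val, if_true, Fin.reduceEq, if_false, zero_ne_one,
    one_ne_zero]
  exacts [h, hasW_const _ _, hasW_const _ _, hasW_const _ _, h', hasW_const _ _, hasW_const _ _,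
    hasW_const _ _, hasW_const _ _]

/-! ### The dressed frame -/

/-- The data of a dressing by a six-pole element. -/
structure DressingData (Ω : Set ℂ) (H ρ : ℝ) (ψ : ℂ → ℝ) (U : ℂ → ℂ) (E : ℂ → ℂ → M3)
    (α d b₁ c₁ b₂ c₂ : ℂ) : Prop where
  isOpen : IsOpen Ω
  hH : H = 2 ∨ H = -2
  smooth_psi : ContDiffOn ℝ ∞ ψ Ω
  smooth_cubic : ContDiffOn ℝ ∞ U Ω
  frame : IsExtendedFrame Ω H ψ U E
  loop : ∀ z ∈ Ω, InLoopSL H (E z)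
  pos : 0 < ρ
  lt_norm : ρ < ‖α‖
  norm_lt : ‖α‖ < ρ⁻¹
  norm_ne_one : ‖α‖ ≠ 1
  d_ne_zero : d ≠ 0
  n₁_ne_zero : 2 * b₁ * c₁ - 1 ≠ 0
  n₂_ne_zero : 2 * b₂ * c₂ - 1 ≠ 0
  tau_eq : ∀ l ∈ nearZeroInfty ρ, l ≠ 0 →
    tau H (sixPole α d b₁ c₁ b₂ c₂ ((starRingEnd ℂ) l)⁻¹) = sixPole α d b₁ c₁ b₂ c₂ l

/-- The points at which the transformed lines are not in the cone. -/
def nonConeSet (Ω : Set ℂ) (E : ℂ → ℂ → M3) (α b₁ c₁ b₂ c₂ : ℂ) : Set ℂ :=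
  {z | z ∈ Ω ∧ line₂ E α b₂ c₂ z ∉ cone ∧ line₁ E α b₁ c₁ b₂ c₂ z ∉ cone}

lemma isClosed_cone : IsClosed cone := by
  have h : cone = {v : Fin 3 → ℂ | 2 * v 0 * v 1 = v 2 ^ 2} ∪ {v | v 2 = 0} := rfl
  rw [h]
  exact (isClosed_eq (by fun_prop) (by fun_prop)).union (isClosed_eq (by fun_prop) (by fun_prop))

lemma isOpen_not_mem_cone {S : Set ℂ} (hS : IsOpen S) {v : ℂ → Fin 3 → ℂ}
    (hv : ∀ j, ContDiffOn ℝ ∞ (fun z => v z j) S) : IsOpen {z | z ∈ S ∧ v z ∉ cone} :=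
  (continuousOn_pi.mpr fun j => (hv j).continuousOn).isOpen_inter_preimage hS
    isClosed_cone.isOpen_compl

lemma contDiffOn_vecMul {F : ℂ → M3} {S : Set ℂ} (hF : SmoothM F S) (u : Fin 3 → ℂ) (j : Fin 3) :
    ContDiffOn ℝ ∞ (fun z => (u ᵥ* F z) j) S := by
  simp only [Matrix.vecMul, dotProduct]
  exact ContDiffOn.sum fun i _ => contDiffOn_const.mul (hF i j)

lemma contDiffOn_div {f g : ℂ → ℂ} {S : Set ℂ} (hf : ContDiffOn ℝ ∞ f S)
    (hg : ContDiffOn ℝ ∞ g S) (h : ∀ z ∈ S, g z ≠ 0) : ContDiffOn ℝ ∞ (fun z => f z / g z) S := by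
  simp only [div_eq_mul_inv]
  exact hf.mul (hg.inv h)

lemma smoothM_simpleElt {b c : ℂ → ℂ} {S : Set ℂ} (hb : ContDiffOn ℝ ∞ b S)
    (hc : ContDiffOn ℝ ∞ c S) (hn : ∀ z ∈ S, 2 * b z * c z - 1 ≠ 0) (α l : ℂ) :
    SmoothM (fun z => simpleElt α (b z) (c z) l) S := by
  have hN : ContDiffOn ℝ ∞ (fun z => (2 * b z * c z - 1)⁻¹) S :=
    ContDiffOn.inv (by fun_prop) hn
  intro i j
  simp only [simpleElt, Matrix.add_apply, Matrix.smul_apply, smul_eq_mul, div_eq_mul_inv]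
  refine contDiffOn_const.add (contDiffOn_const.mul ?_)
  fin_cases i <;> fin_cases j <;> simp only [Matrix.of_apply, Matrix.cons_val', Fin.zero_eta,
    Fin.mk_one, Fin.reduceFinMk, Fin.isValue, Matrix.cons_val_zero, Matrix.cons_val_one,
    Matrix.cons_val] <;> fun_prop

/-! ### Smoothness and reality of the transformed data, openness of the regular set -/

namespace DressingData

variable {Ω : Set ℂ} {H ρ : ℝ} {ψ : ℂ → ℝ} {U : ℂ → ℂ} {E : ℂ → ℂ → M3} {α d b₁ c₁ b₂ c₂ : ℂ}

lemma α_ne_zero (S : DressingData Ω H ρ ψ U E α d b₁ c₁ b₂ c₂) : α ≠ 0 :=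
  norm_pos_iff.mp (S.pos.trans S.lt_norm)

lemma β_ne_zero (S : DressingData Ω H ρ ψ U E α d b₁ c₁ b₂ c₂) : ((starRingEnd ℂ) α)⁻¹ ≠ 0 := by
  simpa using S.α_ne_zero

lemma norm_β_ne_one (S : DressingData Ω H ρ ψ U E α d b₁ c₁ b₂ c₂) :
    ‖((starRingEnd ℂ) α)⁻¹‖ ≠ 1 := by
  rw [norm_inv, RCLike.norm_conj, Ne, inv_eq_one]
  exact S.norm_ne_one

lemma norm_ne (S : DressingData Ω H ρ ψ U E α d b₁ c₁ b₂ c₂) :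
    ‖α‖ ≠ ‖((starRingEnd ℂ) α)⁻¹‖ := by
  intro h
  have h0 : 0 < ‖α‖ := S.pos.trans S.lt_norm
  rw [norm_inv, RCLike.norm_conj] at h
  have h2 : ‖α‖ ^ 2 = 1 := by
    rw [sq]; nth_rewrite 2 [h]; exact mul_inv_cancel₀ h0.ne'
  exact S.norm_ne_one ((pow_eq_one_iff_of_nonneg h0.le two_ne_zero).mp h2)

lemma pow_ne_of_norm_one (S : DressingData Ω H ρ ψ U E α d b₁ c₁ b₂ c₂) {l : ℂ} (hl : ‖l‖ = 1)
    {n : ℕ} (hn : n ≠ 0) : l ^ n ≠ α ^ n ∧ l ^ n ≠ ((starRingEnd ℂ) α)⁻¹ ^ n :=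
  ⟨pow_ne_pow_of_norm_ne (by rw [hl]; exact S.norm_ne_one.symm) hn,
    pow_ne_pow_of_norm_ne (by rw [hl]; exact S.norm_β_ne_one.symm) hn⟩

lemma smooth_line₂ (S : DressingData Ω H ρ ψ U E α d b₁ c₁ b₂ c₂) (j : Fin 3) :
    ContDiffOn ℝ ∞ (fun z => line₂ E α b₂ c₂ z j) Ω :=
  contDiffOn_vecMul (F := fun z => E z ((starRingEnd ℂ) α)⁻¹) (S.frame.smooth _ S.β_ne_zero) _ j

lemma isOpen_line₂ (S : DressingData Ω H ρ ψ U E α d b₁ c₁ b₂ c₂) :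
    IsOpen {z | z ∈ Ω ∧ line₂ E α b₂ c₂ z ∉ cone} :=
  isOpen_not_mem_cone S.isOpen S.smooth_line₂

lemma smooth_b₂t (S : DressingData Ω H ρ ψ U E α d b₁ c₁ b₂ c₂) :
    ContDiffOn ℝ ∞ (b₂t E α b₂ c₂) {z | z ∈ Ω ∧ line₂ E α b₂ c₂ z ∉ cone} :=
  contDiffOn_div ((S.smooth_line₂ 0).mono fun _ h => h.1) ((S.smooth_line₂ 2).mono fun _ h => h.1)
    fun _ h => (not_mem_cone_iff.mp h.2).1

lemma smooth_c₂t (S : DressingData Ω H ρ ψ U E α d b₁ c₁ b₂ c₂) :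
    ContDiffOn ℝ ∞ (c₂t E α b₂ c₂) {z | z ∈ Ω ∧ line₂ E α b₂ c₂ z ∉ cone} :=
  contDiffOn_div ((S.smooth_line₂ 1).mono fun _ h => h.1) ((S.smooth_line₂ 2).mono fun _ h => h.1)
    fun _ h => (not_mem_cone_iff.mp h.2).1

lemma smooth_line₁ (S : DressingData Ω H ρ ψ U E α d b₁ c₁ b₂ c₂) (j : Fin 3) :
    ContDiffOn ℝ ∞ (fun z => line₁ E α b₁ c₁ b₂ c₂ z j)
      {z | z ∈ Ω ∧ line₂ E α b₂ c₂ z ∉ cone} := by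
  simp only [line₁_eq]
  have hα6 : α ^ 6 ≠ ((starRingEnd ℂ) α)⁻¹ ^ 6 := pow_ne_pow_of_norm_ne S.norm_ne (by norm_num)
  have hE : SmoothM (fun z => E z α) {z | z ∈ Ω ∧ line₂ E α b₂ c₂ z ∉ cone} := fun i j =>
    (S.frame.smooth α S.α_ne_zero i j).mono fun _ h => h.1
  have hn : ∀ z ∈ {z | z ∈ Ω ∧ line₂ E α b₂ c₂ z ∉ cone},
      2 * b₂t E α b₂ c₂ z * c₂t E α b₂ c₂ z - 1 ≠ 0 := fun z hz => (not_mem_cone_iff.mp hz.2).2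
  exact contDiffOn_vecMul (hE.mul ((smoothM_simpleElt S.smooth_b₂t S.smooth_c₂t hn _ _).inv
    fun z hz => det_simpleElt_ne_zero (hn z hz) hα6)) _ j

lemma isOpen_nonConeSet (S : DressingData Ω H ρ ψ U E α d b₁ c₁ b₂ c₂) :
    IsOpen (nonConeSet Ω E α b₁ c₁ b₂ c₂) := by
  have h := isOpen_not_mem_cone S.isOpen_line₂ S.smooth_line₁
  convert! h using 1
  ext z
  simp only [nonConeSet, Set.mem_setOf_eq, and_assoc]

lemma smooth_prodT (S : DressingData Ω H ρ ψ U E α d b₁ c₁ b₂ c₂) :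
    ContDiffOn ℝ ∞ (prodT E α b₁ c₁ b₂ c₂) (nonConeSet Ω E α b₁ c₁ b₂ c₂) := by
  have hb2 := S.smooth_b₂t.mono (t := nonConeSet Ω E α b₁ c₁ b₂ c₂) fun _ h => ⟨h.1, h.2.1⟩
  have hc2 := S.smooth_c₂t.mono (t := nonConeSet Ω E α b₁ c₁ b₂ c₂) fun _ h => ⟨h.1, h.2.1⟩
  have h1 := fun j => (S.smooth_line₁ j).mono (t := nonConeSet Ω E α b₁ c₁ b₂ c₂)
    fun _ h => ⟨h.1, h.2.1⟩
  have hb1 : ContDiffOn ℝ ∞ (b₁t E α b₁ c₁ b₂ c₂) (nonConeSet Ω E α b₁ c₁ b₂ c₂) :=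
    contDiffOn_div (h1 0) (h1 2) fun _ h => (not_mem_cone_iff.mp h.2.2).1
  have hc1 : ContDiffOn ℝ ∞ (c₁t E α b₁ c₁ b₂ c₂) (nonConeSet Ω E α b₁ c₁ b₂ c₂) :=
    contDiffOn_div (h1 1) (h1 2) fun _ h => (not_mem_cone_iff.mp h.2.2).1
  exact (((contDiffOn_const.mul hb1).mul hc1).sub contDiffOn_const).mul
    (((contDiffOn_const.mul hb2).mul hc2).sub contDiffOn_const)

/-- Reality of the product holds for any torus normalization of the new element, so the Liouville
argument is run with `δ = 1`, before `d̃` is available. -/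
lemma conj_prodT (S : DressingData Ω H ρ ψ U E α d b₁ c₁ b₂ c₂) {z : ℂ}
    (hz : z ∈ nonConeSet Ω E α b₁ c₁ b₂ c₂) :
    (starRingEnd ℂ) (prodT E α b₁ c₁ b₂ c₂ z) = prodT E α b₁ c₁ b₂ c₂ z := by
  obtain ⟨E', hE', hf⟩ := exists_sixPole_dressing (S.loop z hz.1).isSigmaLoop S.α_ne_zero S.norm_ne
    S.d_ne_zero one_ne_zero S.n₁_ne_zero S.n₂_ne_zero hz.2.1 hz.2.2
  exact (tau_dressing S.hH S.pos S.lt_norm S.norm_lt (S.loop z hz.1).tau_eq hE' S.tau_eq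
    one_ne_zero (not_mem_cone_iff.mp hz.2.2).2 (not_mem_cone_iff.mp hz.2.1).2 hf).1

lemma prodT_eq_re (S : DressingData Ω H ρ ψ U E α d b₁ c₁ b₂ c₂) {z : ℂ}
    (hz : z ∈ nonConeSet Ω E α b₁ c₁ b₂ c₂) :
    prodT E α b₁ c₁ b₂ c₂ z = ((prodT E α b₁ c₁ b₂ c₂ z).re : ℂ) :=
  (conj_eq_iff_re.mp (S.conj_prodT hz)).symm

/-- Positivity of a complex number is not an open condition; since the product is real, it reduces
to the open condition on its real part. -/
theorem regularSet_eq (S : DressingData Ω H ρ ψ U E α d b₁ c₁ b₂ c₂) :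
    regularSet Ω E α b₁ c₁ b₂ c₂ = nonConeSet Ω E α b₁ c₁ b₂ c₂ ∩
      (fun z => (prodT E α b₁ c₁ b₂ c₂ z).re) ⁻¹' Set.Ioi 0 := by
  ext z
  constructor
  · rintro ⟨h1, h2, h3, h4⟩
    exact ⟨⟨h1, h2, h3⟩, (Complex.pos_iff.mp h4).1⟩
  · rintro ⟨h, h4⟩
    refine ⟨h.1, h.2.1, h.2.2, ?_⟩
    rw [S.prodT_eq_re h]
    exact_mod_cast h4

theorem isOpen_regularSet (S : DressingData Ω H ρ ψ U E α d b₁ c₁ b₂ c₂) :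
    IsOpen (regularSet Ω E α b₁ c₁ b₂ c₂) := by
  rw [S.regularSet_eq]
  exact (continuous_re.comp_continuousOn S.smooth_prodT.continuousOn).isOpen_inter_preimage
    S.isOpen_nonConeSet isOpen_Ioi

lemma dt_pos (S : DressingData Ω H ρ ψ U E α d b₁ c₁ b₂ c₂) {z : ℂ}
    (hz : z ∈ regularSet Ω E α b₁ c₁ b₂ c₂) : 0 < dt E α b₁ c₁ b₂ c₂ z := by
  rw [S.regularSet_eq] at hz
  exact Real.sqrt_pos.mpr hz.2

lemma dt_ne_zero (S : DressingData Ω H ρ ψ U E α d b₁ c₁ b₂ c₂) {z : ℂ}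
    (hz : z ∈ regularSet Ω E α b₁ c₁ b₂ c₂) : (dt E α b₁ c₁ b₂ c₂ z : ℂ) ≠ 0 :=
  ofReal_ne_zero.mpr (S.dt_pos hz).ne'

lemma dt_sq (S : DressingData Ω H ρ ψ U E α d b₁ c₁ b₂ c₂) {z : ℂ}
    (hz : z ∈ regularSet Ω E α b₁ c₁ b₂ c₂) :
    (dt E α b₁ c₁ b₂ c₂ z : ℂ) ^ 2 = prodT E α b₁ c₁ b₂ c₂ z := by
  rw [S.regularSet_eq] at hz
  rw [S.prodT_eq_re hz.1, ← ofReal_pow, dt, Real.sq_sqrt (le_of_lt hz.2)]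

lemma smooth_dt (S : DressingData Ω H ρ ψ U E α d b₁ c₁ b₂ c₂) :
    ContDiffOn ℝ ∞ (dt E α b₁ c₁ b₂ c₂) (regularSet Ω E α b₁ c₁ b₂ c₂) := by
  rw [S.regularSet_eq]
  exact ContDiffOn.sqrt (reCLM.contDiff.comp_contDiffOn
    (S.smooth_prodT.mono Set.inter_subset_left)) fun z hz => ne_of_gt hz.2

lemma regularSet_subset : regularSet Ω E α b₁ c₁ b₂ c₂ ⊆ Ω := fun _ h => h.1

lemma smooth_psiT (S : DressingData Ω H ρ ψ U E α d b₁ c₁ b₂ c₂) :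
    ContDiffOn ℝ ∞ (psiT ψ E α b₁ c₁ b₂ c₂) (regularSet Ω E α b₁ c₁ b₂ c₂) :=
  ContDiffOn.log ((S.smooth_dt.pow 2).mul (S.smooth_psi.mono regularSet_subset).exp)
    fun _ hz => (mul_pos (pow_pos (S.dt_pos hz) 2) (Real.exp_pos _)).ne'

lemma exp_psiT_half (S : DressingData Ω H ρ ψ U E α d b₁ c₁ b₂ c₂) {z : ℂ}
    (hz : z ∈ regularSet Ω E α b₁ c₁ b₂ c₂) : Real.exp (psiT ψ E α b₁ c₁ b₂ c₂ z / 2) =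
      dt E α b₁ c₁ b₂ c₂ z * Real.exp (ψ z / 2) := by
  have h := S.dt_pos hz
  have : psiT ψ E α b₁ c₁ b₂ c₂ z / 2 = Real.log (dt E α b₁ c₁ b₂ c₂ z) + ψ z / 2 := by
    rw [psiT, Real.log_mul (by positivity) (Real.exp_pos _).ne', Real.log_exp, Real.log_pow]
    push_cast
    ring
  rw [this, Real.exp_add, Real.exp_log h]

lemma exp_neg_psiT (S : DressingData Ω H ρ ψ U E α d b₁ c₁ b₂ c₂) {z : ℂ}
    (hz : z ∈ regularSet Ω E α b₁ c₁ b₂ c₂) : Real.exp (-psiT ψ E α b₁ c₁ b₂ c₂ z) =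
      Real.exp (-ψ z) / dt E α b₁ c₁ b₂ c₂ z ^ 2 := by
  have h := S.dt_pos hz
  rw [psiT, Real.exp_neg, Real.exp_log (by positivity), Real.exp_neg]
  field_simp

/-- The derivatives of `ψ̃ = ψ + log d̃²`. -/
lemma hasW_psiT (S : DressingData Ω H ρ ψ U E α d b₁ c₁ b₂ c₂) {z p q πz πb : ℂ}
    (hz : z ∈ regularSet Ω E α b₁ c₁ b₂ c₂) (hp : HasW (fun w => (ψ w : ℂ)) p q z)
    (hπ : HasW (prodT E α b₁ c₁ b₂ c₂) πz πb z) :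
    HasW (fun w => (dt E α b₁ c₁ b₂ c₂ w : ℂ)) (πz / (2 * dt E α b₁ c₁ b₂ c₂ z))
      (πb / (2 * dt E α b₁ c₁ b₂ c₂ z)) z ∧
    HasW (fun w => (psiT ψ E α b₁ c₁ b₂ c₂ w : ℂ)) (p + πz / prodT E α b₁ c₁ b₂ c₂ z)
      (q + πb / prodT E α b₁ c₁ b₂ c₂ z) z := by
  have hG := S.isOpen_regularSet
  have h0 := S.dt_ne_zero hz
  have hdt := hasW_of_contDiffOn hG (contDiffOn_ofReal S.smooth_dt) hz
  have hps := hasW_of_contDiffOn hG (contDiffOn_ofReal S.smooth_psiT) hz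
  have h1 : HasW (fun w => (dt E α b₁ c₁ b₂ c₂ w : ℂ)) (πz / (2 * dt E α b₁ c₁ b₂ c₂ z))
      (πb / (2 * dt E α b₁ c₁ b₂ c₂ z)) z := by
    have h2 : HasW (prodT E α b₁ c₁ b₂ c₂) _ _ z := (hdt.mul hdt).congr (by
      filter_upwards [hG.mem_nhds hz] with w hw
      rw [← S.dt_sq hw, sq])
    obtain ⟨e1, e2⟩ := hπ.unique h2
    refine hdt.congr_deriv ?_ ?_
    · rw [e1]; field_simp; ring
    · rw [e2]; field_simp; ring
  refine ⟨h1, ?_⟩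
  have h3 := hasW_exp_half hps
  have h4 : HasW (fun w => ((Real.exp (psiT ψ E α b₁ c₁ b₂ c₂ w / 2) : ℝ) : ℂ)) _ _ z :=
    (h1.mul (hasW_exp_half hp)).congr (by
      filter_upwards [hG.mem_nhds hz] with w hw
      rw [S.exp_psiT_half hw, ofReal_mul])
  obtain ⟨e1, e2⟩ := h3.unique h4
  have hf := (exp_half_identities (ψ z)).1
  rw [S.exp_psiT_half hz, ofReal_mul] at e1 e2
  refine hps.congr_deriv ?_ ?_
  · rw [← S.dt_sq hz]
    generalize (dt E α b₁ c₁ b₂ c₂ z : ℂ) = t at *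
    generalize ((Real.exp (ψ z / 2) : ℝ) : ℂ) = f at *
    field_simp at e1 ⊢
    linear_combination e1
  · rw [← S.dt_sq hz]
    generalize (dt E α b₁ c₁ b₂ c₂ z : ℂ) = t at *
    generalize ((Real.exp (ψ z / 2) : ℝ) : ℂ) = f at *
    field_simp at e2 ⊢
    linear_combination e2

end DressingData

/-! ### The linear system solved by the dressed frame -/

namespace DressingData

variable {Ω : Set ℂ} {H ρ : ℝ} {ψ : ℂ → ℝ} {U : ℂ → ℂ} {E : ℂ → ℂ → M3} {α d b₁ c₁ b₂ c₂ : ℂ}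

lemma n₁t_ne_zero {z : ℂ} (hz : z ∈ regularSet Ω E α b₁ c₁ b₂ c₂) :
    2 * b₁t E α b₁ c₁ b₂ c₂ z * c₁t E α b₁ c₁ b₂ c₂ z - 1 ≠ 0 :=
  (not_mem_cone_iff.mp hz.2.2.1).2

lemma n₂t_ne_zero {z : ℂ} (hz : z ∈ regularSet Ω E α b₁ c₁ b₂ c₂) :
    2 * b₂t E α b₂ c₂ z * c₂t E α b₂ c₂ z - 1 ≠ 0 :=
  (not_mem_cone_iff.mp hz.2.1).2

lemma sixPoleT_inv (E : ℂ → ℂ → M3) (α b₁ c₁ b₂ c₂ z l : ℂ) :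
    (sixPoleT E α b₁ c₁ b₂ c₂ z l)⁻¹ =
      (simpleElt ((starRingEnd ℂ) α)⁻¹ (b₂t E α b₂ c₂ z) (c₂t E α b₂ c₂ z) l)⁻¹ *
      (simpleElt α (b₁t E α b₁ c₁ b₂ c₂ z) (c₁t E α b₁ c₁ b₂ c₂ z) l)⁻¹ *
      (torus (dt E α b₁ c₁ b₂ c₂ z : ℂ))⁻¹ := by
  rw [sixPoleT, sixPole_eq, Matrix.mul_inv_rev, Matrix.mul_inv_rev, mul_assoc]

/-- Away from the singular values of the parameter, `E h̃⁻¹` solves the linear system of `ψ̃`. -/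
theorem solvesOn_mul_sixPoleT_inv (S : DressingData Ω H ρ ψ U E α d b₁ c₁ b₂ c₂) {l : ℂ}
    (hl : l ≠ 0) (h1 : l ^ 6 ≠ α ^ 6) (h2 : l ^ 6 ≠ ((starRingEnd ℂ) α)⁻¹ ^ 6) :
    SolvesOn (regularSet Ω E α b₁ c₁ b₂ c₂) H (psiT ψ E α b₁ c₁ b₂ c₂) U l
      fun w => E w l * (sixPoleT E α b₁ c₁ b₂ c₂ w l)⁻¹ := by
  intro z hz
  have hG := S.isOpen_regularSet
  have hp := hasW_of_contDiffOn S.isOpen (contDiffOn_ofReal S.smooth_psi) hz.1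
  obtain ⟨πz, πb, hπ, hd⟩ := hasWM_double_dressing (fun l hl =>
    (S.frame.solvesOn S.isOpen hl z hz.1).congr_deriv (by rw [connZ_eq_formZ])
      (by rw [connZbar_eq_formW])) S.α_ne_zero S.norm_ne hz.2.1 hz.2.2.1
  obtain ⟨F, hF, hFd⟩ := hd l hl h1 h2
  obtain ⟨hdt, hps⟩ := S.hasW_psiT hz hp hπ
  have h0 := S.dt_ne_zero hz
  have hsq := S.dt_sq hz
  -- With `d̃² = prodT` the torus gauge turns the form into `α_λ` for `ψ̃`, because `e^{ψ̃/2} = d̃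
  -- e^{ψ/2}` and `U e^{-ψ̃} = U e^{-ψ}/d̃²`.
  have key := hFd.gauge (hasWM_torus hdt h0) (by rw [det_torus h0]; exact one_ne_zero)
    (torus_mul_formZ h0) (torus_mul_formW h0)
  have heq : ∀ w ∈ regularSet Ω E α b₁ c₁ b₂ c₂, E w l * (sixPoleT E α b₁ c₁ b₂ c₂ w l)⁻¹ =
      F w * (torus (dt E α b₁ c₁ b₂ c₂ w : ℂ))⁻¹ := fun w hw => by
    rw [sixPoleT_inv, hF w]; simp only [mul_assoc]
  refine (key.congr (by filter_upwards [hG.mem_nhds hz] with w hw using heq w hw)).congr_deriv ?_ ?_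
  · beta_reduce
    rw [heq z hz, connZ_eq_formZ, hps.dz_eq, S.exp_psiT_half hz, S.exp_neg_psiT hz, ← hsq]
    congr 2
    · field_simp; ring
    · push_cast; ring
    · push_cast; ring
  · beta_reduce
    rw [heq z hz, connZbar_eq_formW, hps.dzbar_eq, S.exp_psiT_half hz, S.exp_neg_psiT hz, ← hsq]
    congr 2
    · field_simp
    · push_cast; field_simp
    · push_cast; field_simp

/-- One frame suffices, and `l = 1` is not singular because `α` is off the unit circle. The
equations are needed for local frames of the new system at the singular parameters. -/
lemma gaussCodazzi_psiT (S : DressingData Ω H ρ ψ U E α d b₁ c₁ b₂ c₂) :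
    GaussCodazzi (regularSet Ω E α b₁ c₁ b₂ c₂) H (psiT ψ E α b₁ c₁ b₂ c₂) U := by
  have h := S.pow_ne_of_norm_one (l := 1) (by simp) (n := 6) (by norm_num)
  refine gaussCodazzi_of_frame S.isOpen_regularSet S.hH S.smooth_psiT
    (S.smooth_cubic.mono regularSet_subset) one_ne_zero
    (S.solvesOn_mul_sixPoleT_inv one_ne_zero h.1 h.2) fun z hz => ?_
  rw [Matrix.det_mul, Matrix.det_nonsing_inv, (S.loop z hz.1).det_eq_one 1 one_ne_zero, one_mul,
    Ring.inverse_eq_inv']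
  exact inv_ne_zero (det_sixPole_ne_zero (S.dt_ne_zero hz) (n₁t_ne_zero hz) (n₂t_ne_zero hz)
    h.1 h.2)

/-- The factorization of the dressed frame. -/
theorem exists_dressed_frame (S : DressingData Ω H ρ ψ U E α d b₁ c₁ b₂ c₂) :
    ∃ Et : ℂ → ℂ → M3,
      (∀ z ∈ regularSet Ω E α b₁ c₁ b₂ c₂,
        InLoopSL H (Et z) ∧ InLoopI H ρ (sixPoleT E α b₁ c₁ b₂ c₂ z) ∧
        ∀ l : ℂ, l ≠ 0 → l ^ 3 ≠ α ^ 3 → l ^ 3 ≠ ((starRingEnd ℂ) α)⁻¹ ^ 3 →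
          sixPole α d b₁ c₁ b₂ c₂ l * E z l = Et z l * sixPoleT E α b₁ c₁ b₂ c₂ z l) ∧
      IsExtendedFrame (regularSet Ω E α b₁ c₁ b₂ c₂) H (psiT ψ E α b₁ c₁ b₂ c₂) U Et := by
  have hpt : ∀ z, z ∈ regularSet Ω E α b₁ c₁ b₂ c₂ → ∃ E' : ℂ → M3,
      InLoopSL H E' ∧ InLoopI H ρ (sixPoleT E α b₁ c₁ b₂ c₂ z) ∧
      ∀ l : ℂ, l ≠ 0 → l ^ 3 ≠ α ^ 3 → l ^ 3 ≠ ((starRingEnd ℂ) α)⁻¹ ^ 3 →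
        sixPole α d b₁ c₁ b₂ c₂ l * E z l = E' l * sixPoleT E α b₁ c₁ b₂ c₂ z l := by
    intro z hz
    obtain ⟨E', hE', hf⟩ := exists_sixPole_dressing (S.loop z hz.1).isSigmaLoop S.α_ne_zero
      S.norm_ne S.d_ne_zero (S.dt_ne_zero hz) S.n₁_ne_zero S.n₂_ne_zero hz.2.1 hz.2.2.1
    obtain ⟨ht, hI⟩ := (tau_dressing S.hH S.pos S.lt_norm S.norm_lt (S.loop z hz.1).tau_eq hE'
      S.tau_eq (S.dt_ne_zero hz) (n₁t_ne_zero hz) (n₂t_ne_zero hz) hf).2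
      (by rw [conj_ofReal, ← sq, S.dt_sq hz]; rfl)
    exact ⟨E', ⟨hE'.holo, hE'.det_eq_one, ht, hE'.sigma_eq⟩, inLoopI_sixPole S.pos S.lt_norm
      S.norm_lt (S.dt_ne_zero hz) (n₁t_ne_zero hz) (n₂t_ne_zero hz) hI, hf⟩
  -- The loops are chosen point by point, so nothing is known yet about their dependence on `z`; for
  -- non-singular `l` it comes from the factorization itself.
  choose! Et hEt using hpt
  have hG := S.isOpen_regularSet
  have hU := S.smooth_cubic.mono (regularSet_subset (E := E) (α := α) (b₁ := b₁) (c₁ := c₁)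
    (b₂ := b₂) (c₂ := c₂))
  have hgen : ∀ l : ℂ, l ≠ 0 → l ^ 6 ≠ α ^ 6 → l ^ 6 ≠ ((starRingEnd ℂ) α)⁻¹ ^ 6 →
      SolvesOn (regularSet Ω E α b₁ c₁ b₂ c₂) H (psiT ψ E α b₁ c₁ b₂ c₂) U l
        fun w => Et w l := by
    intro l hl h1 h2
    have heq : ∀ w ∈ regularSet Ω E α b₁ c₁ b₂ c₂, Et w l =
        sixPole α d b₁ c₁ b₂ c₂ l * (E w l * (sixPoleT E α b₁ c₁ b₂ c₂ w l)⁻¹) := by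
      intro w hw
      rw [← mul_assoc, (hEt w hw).2.2 l hl (pow_three_ne_of_pow_six_ne h1).1
        (pow_three_ne_of_pow_six_ne h2).1, mul_assoc, Matrix.mul_nonsing_inv, mul_one]
      exact isUnit_iff_ne_zero.mpr (det_sixPole_ne_zero (S.dt_ne_zero hw) (n₁t_ne_zero hw)
        (n₂t_ne_zero hw) h1 h2)
    intro z hz
    have := (S.solvesOn_mul_sixPoleT_inv hl h1 h2).const_mul (sixPole α d b₁ c₁ b₂ c₂ l) z hz
    refine (this.congr (G := fun w => Et w l) (by
      filter_upwards [hG.mem_nhds hz] with w hw using heq w hw)).congr_deriv ?_ ?_ <;>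
    · beta_reduce; rw [heq z hz]
  refine ⟨Et, hEt, isExtendedFrame_of_solvesOn hG S.smooth_psiT hU (fun l hl => ?_)
    fun l hl z hz => by rw [(hEt z hz).1.det_eq_one l hl]; exact one_ne_zero⟩
  intro x hx
  obtain ⟨e, he, hsub, Γ, g1, g2, g3, g4⟩ := exists_local_frame hG S.hH S.smooth_psiT hU
    S.gaussCodazzi_psiT hx
  -- At fixed `z` both sides are holomorphic in `l` and agree off the finitely many singular
  -- parameters, so they agree at those too; the right side solves the system there.
  have hloc : ∀ z ∈ Metric.ball x e, Et z l = Et x l * Γ z l := by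
    intro z hz
    refine HoloM.eq_of_eq_off_finite (F := Et z) (G := fun l => Et x l * Γ z l)
      (hEt z (hsub hz)).1.holo (HoloM.mul (hEt x hx).1.holo (g3 z hz))
      ((finite_pow_six_eq (α ^ 6)).union (finite_pow_six_eq (((starRingEnd ℂ) α)⁻¹ ^ 6)))
      (fun l hl hT => ?_) hl
    simp only [Set.mem_union, Set.mem_setOf_eq, not_or] at hT
    exact g4 l hl (fun w => Et w l) (fun w hw => hgen l hl hT.1 hT.2 w (hsub hw)) z hz
  have hxe : x ∈ Metric.ball x e := Metric.mem_ball_self he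
  have := SolvesOn.const_mul (g1 l hl) (Et x l) x hxe
  refine (this.congr (G := fun w => Et w l) (by
    filter_upwards [Metric.isOpen_ball.mem_nhds hxe] with w hw using hloc w hw)).congr_deriv ?_ ?_
    <;> (beta_reduce; rw [← hloc x hxe])

end DressingData

/-! ### Explicit formula, determinant on the unit circle and real position -/

/-! ### The dressed affine spheres -/

/-- The explicit formula is the last column of the frame times `g₂⁻¹ g₁⁻¹`. -/
lemma dressingFormula_eq {H : ℝ} {s α b₁ c₁ b₂ c₂ l r rz rzb : ℂ} (hα : α ≠ 0) (hl : l ≠ 0)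
    (hn₁ : 2 * b₁ * c₁ - 1 ≠ 0) (hn₂ : 2 * b₂ * c₂ - 1 ≠ 0) (h1 : l ^ 6 ≠ α ^ 6)
    (h2 : l ^ 6 ≠ ((starRingEnd ℂ) α)⁻¹ ^ 6) :
    dressingFormula H s α b₁ c₁ b₂ c₂ l r rz rzb =
      (![l⁻¹ * s * rz, l * s * rzb, -(H : ℂ) * r] ᵥ*
        ((simpleElt ((starRingEnd ℂ) α)⁻¹ b₂ c₂ l)⁻¹ * (simpleElt α b₁ c₁ l)⁻¹)) 2 := by
  have ha : (starRingEnd ℂ) α ≠ 0 := by simpa using hα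
  have e1 := (pow_three_ne_of_pow_six_ne h1).2
  have e2 := (pow_three_ne_of_pow_six_ne h2).2
  rw [simpleElt_inv hn₂ h2, simpleElt_inv hn₁ h1, ← Matrix.vecMul_vecMul, dressingFormula]
  generalize (starRingEnd ℂ) α = a at *
  have e3 : l ^ 3 * a ^ 3 + 1 ≠ 0 := by
    intro h
    refine e2 ?_
    rw [inv_pow]
    field_simp
    rw [h, mul_zero]
  have e4 : (l ^ 3 + a⁻¹ ^ 3)⁻¹ = a ^ 3 * (l ^ 3 * a ^ 3 + 1)⁻¹ := by
    rw [show l ^ 3 + a⁻¹ ^ 3 = (l ^ 3 * a ^ 3 + 1) / a ^ 3 by field_simp, inv_div, div_eq_mul_inv]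
  rw [e4]
  simp only [Matrix.vecMul, dotProduct, Fin.sum_univ_three, Matrix.smul_apply, smul_eq_mul,
    simpleInvNum, Matrix.of_apply, Matrix.cons_val', Fin.isValue, Matrix.cons_val_zero,
    Matrix.cons_val_one, Matrix.cons_val]
  field_simp
  ring

/-- On the unit circle `l̄ = 1/l`, so the determinant of the factor at `1/ᾱ` is minus the conjugate
of that of the factor at `α`. -/
lemma det_sixPole_of_norm_one {α d b₁ c₁ b₂ c₂ l : ℂ} (hα : α ≠ 0) (hl : ‖l‖ = 1) (hd : d ≠ 0)
    (hn₁ : 2 * b₁ * c₁ - 1 ≠ 0) (hn₂ : 2 * b₂ * c₂ - 1 ≠ 0) (h₁ : l ^ 3 ≠ α ^ 3)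
    (h₂ : l ^ 3 ≠ ((starRingEnd ℂ) α)⁻¹ ^ 3) :
    (sixPole α d b₁ c₁ b₂ c₂ l).det = -(negDet α l : ℂ) := by
  have ha : (starRingEnd ℂ) α ≠ 0 := by simpa using hα
  have hl0 : l ≠ 0 := by rintro rfl; simp at hl
  have hlc : (starRingEnd ℂ) l = l⁻¹ := by rw [← inv_inj, conj_inv_of_norm_one hl, inv_inv]
  have hsq : ∀ w : ℂ, ((‖w‖ : ℝ) : ℂ) ^ 2 = w * (starRingEnd ℂ) w := fun w => by
    rw [mul_conj, normSq_eq_norm_sq]; push_cast; rfl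
  rw [det_sixPole hd hn₁ hn₂ h₁ h₂, negDet]
  push_cast
  rw [hsq, hsq]
  simp only [map_add, map_sub, map_pow, hlc]
  have e1 : l ^ 3 - α ^ 3 ≠ 0 := sub_ne_zero.mpr h₁
  have e2 : l ^ 3 - ((starRingEnd ℂ) α)⁻¹ ^ 3 ≠ 0 := sub_ne_zero.mpr h₂
  generalize (starRingEnd ℂ) α = a at *
  have e3 : l ^ 3 * a ^ 3 - 1 ≠ 0 := by
    intro h
    refine e2 ?_
    rw [inv_pow]
    field_simp
    rw [h, mul_zero]
  have f1 : l ^ 3 + a⁻¹ ^ 3 = (l ^ 3 * a ^ 3 + 1) / a ^ 3 := by field_simp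
  have f2 : l ^ 3 - a⁻¹ ^ 3 = (l ^ 3 * a ^ 3 - 1) / a ^ 3 := by field_simp
  have f3 : l⁻¹ ^ 3 + a ^ 3 = (l ^ 3 * a ^ 3 + 1) / l ^ 3 := by field_simp; ring
  have f4 : l⁻¹ ^ 3 - a ^ 3 = -(l ^ 3 * a ^ 3 - 1) / l ^ 3 := by field_simp; ring
  rw [f1, f2, f3, f4]
  field_simp

lemma negDet_pos {α l : ℂ} (h₁ : l ^ 6 ≠ α ^ 6) : 0 < negDet α l := by
  obtain ⟨h1, h2⟩ := pow_three_ne_of_pow_six_ne h₁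
  have h3 := sub_ne_zero.mpr h1
  rw [negDet]
  positivity

lemma rpow_third_cube {x : ℝ} (hx : 0 ≤ x) : (x ^ (1 / 3 : ℝ)) ^ 3 = x := by
  rw [← Real.rpow_natCast, ← Real.rpow_mul hx]
  norm_num

/-- Compared with `conj_surfaceFrame` the factor `-H/2` is missing; dividing `N` by the root of
`-H/2` supplies it. -/
lemma conj_matN {H : ℝ} (hH : H = 2 ∨ H = -2) :
    (matN H).map (starRingEnd ℂ) = matN H * matT H := by
  have hc := conj_sqrt_neg_half hH
  ext i j
  rw [Matrix.mul_apply, Fin.sum_univ_three]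
  simp only [matN, matT, Matrix.map_apply]
  generalize Complex.sqrt ((-H / 2 : ℝ) : ℂ) = k at *
  fin_cases i <;> fin_cases j <;> simp [hc, neg_div]
  ring

lemma det_matN (H : ℝ) : (matN H).det = -I * Complex.sqrt ((-H / 2 : ℝ) : ℂ) := by
  have h2 : ((√2 : ℝ) : ℂ) ^ 2 = 2 := by
    rw [← ofReal_pow, Real.sq_sqrt (by norm_num)]; norm_num
  have h0 : ((√2 : ℝ) : ℂ) ≠ 0 := by
    intro h; rw [h] at h2; norm_num at h2
  rw [Matrix.det_fin_three]
  simp only [matN, Matrix.of_apply, Matrix.cons_val', Fin.isValue, Matrix.cons_val_zero,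
    Matrix.cons_val_one, Matrix.cons_val]
  generalize ((√2 : ℝ) : ℂ) = t at *
  generalize Complex.sqrt ((-H / 2 : ℝ) : ℂ) = k
  field_simp
  linear_combination I * k * h2

namespace DressingData

variable {Ω : Set ℂ} {H ρ : ℝ} {ψ : ℂ → ℝ} {U : ℂ → ℂ} {E : ℂ → ℂ → M3} {α d b₁ c₁ b₂ c₂ : ℂ}

/-- The explicit formula in terms of the frame. -/
lemma dressed_eq (S : DressingData Ω H ρ ψ U E α d b₁ c₁ b₂ c₂) {l : ℂ} (hl : ‖l‖ = 1) (C : M3)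
    {R : ℂ → Fin 3 → ℂ} (hR : ∀ z ∈ Ω, ∀ k, (C * E z l) k 2 = -(H : ℂ) * R z k) {z : ℂ}
    (hz : z ∈ regularSet Ω E α b₁ c₁ b₂ c₂) (k : Fin 3) :
    dressed H ψ E α b₁ c₁ b₂ c₂ l R z k =
      (C * (E z l * (sixPoleT E α b₁ c₁ b₂ c₂ z l)⁻¹)) k 2 := by
  have hl0 : l ≠ 0 := by rintro rfl; simp at hl
  have hk := sqrt_neg_half_sq S.hH
  have hH0 : (H : ℂ) ≠ 0 := by rcases S.hH with rfl | rfl <;> norm_num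
  have h6 := S.pow_ne_of_norm_one hl (n := 6) (by norm_num)
  obtain ⟨hf, e1, e2, e3⟩ := exp_half_identities (ψ z)
  have hs := SolvesOn.const_mul (S.frame.solvesOn S.isOpen hl0) C z hz.1
  have hW : HasW (fun w => R w k)
      (-(H : ℂ)⁻¹ * Complex.sqrt ((-H / 2 : ℝ) : ℂ) * l * (Real.exp (ψ z / 2) : ℝ) *
        (C * E z l) k 0)
      (-(H : ℂ)⁻¹ * Complex.sqrt ((-H / 2 : ℝ) : ℂ) * l⁻¹ * (Real.exp (ψ z / 2) : ℝ) *
        (C * E z l) k 1) z := by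
    refine ((hs k 2).const_mul (-(H : ℂ)⁻¹)).congr (g := fun w => R w k) ?_ |>.congr_deriv ?_ ?_
    · filter_upwards [S.isOpen.mem_nhds hz.1] with w hw
      rw [hR w hw k]; field_simp
    · rw [Matrix.mul_apply (M := C * E z l), Fin.sum_univ_three]
      simp [connZ, -ofReal_exp]; ring
    · rw [Matrix.mul_apply (M := C * E z l), Fin.sum_univ_three]
      simp [connZbar, -ofReal_exp]; ring
  -- The vector fed to `dressingFormula_eq` is row `k` of the frame `C E`, by the derivatives of its
  -- last column.
  have hrow : ![l⁻¹ * (Complex.sqrt ((-2 * H : ℝ) : ℂ) * (Real.exp (-ψ z / 2) : ℂ)) *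
        dz (fun w => R w k) z,
      l * (Complex.sqrt ((-2 * H : ℝ) : ℂ) * (Real.exp (-ψ z / 2) : ℂ)) *
        dzbar (fun w => R w k) z, -(H : ℂ) * R z k] = (C * E z l) k := by
    rw [hW.dz_eq, hW.dzbar_eq, sqrt_neg_two_mul S.hH, e3, ← hR z hz.1 k]
    generalize Complex.sqrt ((-H / 2 : ℝ) : ℂ) = κ at *
    generalize ((Real.exp (ψ z / 2) : ℝ) : ℂ) = f at *
    ext j
    fin_cases j
    · simp
      field_simp
      linear_combination (-2 * (C * E z l) k 0) * hk
    · simp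
      field_simp
      linear_combination (-2 * (C * E z l) k 1) * hk
    · simp
  rw [dressed, dressingFormula_eq S.α_ne_zero hl0 (n₁t_ne_zero hz) (n₂t_ne_zero hz) h6.1 h6.2,
    hrow, sixPoleT_inv, torus_inv (S.dt_ne_zero hz)]
  set M := (simpleElt ((starRingEnd ℂ) α)⁻¹ (b₂t E α b₂ c₂ z) (c₂t E α b₂ c₂ z) l)⁻¹ *
      (simpleElt α (b₁t E α b₁ c₁ b₂ c₂ z) (c₁t E α b₁ c₁ b₂ c₂ z) l)⁻¹
  -- The torus factor has last entry `1`, so it does not affect the last column; this is why `d̃` is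
  -- absent from the formula.
  rw [← mul_assoc, ← mul_assoc, torus, Matrix.mul_diagonal]
  simp only [Matrix.cons_val, mul_one]
  rfl

/-- Dressed affine spheres: `C` is a constant frame compatible with the real structure. -/
theorem exists_dressed_sphere (S : DressingData Ω H ρ ψ U E α d b₁ c₁ b₂ c₂) {Et : ℂ → ℂ → M3}
    (hL : ∀ z ∈ regularSet Ω E α b₁ c₁ b₂ c₂, InLoopSL H (Et z))
    (hf : ∀ z ∈ regularSet Ω E α b₁ c₁ b₂ c₂, ∀ l : ℂ, l ≠ 0 → l ^ 3 ≠ α ^ 3 →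
      l ^ 3 ≠ ((starRingEnd ℂ) α)⁻¹ ^ 3 →
        sixPole α d b₁ c₁ b₂ c₂ l * E z l = Et z l * sixPoleT E α b₁ c₁ b₂ c₂ z l)
    (hEt : IsExtendedFrame (regularSet Ω E α b₁ c₁ b₂ c₂) H (psiT ψ E α b₁ c₁ b₂ c₂) U Et)
    {l : ℂ} (hl : ‖l‖ = 1) {C : M3} {c : ℝ}
    (hC : C.map (starRingEnd ℂ) = (-(H : ℂ) / 2) • (C * matT H))
    (hdet : (c : ℂ) ^ 3 * C.det = I * H * negDet α l) :
    ∃ rt : ℂ → Fin 3 → ℝ,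
      (∀ z ∈ regularSet Ω E α b₁ c₁ b₂ c₂, ∀ k, (rt z k : ℂ) = -(H : ℂ)⁻¹ * c *
        (C * (E z l * (sixPoleT E α b₁ c₁ b₂ c₂ z l)⁻¹)) k 2) ∧
      IsDefiniteAffineSphere (regularSet Ω E α b₁ c₁ b₂ c₂) rt
        (psiT ψ E α b₁ c₁ b₂ c₂) (fun z => l ^ 3 * U z) H ∧
      ∃ K : M3, ∀ z ∈ regularSet Ω E α b₁ c₁ b₂ c₂,
        surfaceFrame H (psiT ψ E α b₁ c₁ b₂ c₂) rt l z = K * Et z l := by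
  have hl0 : l ≠ 0 := by rintro rfl; simp at hl
  have hH0 : (H : ℂ) ≠ 0 := by rcases S.hH with rfl | rfl <;> norm_num
  have h6 := S.pow_ne_of_norm_one hl (n := 6) (by norm_num)
  have h3 := S.pow_ne_of_norm_one hl (n := 3) (by norm_num)
  set h := sixPole α d b₁ c₁ b₂ c₂ l with hh
  have hhdet : h.det ≠ 0 := det_sixPole_ne_zero S.d_ne_zero S.n₁_ne_zero S.n₂_ne_zero h6.1 h6.2
  have hhu : IsUnit h.det := isUnit_iff_ne_zero.mpr hhdet
  have hhtau : tau H h = h :=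
    tau_sixPole_of_norm_one S.hH S.pos S.lt_norm S.norm_lt S.norm_ne_one S.tau_eq hl
  -- The frame of the new surface is `c C h⁻¹ Ẽ = c C E h̃⁻¹`. As `det h = -κ`, the condition `c³
  -- det C = i H κ` gives it the determinant `-i H`, and a real `c` preserves the reality condition
  -- on `C`.
  set C' : M3 := (c : ℂ) • C with hC'
  have hC'c : C'.map (starRingEnd ℂ) = (-(H : ℂ) / 2) • (C' * matT H) := by
    have : C'.map (starRingEnd ℂ) = (c : ℂ) • C.map (starRingEnd ℂ) := by
      ext i j; simp [hC']
    rw [this, hC, hC', Matrix.smul_mul, smul_comm]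
  have hA : ∀ z ∈ regularSet Ω E α b₁ c₁ b₂ c₂,
      h⁻¹ * Et z l = E z l * (sixPoleT E α b₁ c₁ b₂ c₂ z l)⁻¹ := by
    intro z hz
    have hu : IsUnit (sixPoleT E α b₁ c₁ b₂ c₂ z l).det := isUnit_iff_ne_zero.mpr
      (det_sixPole_ne_zero (S.dt_ne_zero hz) (n₁t_ne_zero hz) (n₂t_ne_zero hz) h6.1 h6.2)
    calc h⁻¹ * Et z l = h⁻¹ * (Et z l * sixPoleT E α b₁ c₁ b₂ c₂ z l) *
          (sixPoleT E α b₁ c₁ b₂ c₂ z l)⁻¹ := by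
          rw [mul_assoc, mul_assoc, Matrix.mul_nonsing_inv _ hu, mul_one]
      _ = _ := by
          rw [← hf z hz l hl0 h3.1 h3.2, ← mul_assoc, ← hh, Matrix.nonsing_inv_mul _ hhu, one_mul]
  have hAtau : ∀ z ∈ regularSet Ω E α b₁ c₁ b₂ c₂, tau H (h⁻¹ * Et z l) = h⁻¹ * Et z l := by
    intro z hz
    have ht := (hL z hz).tau_eq l hl0
    rw [conj_inv_of_norm_one hl] at ht
    rw [tau_mul S.hH, tau_inv S.hH _ hhdet, hhtau, ht]
  refine ⟨fun z k => (-(H : ℂ)⁻¹ * (C' * (h⁻¹ * Et z l)) k 2).re, fun z hz k => ?_, ?_⟩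
  · obtain ⟨x, hx⟩ := conj_eq_iff_real.mp (last_column_real S.hH hC'c (hAtau z hz) k)
    change (((-(H : ℂ)⁻¹ * (C' * (h⁻¹ * Et z l)) k 2).re : ℝ) : ℂ) = _
    have e : (C' * (h⁻¹ * Et z l)) k 2 =
        c * (C * (E z l * (sixPoleT E α b₁ c₁ b₂ c₂ z l)⁻¹)) k 2 := by
      rw [hA z hz, hC', Matrix.smul_mul, Matrix.smul_apply, smul_eq_mul]
    rw [mul_assoc, ← e, hx, show -(H : ℂ)⁻¹ * (x : ℂ) = ((-H⁻¹ * x : ℝ) : ℂ) by push_cast; rfl,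
      ofReal_re]
  · have hs := SolvesOn.const_mul (hEt.solvesOn S.isOpen_regularSet hl0) (C' * h⁻¹)
    have key := sphere_of_frame (r := fun z k => (-(H : ℂ)⁻¹ * (C' * (h⁻¹ * Et z l)) k 2).re)
      S.isOpen_regularSet S.hH S.smooth_psiT (S.smooth_cubic.mono regularSet_subset) hl0 hs
      (fun z hz => ?_) (fun z hz k => ?_)
    · exact ⟨key.1, C' * h⁻¹, key.2⟩
    · have hd : h.det = -(negDet α l : ℂ) := det_sixPole_of_norm_one S.α_ne_zero hl S.d_ne_zero
        S.n₁_ne_zero S.n₂_ne_zero h3.1 h3.2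
      have hn0 : (negDet α l : ℂ) ≠ 0 := ofReal_ne_zero.mpr (negDet_pos h6.1).ne'
      rw [Matrix.det_mul, Matrix.det_mul, (hL z hz).det_eq_one l hl0, Matrix.det_nonsing_inv,
        Ring.inverse_eq_inv', hd, hC', Matrix.det_smul, Fintype.card_fin, hdet]
      field_simp
    · obtain ⟨x, hx⟩ := conj_eq_iff_real.mp (last_column_real S.hH hC'c (hAtau z hz) k)
      change (C' * h⁻¹ * Et z l) k 2 =
        -(H : ℂ) * ((-(H : ℂ)⁻¹ * (C' * (h⁻¹ * Et z l)) k 2).re : ℂ)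
      rw [mul_assoc C', hx, show -(H : ℂ)⁻¹ * (x : ℂ) = ((-H⁻¹ * x : ℝ) : ℂ) by push_cast; rfl,
        ofReal_re]
      push_cast
      field_simp

end DressingData

end AffineSphere

end

/-! ### Assembly of the theorem -/

theorem theorem5p5 (H : ℝ) (hH : H = 2 ∨ H = -2) (D : Set ℂ) (hD : IsOpen D)
    (r : ℂ → Fin 3 → ℝ) (ψ : ℂ → ℝ) (U : ℂ → ℂ) (hr : IsDefiniteAffineSphere D r ψ U H) :
    -- the normalized local frame exists
    (∀ Ω ⊆ D, IsOpen Ω → (0 : ℂ) ∈ Ω → StarConvex ℝ 0 Ω →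
      ∃ E, IsNormalizedFrame Ω H ψ U E) ∧
    ∀ Ω ⊆ D, IsOpen Ω → IsPreconnected Ω → (0 : ℂ) ∈ Ω →
    ∀ E : ℂ → ℂ → Matrix (Fin 3) (Fin 3) ℂ, IsNormalizedFrame Ω H ψ U E →
      -- it takes values in the twisted loop group and frames a family of affine spheres
      (∀ z ∈ Ω, InLoopSL H (E z)) ∧
      ∃ rfam : ℂ → ℂ → Fin 3 → ℝ,
        (∀ z ∈ Ω, rfam 1 z = r z) ∧
        (∀ l : ℂ, ‖l‖ = 1 →
          IsDefiniteAffineSphere Ω (rfam l) ψ (fun z => l ^ 3 * U z) H ∧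
          ∀ z ∈ Ω, surfaceFrame H ψ (rfam l) l z = surfaceFrame H ψ (rfam l) l 0 * E z l) ∧
        -- dressing by a six-pole element
        ∀ (ρ : ℝ) (α d b₁ c₁ b₂ c₂ : ℂ), 0 < ρ → ρ < 1 → ρ < ‖α‖ → ‖α‖ < ρ⁻¹ → ‖α‖ ≠ 1 →
          d ≠ 0 → ![b₁, c₁, 1] ∉ cone → ![b₂, c₂, 1] ∉ cone →
          InLoopI H ρ (sixPole α d b₁ c₁ b₂ c₂) →
          IsOpen (regularSet Ω E α b₁ c₁ b₂ c₂) ∧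
          ∃ Et : ℂ → ℂ → Matrix (Fin 3) (Fin 3) ℂ,
            -- the factorization
            (∀ z ∈ regularSet Ω E α b₁ c₁ b₂ c₂,
              InLoopSL H (Et z) ∧ InLoopI H ρ (sixPoleT E α b₁ c₁ b₂ c₂ z) ∧
              ∀ l : ℂ, l ≠ 0 → l ^ 3 ≠ α ^ 3 → l ^ 3 ≠ ((starRingEnd ℂ) α)⁻¹ ^ 3 →
                sixPole α d b₁ c₁ b₂ c₂ l * E z l =
                  Et z l * sixPoleT E α b₁ c₁ b₂ c₂ z l) ∧
            -- the new frame
            IsExtendedFrame (regularSet Ω E α b₁ c₁ b₂ c₂) H (psiT ψ E α b₁ c₁ b₂ c₂) U Et ∧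
            -- the new affine spheres
            ∀ l : ℂ, ‖l‖ = 1 →
              (∃ rt : ℂ → Fin 3 → ℝ,
                (∀ z ∈ regularSet Ω E α b₁ c₁ b₂ c₂, ∀ k, (rt z k : ℂ) =
                  ((2 * negDet α l) ^ (1 / 3 : ℝ) : ℝ)
                    * (-(H : ℂ) * Complex.sqrt ((-H / 2 : ℝ) : ℂ))⁻¹
                    * (matN H *ᵥ dressed H ψ E α b₁ c₁ b₂ c₂ l
                        (normalizedPosition H E l) z) k) ∧
                IsDefiniteAffineSphere (regularSet Ω E α b₁ c₁ b₂ c₂) rt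
                  (psiT ψ E α b₁ c₁ b₂ c₂) (fun z => l ^ 3 * U z) H ∧
                ∃ K : Matrix (Fin 3) (Fin 3) ℂ, ∀ z ∈ regularSet Ω E α b₁ c₁ b₂ c₂,
                  surfaceFrame H (psiT ψ E α b₁ c₁ b₂ c₂) rt l z = K * Et z l) ∧
              ∃ rt : ℂ → Fin 3 → ℝ,
                (∀ z ∈ regularSet Ω E α b₁ c₁ b₂ c₂, ∀ k, (rt z k : ℂ) =
                  ((negDet α l ^ (1 / 3 : ℝ) : ℝ) : ℂ) * (H : ℂ)⁻¹
                    * dressed H ψ E α b₁ c₁ b₂ c₂ l (fun w k => (rfam l w k : ℂ)) z k) ∧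
                IsDefiniteAffineSphere (regularSet Ω E α b₁ c₁ b₂ c₂) rt
                  (psiT ψ E α b₁ c₁ b₂ c₂) (fun z => l ^ 3 * U z) H ∧
                ∃ K : Matrix (Fin 3) (Fin 3) ℂ, ∀ z ∈ regularSet Ω E α b₁ c₁ b₂ c₂,
                  surfaceFrame H (psiT ψ E α b₁ c₁ b₂ c₂) rt l z = K * Et z l := by
  obtain ⟨hS, hψ⟩ := structureEq_of_sphere hD hr
  have hU := contDiffOn_cubic hD hH hS hψ
  have hGC := gaussCodazzi_of_sphere hD hH hS hψ
  have hH0 : (H : ℂ) ≠ 0 := by rcases hH with rfl | rfl <;> norm_num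
  have hH2 : (H : ℂ) ^ 2 = 4 := by rcases hH with rfl | rfl <;> norm_num
  refine ⟨fun Ω hsub hΩ h0 hs => exists_normalizedFrame hΩ h0 hs hH (hψ.mono hsub) (hU.mono hsub)
    fun z hz => hGC z (hsub hz), fun Ω hsub hΩ hc h0 E hE => ?_⟩
  have hL : ∀ z ∈ Ω, InLoopSL H (E z) := fun z hz => inLoopSL_of_normalizedFrame hΩ hc h0 hH
    (hψ.mono hsub) (hU.mono hsub) (fun z hz => hGC z (hsub hz)) hE hz
  obtain ⟨rfam, h1, C, hCdet, hC, hfam⟩ :=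
    exists_associated_family hD hsub hΩ hc h0 hH hS hψ hE hL
  have hne : ∀ l : ℂ, ‖l‖ = 1 → l ≠ 0 := by rintro l hl rfl; simp at hl
  refine ⟨hL, rfam, h1, fun l hl => ⟨(hfam l hl).1, fun z hz => ?_⟩, ?_⟩
  · rw [(hfam l hl).2 z hz, (hfam l hl).2 0 h0, hE.base l (hne l hl), mul_one]
  intro ρ α d b₁ c₁ b₂ c₂ hρ _ hρα hαρ hα1 hd hc₁ hc₂ hI
  have hn : ∀ b c : ℂ, ![b, c, 1] ∉ cone → 2 * b * c - 1 ≠ 0 := fun b c h => by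
    simpa [lineB, lineC] using (not_mem_cone_iff.mp h).2
  have S : DressingData Ω H ρ ψ U E α d b₁ c₁ b₂ c₂ := ⟨hΩ, hH, hψ.mono hsub, hU.mono hsub,
    hE.toIsExtendedFrame, hL, hρ, hρα, hαρ, hα1, hd, hn _ _ hc₁, hn _ _ hc₂, hI.tau_eq⟩
  obtain ⟨Et, hEt, hframe⟩ := S.exists_dressed_frame
  refine ⟨S.isOpen_regularSet, Et, hEt, hframe, fun l hl => ?_⟩
  have hκ := negDet_pos (S.pow_ne_of_norm_one hl (n := 6) (by norm_num)).1
  have hLt := fun z hz => (hEt z hz).1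
  have hft := fun z hz => (hEt z hz).2.2
  constructor
  · have hk := sqrt_neg_half_sq hH
    have hk0 := sqrt_neg_half_ne_zero hH
    have hkc := conj_sqrt_neg_half hH
    have hcube : ((((2 * negDet α l) ^ (1 / 3 : ℝ) : ℝ) : ℂ)) ^ 3 = 2 * negDet α l := by
      rw [← Complex.ofReal_pow, rpow_third_cube (by positivity)]; push_cast; rfl
    -- With `k² = -H/2` one has `det(k⁻¹ N) = -i/k² = 2i/H`; since `H² = 4`, the determinant
    -- condition becomes `c³ = 2κ`.
    obtain ⟨rt, e, hsph, hK⟩ := S.exists_dressed_sphere hLt hft hframe hl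
      (C := (Complex.sqrt ((-H / 2 : ℝ) : ℂ))⁻¹ • matN H) (c := (2 * negDet α l) ^ (1 / 3 : ℝ))
      (by
        have : ((Complex.sqrt ((-H / 2 : ℝ) : ℂ))⁻¹ • matN H).map (starRingEnd ℂ) =
            (starRingEnd ℂ) (Complex.sqrt ((-H / 2 : ℝ) : ℂ))⁻¹ •
              (matN H).map (starRingEnd ℂ) := by
          ext i j; simp
        rw [this, conj_matN hH, map_inv₀, hkc, Matrix.smul_mul, smul_smul]
        congr 1
        generalize Complex.sqrt ((-H / 2 : ℝ) : ℂ) = k at *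
        field_simp
        linear_combination hH2)
      (by
        rw [hcube, Matrix.det_smul, det_matN, Fintype.card_fin]
        generalize Complex.sqrt ((-H / 2 : ℝ) : ℂ) = k at *
        field_simp
        rw [hk]
        linear_combination hH2 / 2)
    refine ⟨rt, fun z hz k => ?_, hsph, hK⟩
    have hcol : ∀ j, dressed H ψ E α b₁ c₁ b₂ c₂ l (normalizedPosition H E l) z j =
        (E z l * (sixPoleT E α b₁ c₁ b₂ c₂ z l)⁻¹) j 2 := fun j => by
      rw [S.dressed_eq hl 1 (fun w _ i => by
        rw [one_mul, normalizedPosition]; field_simp) hz j, one_mul]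
    rw [e z hz k, Matrix.smul_mul, Matrix.smul_apply, smul_eq_mul, Matrix.mul_apply,
      Matrix.mulVec, dotProduct]
    simp only [hcol]
    rw [mul_inv, inv_neg]
    ring
  · have hcube : (((-(negDet α l ^ (1 / 3 : ℝ)) : ℝ) : ℂ)) ^ 3 = -(negDet α l : ℂ) := by
      rw [← Complex.ofReal_pow, Odd.neg_pow (by decide), rpow_third_cube hκ.le, Complex.ofReal_neg]
    -- Here `det C = -i H`, so `c³ = -κ`; the negative sign of `c` turns the factor `-H⁻¹` into the
    -- `H⁻¹` of the formula.
    obtain ⟨rt, e, hsph, hK⟩ := S.exists_dressed_sphere hLt hft hframe hl (C := C)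
      (c := -(negDet α l ^ (1 / 3 : ℝ))) hC (by rw [hcube, hCdet]; ring)
    refine ⟨rt, fun z hz k => ?_, hsph, hK⟩
    rw [e z hz k, S.dressed_eq hl C (fun w hw i => by rw [← (hfam l hl).2 w hw]; rfl) hz k]
    push_cast
    ring
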